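/- Let $\mathbb{D}=\{z\in\mathbb{C}:|z|<1\}$. Let $\mathcal{H}$ be the class of complex-valued harmonic functions $f$ in $\mathbb{D}$ with $f(0)=0$, $f_z(0)=1$, $f_{\bar z}(0)=0$; each such $f$ is written $f=h+\bar g$ with $h(z)=z+\sum_{n\ge2}a_nz^n$ and $g(z)=\sum_{n\ge2}b_nz^n$ analytic in $\mathbb{D}$. Let $\mathcal{A}\subset\mathcal{H}$ be the class of analytic functions $f$ in $\mathbb{D}$ with $f(0)=0$, $f'(0)=1$, let $\mathcal{S}\subset\mathcal{A}$ be the class of univalent ones, $\mathcal{K}\subset\mathcal{S}$ the class of those mapping $\mathbb{D}$ onto a convex domain, and $\mathcal{R}=\{f\in\mathcal{A}:\operatorname{Re}f'>0\text{ in }\mathbb{D}\}$. A domain is close-to-convex if its complement is a union of half-lines no two of which intersect, except that the origin of one may lie on another. A function is convex (resp. close-to-convex) in $|z|<r$ if it maps this disk univalently onto a convex (resp. close-to-convex) domain. The radius of convexity $r_C$ (resp. of close-to-convexity $r_{CC}$) of a class is the largest $r_0\in(0,1]$ such that every member of the class is convex (resp. close-to-convex) in $|z|<r$ for each $0<r\le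 r_0$; the values below are also such that for each $r_0<r\le1$ some member fails the property in $|z|<r$. Let $\mathcal{SC}_H^0$ be the class of $f=h+\bar g\in\mathcal{H}$ that are univalent and sense-preserving ($|f_{\bar z}|<|f_z|$) in $\mathbb{D}$ and for which $h+\lambda\bar g$ is close-to-convex in $\mathbb{D}$ for each $|\lambda|=1$. For $\mathcal{G}\subset\mathcal{S}$, the harmonic analogue of $\mathcal{G}$ is the class of functions $h+\bar g$, with $h,g$ analytic in $\mathbb{D}$, such that $h+\epsilon g\in\mathcal{G}$ for each $|\epsilon|=1$. For $f=h+\bar g$ harmonic and $\varphi$ analytic in $\mathbb{D}$ put $f\,\tilde*\,\varphi=h*\varphi+\overline{g*\varphi}$, where $*$ is the Hadamard product (coefficientwise product of Taylor series at $0$). Theorem. We have $\mathcal{R}\subset\mathcal{S}$, and the harmonic analogue of $\mathcal{R}$ is $$\mathcal{R}_H^0=\{f=h+\bar g\in\mathcal{H}:\operatorname{Re}h'(z)>|g'(z)|\text{ for all }z\in\mathbb{D}\}.$$ Moreover $\mathcal{R}_H^0\subset\mathcal{SC}_H^0$, the function $f_0(z)=-z-2\log(1-z)=z+\sum_{n\ge2}\frac2nz^n$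 belongs to $\mathcal{R}_H^0$, and: (i) If $f=h+\bar g\in\mathcal{R}_H^0$, then $\big||a_n|-|b_n|\big|\le 2/n$ for all $n\ge2$, with equality for all $n\ge 2$ if $f=f_0$. (ii) Every $f\in\mathcal{R}_H^0$ satisfies $-|z|+2\log(1+|z|)\le|f(z)|\le-|z|-2\log(1-|z|)$ for $z\in\mathbb{D}$, and $f(\mathbb{D})$ contains the disk $|w|<2\log2-1$. These results are sharp for $f_0$: for every $0\le r<1$ each of the two bounds is attained by $f_0$ at some $z$ with $|z|=r$, and $f_0(\mathbb{D})$ contains no disk $|w|<\rho$ with $\rho>2\log2-1$. (iii) $\mathcal{R}_H^0$ is compact in the topology of locally uniform convergence in $\mathbb{D}$. (iv) $r_C(\mathcal{R}_H^0)=\sqrt2-1$ and $r_{CC}(\mathcal{R}_H^0)=1$. (v) If $f\in\mathcal{R}_H^0$ and $\varphi\in\mathcal{K}$, then $f\,\tilde*\,\varphi\in\mathcal{R}_H^0$. If $f\in\mathcal{R}_H^0$ and $\varphi\in\mathcal{A}$ satisfies $\operatorname{Re}(\varphi(z)/z)>1/2$ for $z\in\mathbb{D}\setminus\{0\}$, then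 $f\,\tilde*\,\varphi\in\mathcal{R}_H^0$. (vi) $\mathcal{R}_H^0$ is closed under convex combinations: if $f_n\in\mathcal{R}_H^0$, $t_n\ge0$ for $n\ge1$ and $\sum_{n\ge1} t_n=1$, then $\sum_{n\ge1} t_nf_n$ converges in $\mathbb{D}$ and belongs to $\mathcal{R}_H^0$. -/

import Mathlib

namespace HarmonicMappings

open Metric Set
open scoped ComplexConjugate

/-- The open unit disk. Functions on the disk are modelled by functions `ℂ → ℂ`; every class below
only depends on the values of its members on the disk. -/
abbrev unitDisk : Set ℂ := ball (0 : ℂ) 1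

/-- The Wirtinger derivative `f_z = (f_x - i f_y) / 2`. -/
noncomputable def dz (f : ℂ → ℂ) (z : ℂ) : ℂ :=
  (fderiv ℝ f z 1 - Complex.I * fderiv ℝ f z Complex.I) / 2

/-- The Wirtinger derivative `f_{z̄} = (f_x + i f_y) / 2`. -/
noncomputable def dzbar (f : ℂ → ℂ) (z : ℂ) : ℂ :=
  (fderiv ℝ f z 1 + Complex.I * fderiv ℝ f z Complex.I) / 2

/-- The class `𝓗`: complex-valued harmonic functions in the disk with
`f(0) = 0 = f_z(0) - 1 = f_{z̄}(0)`. -/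
def classH : Set (ℂ → ℂ) :=
  {f | InnerProductSpace.HarmonicOnNhd f unitDisk ∧ f 0 = 0 ∧ dz f 0 = 1 ∧ dzbar f 0 = 0}

/-- `f = h + ḡ` in the disk, with `h` and `g` analytic in the disk. -/
def IsDecomp (f h g : ℂ → ℂ) : Prop :=
  DifferentiableOn ℂ h unitDisk ∧ DifferentiableOn ℂ g unitDisk ∧
    ∀ z ∈ unitDisk, f z = h z + conj (g z)

/-- `f = h + ḡ` is the canonical decomposition, normalized by `g(0) = 0`; it determines `h` and
`g` uniquely in the disk. -/
def IsCanonicalDecomp (f h g : ℂ → ℂ) : Prop :=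
  IsDecomp f h g ∧ g 0 = 0

/-- The class `𝓐` of normalized analytic functions. -/
def classA : Set (ℂ → ℂ) :=
  {f | DifferentiableOn ℂ f unitDisk ∧ f 0 = 0 ∧ deriv f 0 = 1}

/-- The class `𝓢` of normalized analytic univalent functions. -/
def classS : Set (ℂ → ℂ) :=
  {f | f ∈ classA ∧ InjOn f unitDisk}

/-- The class `𝓚` of normalized analytic univalent functions mapping the disk onto a convex
domain. -/
def classK : Set (ℂ → ℂ) :=
  {f | f ∈ classS ∧ Convex ℝ (f '' unitDisk)}

/-- The class `𝓡`: `f ∈ 𝓐` with `Re f' > 0` in the disk. -/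
def classR : Set (ℂ → ℂ) :=
  {f | f ∈ classA ∧ ∀ z ∈ unitDisk, 0 < (deriv f z).re}

/-- The class `𝓢_H⁰`: univalent sense-preserving members of `𝓗`. -/
def classSH0 : Set (ℂ → ℂ) :=
  {f | f ∈ classH ∧ InjOn f unitDisk ∧ ∀ z ∈ unitDisk, ‖dzbar f z‖ < ‖dz f z‖}

/-- The class `𝓡_H⁰`: `f = h + ḡ ∈ 𝓗` with `Re h' > |g'|` in the disk. -/
def classRH0 : Set (ℂ → ℂ) :=
  {f | f ∈ classH ∧ ∃ h g : ℂ → ℂ, IsCanonicalDecomp f h g ∧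
    ∀ z ∈ unitDisk, ‖deriv g z‖ < (deriv h z).re}

/-- `GH` is the harmonic analogue of the subfamily `G` of `𝓢`: it consists of the harmonic
functions `h + ḡ` for which `h + ε g ∈ G` for each `|ε| = 1`. -/
def IsHarmonicAnalogue (G GH : Set (ℂ → ℂ)) : Prop :=
  G ⊆ classS ∧
    GH = {f | ∃ h g : ℂ → ℂ, IsDecomp f h g ∧
      ∀ ε : ℂ, ‖ε‖ = 1 → (fun z ↦ h z + ε * g z) ∈ G}

/-- The closed half-line from `p` in the direction `v`. -/
def closedRay (p v : ℂ) : Set ℂ := {w | ∃ t : ℝ, 0 ≤ t ∧ w = p + t * v}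

/-- The half-line from `p` in the direction `v`, without its origin `p`. -/
def openRay (p v : ℂ) : Set ℂ := {w | ∃ t : ℝ, 0 < t ∧ w = p + t * v}

/-- A close-to-convex domain: its complement is a union of half-lines, no two of which intersect,
except that the origin of one of them may lie on another one. -/
def IsCloseToConvexDomain (Ω : Set ℂ) : Prop :=
  IsOpen Ω ∧ IsConnected Ω ∧
    ∃ L : Set (ℂ × ℂ), (∀ p ∈ L, p.2 ≠ 0) ∧
      Ωᶜ = ⋃ p ∈ L, closedRay p.1 p.2 ∧
      L.Pairwise fun p q ↦ Disjoint (openRay p.1 p.2) (openRay q.1 q.2)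

/-- `f` is convex in `|z| < r`: it maps that disk univalently onto a convex domain. -/
def ConvexInDisk (f : ℂ → ℂ) (r : ℝ) : Prop :=
  InjOn f (ball 0 r) ∧ Convex ℝ (f '' ball 0 r)

/-- `f` is close-to-convex in `|z| < r`: it maps that disk univalently onto a close-to-convex
domain. -/
def CloseToConvexInDisk (f : ℂ → ℂ) (r : ℝ) : Prop :=
  InjOn f (ball 0 r) ∧ IsCloseToConvexDomain (f '' ball 0 r)

/-- The class `𝓢𝓒_H⁰` of stable close-to-convex mappings: members `f = h + ḡ` of `𝓢_H⁰` for which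
`h + λ ḡ` is close-to-convex in the unit disk for each `|λ| = 1`. -/
def classSCH0 : Set (ℂ → ℂ) :=
  {f | f ∈ classSH0 ∧ ∃ h g : ℂ → ℂ, IsCanonicalDecomp f h g ∧
    ∀ l : ℂ, ‖l‖ = 1 → CloseToConvexInDisk (fun z ↦ h z + l * conj (g z)) 1}

/-- `r₀` is the radius of the property `P` for the class `G`: for `0 < r ≤ 1`, all members of `G`
have property `P` in `|z| < r` exactly if `r ≤ r₀`. In particular `r₀` is the largest `r ∈ (0, 1]`
for which all members of `G` have property `P` in `|z| < r`. -/
def IsRadius (P : (ℂ → ℂ) → ℝ → Prop) (G : Set (ℂ → ℂ)) (r₀ : ℝ) : Prop :=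
  r₀ ∈ Ioc (0 : ℝ) 1 ∧ ∀ r ∈ Ioc (0 : ℝ) 1, (∀ f ∈ G, P f r) ↔ r ≤ r₀

/-- `r₀` is the radius of convexity `r_C(G)`. -/
def IsRadiusOfConvexity (G : Set (ℂ → ℂ)) (r₀ : ℝ) : Prop :=
  IsRadius ConvexInDisk G r₀

/-- `r₀` is the radius of close-to-convexity `r_CC(G)`. -/
def IsRadiusOfCloseToConvexity (G : Set (ℂ → ℂ)) (r₀ : ℝ) : Prop :=
  IsRadius CloseToConvexInDisk G r₀

/-- The `n`-th Taylor coefficient at the origin. -/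
noncomputable def taylorCoeff (f : ℂ → ℂ) (n : ℕ) : ℂ :=
  iteratedDeriv n f 0 / (n.factorial : ℂ)

/-- The Hadamard product of two functions analytic in the disk. -/
noncomputable def hadamard (f F : ℂ → ℂ) (z : ℂ) : ℂ :=
  ∑' n : ℕ, taylorCoeff f n * taylorCoeff F n * z ^ n

/-- The product `f ⋆̃ φ = h * φ + conj (g * φ)` of the harmonic function `f = h + ḡ` and the
analytic function `φ`. -/
noncomputable def harmonicHadamard (h g φ : ℂ → ℂ) (z : ℂ) : ℂ :=
  hadamard h φ z + conj (hadamard g φ z)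

/-- The extremal function `-z - 2 log (1 - z)`. -/
noncomputable def extremalFun (z : ℂ) : ℂ := -z - 2 * Complex.log (1 - z)

end HarmonicMappings

open HarmonicMappings

namespace HarmonicMappings

open Metric Set Filter Topology
open scoped ComplexConjugate

/-! ### Functions with nonnegative real part -/

/-! Everything rests on one equivalence: `|g'| ≤ Re h'` holds exactly when `Re (h' + ε g') ≥ 0` for
all `|ε| = 1` (`forall_re_add_mul_nonneg_iff`). Each `h' + ε g'` is then a Carathéodory function
with value 1 at 0, and choosing the worst `ε` at a point or for a coefficient turns the classical
bounds into bounds for `Re h' - |g'|`, `|h'| + |g'|` and `|a_n| + |b_n|`. Since the lower bound is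
positive, the non-strict inequality already implies the strict one, so the class is described by a
closed condition (`IsRPair`). Compactness, convex combinations and convolutions therefore need only
non-strict inequalities.

Univalence, close-to-convexity and covering come from monotone operator theory. On closed subdisks
`f` is strongly monotone: `Re ((f x - f y) conj (x - y)) ≥ c |x - y|²`. Hence each `y` can be
written `f p + t p` with `t ≥ 0`, `|p| ≤ r`, and `t = 0` unless `|p| = r` (`exists_eq_add_smul`).
For omitted `y`, letting `r` grow to the full radius gives a direction `P y`, monotone in `y`; the
half-lines along `P` fill the complement without crossing (`isCloseToConvexDomain`). The same
representation combined with the radial growth estimate gives the covering disk.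

For the radius of convexity, Schwarz-Pick gives `|z p'| ≤ |p|` for `p = h' + ε g'` when `|z| ≤ √2 -
1`. An algebraic lemma (`re_mul_conj_nonneg_of_forall`) transfers this curvature condition from all
`h + ε g` to the harmonic map. The tangent of each image circle turns monotonically through `2π`, so
the curve has supporting lines, and the representation `f p + t p` finishes convexity. The function
`-z - 2 log (1 - z)` shows sharpness, through its symmetry in the real axis.

Convolution preserves the class because convolving with `φ(z)/z = (1 + q)/2`, `Re q ≥ 0`, is
averaging against the positive weight `Re q`. For convex `φ` the hypothesis `Re (φ(z)/z) > 1/2` is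
the Marx-Strohhäcker inequality, proved in `half_le_re_div`. -/

/-- The imaginary parts on the two sides agree, and the squares differ by `4 Re p Re a`. This makes
the Cayley transform `(p - a) / (p + conj a)` a map of the right half-plane into the disk. -/
lemma norm_sub_le_norm_add_conj {p a : ℂ} (hp : 0 ≤ p.re) (ha : 0 ≤ a.re) :
    ‖p - a‖ ≤ ‖p + conj a‖ := by
  rw [← sq_le_sq₀ (norm_nonneg _) (norm_nonneg _), ← Complex.normSq_eq_norm_sq,
    ← Complex.normSq_eq_norm_sq, Complex.normSq_apply, Complex.normSq_apply]
  simp only [Complex.sub_re, Complex.sub_im, Complex.add_re, Complex.add_im, Complex.conj_re,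
    Complex.conj_im]
  nlinarith [mul_nonneg hp ha]

lemma add_conj_ne_zero {p a : ℂ} (hp : 0 ≤ p.re) (ha : 0 < a.re) : p + conj a ≠ 0 := by
  intro h
  have := congrArg Complex.re h
  simp at this
  linarith

section Caratheodory

variable {p : ℂ → ℂ} {R : ℝ}

lemma differentiableOn_cayley (hd : DifferentiableOn ℂ p (ball 0 R))
    (hp : ∀ z ∈ ball (0 : ℂ) R, 0 ≤ (p z).re) (h0 : 0 < (p 0).re) :
    DifferentiableOn ℂ (fun z ↦ (p z - p 0) / (p z + conj (p 0))) (ball 0 R) :=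
  (hd.sub_const _).div (hd.add_const _) fun z hz ↦ add_conj_ne_zero (hp z hz) h0

lemma mapsTo_cayley (hp : ∀ z ∈ ball (0 : ℂ) R, 0 ≤ (p z).re) (h0 : 0 < (p 0).re) :
    MapsTo (fun z ↦ (p z - p 0) / (p z + conj (p 0))) (ball 0 R)
      (closedBall ((p 0 - p 0) / (p 0 + conj (p 0))) 1) := by
  intro z hz
  simp only [sub_self, zero_div, mem_closedBall, dist_zero_right, norm_div]
  exact div_le_one_of_le₀ (norm_sub_le_norm_add_conj (hp z hz) h0.le) (norm_nonneg _)

/-- Carathéodory's bound for the first coefficient. -/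
lemma norm_deriv_zero_le (hR : 0 < R) (hd : DifferentiableOn ℂ p (ball 0 R))
    (hp : ∀ z ∈ ball (0 : ℂ) R, 0 ≤ (p z).re) (h0 : 0 < (p 0).re) :
    ‖deriv p 0‖ ≤ 2 * (p 0).re / R := by
  have h := Complex.norm_deriv_le_div_of_mapsTo_ball (differentiableOn_cayley hd hp h0)
    (mapsTo_cayley hp h0) hR
  have hp0 : DifferentiableAt ℂ p 0 := hd.differentiableAt (ball_mem_nhds _ hR)
  have hne := add_conj_ne_zero h0.le h0
  have hder : deriv (fun z ↦ (p z - p 0) / (p z + conj (p 0))) 0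
      = deriv p 0 / (p 0 + conj (p 0)) := by
    rw [((hp0.hasDerivAt.sub_const (p 0)).fun_div (hp0.hasDerivAt.add_const (conj (p 0))) hne).deriv]
    field_simp
    ring
  rw [hder, norm_div, Complex.add_conj, Complex.norm_real, Real.norm_eq_abs,
    abs_of_pos (by linarith), div_le_div_iff₀ (by linarith) hR] at h
  rw [le_div_iff₀ hR]
  linarith

/-- Schwarz's lemma for the Cayley transform `(p - 1) / (p + 1)`, which vanishes at 0. Both Harnack
bounds below are read off from it. -/
lemma norm_sub_one_le (hd : DifferentiableOn ℂ p unitDisk)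
    (hp : ∀ z ∈ unitDisk, 0 ≤ (p z).re) (h0 : p 0 = 1) {z : ℂ} (hz : z ∈ unitDisk) :
    ‖p z - 1‖ ≤ ‖z‖ * ‖p z + 1‖ := by
  have h0' : 0 < (p 0).re := by simp [h0]
  have h := Complex.dist_le_div_mul_dist_of_mapsTo_ball (differentiableOn_cayley hd hp h0')
    (mapsTo_cayley hp h0') hz
  have hne : p z + 1 ≠ 0 := by simpa using add_conj_ne_zero (a := 1) (hp z hz) (by simp)
  simp only [h0, map_one, sub_self, zero_div, dist_zero_right, norm_div, div_one, one_mul] at h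
  rwa [div_le_iff₀ (norm_pos_iff.2 hne)] at h

lemma one_sub_div_le_re (hd : DifferentiableOn ℂ p unitDisk)
    (hp : ∀ z ∈ unitDisk, 0 ≤ (p z).re) (h0 : p 0 = 1) {z : ℂ} (hz : z ∈ unitDisk) :
    (1 - ‖z‖) / (1 + ‖z‖) ≤ (p z).re := by
  have h := norm_sub_one_le hd hp h0 hz
  have hr : ‖z‖ < 1 := by simpa using hz
  have hr0 := norm_nonneg z
  have h2 : ‖p z - 1‖ ^ 2 ≤ (‖z‖ * ‖p z + 1‖) ^ 2 := by gcongr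
  rw [mul_pow, ← Complex.normSq_eq_norm_sq, ← Complex.normSq_eq_norm_sq (p z + 1),
    Complex.normSq_apply, Complex.normSq_apply] at h2
  simp only [Complex.sub_re, Complex.sub_im, Complex.add_re, Complex.add_im, Complex.one_re,
    Complex.one_im] at h2
  rw [div_le_iff₀ (by linarith)]
  by_contra! hlt
  set x := (p z).re
  set y := (p z).im
  set r := ‖z‖
  -- After squaring and dropping the nonnegative term `(1 - r²) y²`, what remains is `(x - 1)² ≤ r²
  -- (x + 1)²`, factored here.
  have key : ((1 - r) - x * (1 + r)) * ((1 + r) - x * (1 - r)) ≤ 0 := by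
    nlinarith [mul_nonneg (sq_nonneg y) (show 0 ≤ 1 - r ^ 2 by nlinarith)]
  have hx : 0 ≤ x := hp z hz
  have : 0 < (1 + r) - x * (1 - r) := by nlinarith
  nlinarith [mul_pos (sub_pos.2 hlt) this]

lemma norm_le_one_add_div (hd : DifferentiableOn ℂ p unitDisk)
    (hp : ∀ z ∈ unitDisk, 0 ≤ (p z).re) (h0 : p 0 = 1) {z : ℂ} (hz : z ∈ unitDisk) :
    ‖p z‖ ≤ (1 + ‖z‖) / (1 - ‖z‖) := by
  have h := norm_sub_one_le hd hp h0 hz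
  have hr : ‖z‖ < 1 := by simpa using hz
  rw [le_div_iff₀ (by linarith)]
  have h1 : ‖p z‖ - 1 ≤ ‖p z - 1‖ := by simpa using norm_sub_norm_le (p z) 1
  have h2 : ‖p z + 1‖ ≤ ‖p z‖ + 1 := by simpa using norm_add_le (p z) 1
  nlinarith [mul_le_mul_of_nonneg_left h2 (norm_nonneg z)]

/-- The Schwarz-Pick inequality for functions with positive real part. -/
lemma norm_deriv_mul_le (hd : DifferentiableOn ℂ p unitDisk)
    (hp : ∀ z ∈ unitDisk, 0 < (p z).re) {z : ℂ} (hz : z ∈ unitDisk) :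
    ‖deriv p z‖ * (1 - ‖z‖ ^ 2) ≤ 2 * (p z).re := by
  have hr : ‖z‖ < 1 := by simpa using hz
  have hne : ∀ w ∈ unitDisk, 1 + conj z * w ≠ 0 := by
    intro w hw h
    have hw1 : ‖w‖ < 1 := by simpa using hw
    have : ‖conj z * w‖ = 1 := by
      rw [eq_neg_of_add_eq_zero_right h]; simp
    rw [norm_mul, Complex.norm_conj] at this
    nlinarith [norm_nonneg z, norm_nonneg w]
  -- The disk automorphism sending 0 to `z`, with derivative `1 - |z|²` at 0, reduces the claim to
  -- the bound for the first coefficient. It maps into the disk because `|1 + conj z w|² - |w + z|²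
  -- = (1 - |w|²)(1 - |z|²)`.
  have hmaps : MapsTo (fun w ↦ (w + z) / (1 + conj z * w)) unitDisk unitDisk := by
    intro w hw
    have hw1 : ‖w‖ < 1 := by simpa using hw
    have hpos := norm_pos_iff.2 (hne w hw)
    rw [mem_ball_zero_iff, norm_div, div_lt_one hpos, ← sq_lt_sq₀ (norm_nonneg _) hpos.le]
    have e1 : ‖w‖ ^ 2 < 1 := by nlinarith [norm_nonneg w]
    have e2 : ‖z‖ ^ 2 < 1 := by nlinarith [norm_nonneg z]
    rw [← Complex.normSq_eq_norm_sq, Complex.normSq_apply] at e1 e2 ⊢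
    rw [← Complex.normSq_eq_norm_sq, Complex.normSq_apply]
    simp only [Complex.add_re, Complex.add_im, Complex.one_re, Complex.one_im, Complex.mul_re,
      Complex.mul_im, Complex.conj_re, Complex.conj_im]
    nlinarith [mul_pos (sub_pos.2 e1) (sub_pos.2 e2)]
  have hm : ∀ w ∈ unitDisk, HasDerivAt (fun w ↦ (w + z) / (1 + conj z * w))
      ((1 * (1 + conj z * w) - (w + z) * (conj z * 1)) / (1 + conj z * w) ^ 2) w := fun w hw ↦
    ((hasDerivAt_id w).add_const z).div (((hasDerivAt_id w).const_mul (conj z)).const_add 1)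
      (hne w hw)
  have h0 : (0 : ℂ) ∈ unitDisk := by simp
  have hmd : DifferentiableOn ℂ (fun w ↦ (w + z) / (1 + conj z * w)) unitDisk :=
    fun w hw ↦ (hm w hw).differentiableAt.differentiableWithinAt
  have h := norm_deriv_zero_le one_pos (hd.comp hmd hmaps) (fun w hw ↦ (hp _ (hmaps hw)).le)
    (hp _ (hmaps h0))
  have hpz : HasDerivAt p (deriv p z) ((fun w ↦ (w + z) / (1 + conj z * w)) 0) := by
    simpa using (hd.differentiableAt (isOpen_ball.mem_nhds hz)).hasDerivAt
  rw [(hpz.comp 0 (hm 0 h0)).deriv] at h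
  have e : (1 * (1 + conj z * 0) - (0 + z) * (conj z * 1)) / (1 + conj z * 0) ^ 2
      = ((1 - ‖z‖ ^ 2 : ℝ) : ℂ) := by
    simp [Complex.mul_conj, Complex.normSq_eq_norm_sq]
  rw [e, norm_mul, Complex.norm_real, Real.norm_eq_abs, abs_of_pos (by nlinarith [norm_nonneg z])]
    at h
  simpa using h

end Caratheodory

/-! ### Rotations of the co-analytic part -/

lemma exists_norm_eq_one_mul (a b : ℂ) : ∃ ε : ℂ, ‖ε‖ = 1 ∧ ‖a + ε * b‖ = ‖a‖ + ‖b‖ := by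
  rcases eq_or_ne a 0 with rfl | ha
  · exact ⟨1, by simp, by simp⟩
  rcases eq_or_ne b 0 with rfl | hb
  · exact ⟨1, by simp, by simp⟩
  have ha' : (‖a‖ : ℂ) ≠ 0 := by simpa using ha
  refine ⟨a / ‖a‖ * (‖b‖ / b), by simp [ha, hb], ?_⟩
  have : a + a / ‖a‖ * (‖b‖ / b) * b = a / ‖a‖ * ((‖a‖ + ‖b‖ : ℝ) : ℂ) := by
    push_cast
    field_simp
  rw [this, norm_mul, norm_div, Complex.norm_real, Complex.norm_real, norm_norm,
    div_self (by simpa using ha), one_mul, Real.norm_eq_abs, abs_of_nonneg (by positivity)]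

lemma exists_norm_eq_one_re_mul (b : ℂ) : ∃ ε : ℂ, ‖ε‖ = 1 ∧ (ε * b).re = -‖b‖ := by
  rcases eq_or_ne b 0 with rfl | hb
  · exact ⟨1, by simp, by simp⟩
  refine ⟨-(‖b‖ / b), by simp [hb], ?_⟩
  rw [neg_mul, div_mul_cancel₀ _ hb]
  simp

/-- The worst rotation is the one with `ε b = -|b|`. This is the dictionary between the harmonic
class and the analytic functions `h + ε g`. -/
lemma forall_re_add_mul_nonneg_iff {a b : ℂ} :
    (∀ ε : ℂ, ‖ε‖ = 1 → 0 ≤ (a + ε * b).re) ↔ ‖b‖ ≤ a.re := by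
  constructor
  · intro h
    obtain ⟨ε, hε, he⟩ := exists_norm_eq_one_re_mul b
    have := h ε hε
    rw [Complex.add_re, he] at this
    linarith
  · intro h ε hε
    have := (abs_le.1 (Complex.abs_re_le_norm (ε * b))).1
    rw [norm_mul, hε, one_mul] at this
    rw [Complex.add_re]
    linarith

lemma forall_re_add_mul_pos_iff {a b : ℂ} :
    (∀ ε : ℂ, ‖ε‖ = 1 → 0 < (a + ε * b).re) ↔ ‖b‖ < a.re := by
  constructor
  · intro h
    obtain ⟨ε, hε, he⟩ := exists_norm_eq_one_re_mul b
    have := h ε hε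
    rw [Complex.add_re, he] at this
    linarith
  · intro h ε hε
    have := (abs_le.1 (Complex.abs_re_le_norm (ε * b))).1
    rw [norm_mul, hε, one_mul] at this
    rw [Complex.add_re]
    linarith

/-- The analytic and co-analytic parts `h`, `g` of a normalized harmonic function satisfying
`|g'| ≤ Re h'` in the unit disk. -/
structure IsRPair (h g : ℂ → ℂ) : Prop where
  diff_h : DifferentiableOn ℂ h unitDisk
  diff_g : DifferentiableOn ℂ g unitDisk
  h_zero : h 0 = 0
  g_zero : g 0 = 0
  deriv_h_zero : deriv h 0 = 1
  deriv_g_zero : deriv g 0 = 0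
  norm_le : ∀ z ∈ unitDisk, ‖deriv g z‖ ≤ (deriv h z).re

lemma zero_mem_unitDisk : (0 : ℂ) ∈ unitDisk := by simp

/-! ### Carathéodory bounds for the derivatives of the two parts -/

namespace IsRPair

variable {h g : ℂ → ℂ}

lemma hasDerivAt_h (H : IsRPair h g) {z : ℂ} (hz : z ∈ unitDisk) : HasDerivAt h (deriv h z) z :=
  (H.diff_h.differentiableAt (isOpen_ball.mem_nhds hz)).hasDerivAt

lemma hasDerivAt_g (H : IsRPair h g) {z : ℂ} (hz : z ∈ unitDisk) : HasDerivAt g (deriv g z) z :=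
  (H.diff_g.differentiableAt (isOpen_ball.mem_nhds hz)).hasDerivAt

lemma diff_deriv (H : IsRPair h g) (ε : ℂ) :
    DifferentiableOn ℂ (fun z ↦ deriv h z + ε * deriv g z) unitDisk :=
  (H.diff_h.deriv isOpen_ball).add ((H.diff_g.deriv isOpen_ball).const_mul ε)

lemma re_nonneg (H : IsRPair h g) {ε : ℂ} (hε : ‖ε‖ = 1) :
    ∀ z ∈ unitDisk, 0 ≤ (deriv h z + ε * deriv g z).re := fun z hz ↦
  forall_re_add_mul_nonneg_iff.2 (H.norm_le z hz) ε hε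

lemma deriv_zero (H : IsRPair h g) (ε : ℂ) : deriv h 0 + ε * deriv g 0 = 1 := by
  simp [H.deriv_h_zero, H.deriv_g_zero]

lemma one_sub_div_le (H : IsRPair h g) {z : ℂ} (hz : z ∈ unitDisk) :
    (1 - ‖z‖) / (1 + ‖z‖) ≤ (deriv h z).re - ‖deriv g z‖ := by
  obtain ⟨ε, hε, he⟩ := exists_norm_eq_one_re_mul (deriv g z)
  have := one_sub_div_le_re (H.diff_deriv ε) (H.re_nonneg hε) (H.deriv_zero ε) hz
  rw [Complex.add_re, he] at this
  linarith

lemma norm_add_norm_le (H : IsRPair h g) {z : ℂ} (hz : z ∈ unitDisk) :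
    ‖deriv h z‖ + ‖deriv g z‖ ≤ (1 + ‖z‖) / (1 - ‖z‖) := by
  obtain ⟨ε, hε, he⟩ := exists_norm_eq_one_mul (deriv h z) (deriv g z)
  rw [← he]
  exact norm_le_one_add_div (H.diff_deriv ε) (H.re_nonneg hε) (H.deriv_zero ε) hz

/-- Strictness is automatic, because Harnack's lower bound is positive. It is the reason why the
class is closed under limits although it is defined by a strict inequality. -/
lemma norm_lt (H : IsRPair h g) {z : ℂ} (hz : z ∈ unitDisk) : ‖deriv g z‖ < (deriv h z).re := by
  have := H.one_sub_div_le hz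
  have hr : ‖z‖ < 1 := by simpa using hz
  have : 0 < (1 - ‖z‖) / (1 + ‖z‖) := div_pos (by linarith) (by linarith [norm_nonneg z])
  linarith

lemma mul_right (H : IsRPair h g) {ε : ℂ} (hε : ‖ε‖ = 1) : IsRPair h (fun z ↦ ε * g z) := by
  have hd : ∀ z ∈ unitDisk, deriv (fun z ↦ ε * g z) z = ε * deriv g z := fun z hz ↦
    ((H.hasDerivAt_g hz).const_mul ε).deriv
  refine ⟨H.diff_h, H.diff_g.const_mul ε, H.h_zero, by simp [H.g_zero], H.deriv_h_zero, ?_, ?_⟩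
  · rw [hd 0 zero_mem_unitDisk, H.deriv_g_zero, mul_zero]
  · intro z hz
    rw [hd z hz, norm_mul, hε, one_mul]
    exact H.norm_le z hz

end IsRPair

/-! ### Wirtinger derivatives and membership in the class -/

section Wirtinger

variable {f h g : ℂ → ℂ}

lemma IsDecomp.hasFDerivAt (H : IsDecomp f h g) {z : ℂ} (hz : z ∈ unitDisk) :
    HasFDerivAt f ((ContinuousLinearMap.toSpanSingleton ℂ (deriv h z)).restrictScalars ℝ +
      Complex.conjCLE.toContinuousLinearMap.comp
        ((ContinuousLinearMap.toSpanSingleton ℂ (deriv g z)).restrictScalars ℝ)) z := by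
  have hn := isOpen_ball.mem_nhds hz
  have h1 := (H.1.differentiableAt hn).hasDerivAt.hasFDerivAt.restrictScalars ℝ
  have h2 := (H.2.1.differentiableAt hn).hasDerivAt.hasFDerivAt.restrictScalars ℝ
  refine (h1.add (Complex.conjCLE.toContinuousLinearMap.hasFDerivAt.comp z h2)).congr_of_eventuallyEq
    ?_
  filter_upwards [hn] with w hw
  simpa using H.2.2 w hw

lemma IsDecomp.dz_eq (H : IsDecomp f h g) {z : ℂ} (hz : z ∈ unitDisk) : dz f z = deriv h z := by
  rw [dz, (H.hasFDerivAt hz).fderiv]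
  simp
  linear_combination (-(1 / 2) * deriv h z + 1/2 * conj (deriv g z)) * Complex.I_mul_I

lemma IsDecomp.dzbar_eq (H : IsDecomp f h g) {z : ℂ} (hz : z ∈ unitDisk) :
    dzbar f z = conj (deriv g z) := by
  rw [dzbar, (H.hasFDerivAt hz).fderiv]
  simp
  linear_combination ((1 / 2) * deriv h z - 1/2 * conj (deriv g z)) * Complex.I_mul_I

lemma IsDecomp.harmonicOnNhd (H : IsDecomp f h g) :
    InnerProductSpace.HarmonicOnNhd f unitDisk := by
  intro z hz
  have hn := isOpen_ball.mem_nhds hz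
  have h1 := (H.1.analyticAt hn).harmonicAt
  have h2 := (H.2.1.analyticAt hn).harmonicAt_conj
  refine (InnerProductSpace.harmonicAt_congr_nhds ?_).2 (h1.add h2)
  filter_upwards [hn] with w hw
  simpa using H.2.2 w hw

lemma IsRPair.mem_classRH0 (H : IsRPair h g) (hf : ∀ z ∈ unitDisk, f z = h z + conj (g z)) :
    f ∈ classRH0 := by
  have hD : IsDecomp f h g := ⟨H.diff_h, H.diff_g, hf⟩
  refine ⟨⟨hD.harmonicOnNhd, ?_, ?_, ?_⟩, h, g, ⟨hD, H.g_zero⟩, fun z hz ↦ H.norm_lt hz⟩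
  · simp [hf 0 zero_mem_unitDisk, H.h_zero, H.g_zero]
  · rw [hD.dz_eq zero_mem_unitDisk, H.deriv_h_zero]
  · rw [hD.dzbar_eq zero_mem_unitDisk, H.deriv_g_zero, map_zero]

/-- The class only provides some decomposition; the inequality moves to any other one since `h'` and
`conj g'` are the Wirtinger derivatives of `f`. -/
lemma IsCanonicalDecomp.isRPair (hD : IsCanonicalDecomp f h g) (hf : f ∈ classRH0) :
    IsRPair h g := by
  obtain ⟨⟨-, h0, h1, h2⟩, h', g', ⟨hD', -⟩, hn⟩ := hf
  refine ⟨hD.1.1, hD.1.2.1, ?_, hD.2, ?_, ?_, fun z hz ↦ ?_⟩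
  · have := hD.1.2.2 0 zero_mem_unitDisk
    rw [h0, hD.2] at this
    simpa using this.symm
  · rw [← hD.1.dz_eq zero_mem_unitDisk, h1]
  · have := hD.1.dzbar_eq zero_mem_unitDisk
    rw [h2] at this
    simpa using this.symm
  · have e1 := (hD.1.dz_eq hz).symm.trans (hD'.dz_eq hz)
    have e2 := (hD.1.dzbar_eq hz).symm.trans (hD'.dzbar_eq hz)
    have e3 : deriv g z = deriv g' z := star_injective e2
    rw [e1, e3]
    exact (hn z hz).le

lemma exists_isRPair (hf : f ∈ classRH0) :
    ∃ h g, IsRPair h g ∧ ∀ z ∈ unitDisk, f z = h z + conj (g z) := by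
  obtain ⟨h, g, hD, -⟩ := hf.2
  exact ⟨h, g, hD.isRPair hf, hD.1.2.2⟩

lemma isRPair_of_mem_classR {F : ℂ → ℂ} (hF : F ∈ classR) : IsRPair F 0 := by
  obtain ⟨⟨hd, h0, h1⟩, hp⟩ := hF
  exact ⟨hd, differentiableOn_const 0, h0, rfl, h1, by simp, fun z hz ↦ by simpa using (hp z hz).le⟩

end Wirtinger

end HarmonicMappings

namespace HarmonicMappings

open Metric Set Filter Topology
open scoped ComplexConjugate RealInnerProductSpace

/-! ### A variational inequality for strongly monotone maps -/

section Variational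

variable {E : Type*} [NormedAddCommGroup E] [InnerProductSpace ℝ E]

/-- `P` is the nearest-point map. Adding its variational inequalities at `u` and `v` gives `‖P u - P
v‖² ≤ ⟪u - v, P u - P v⟫`. -/
lemma exists_nonexpansive_projection [CompleteSpace E] {K : Set E} (hne : K.Nonempty) (hK : IsClosed K)
    (hconv : Convex ℝ K) :
    ∃ P : E → E, (∀ u, P u ∈ K) ∧ (∀ u, ∀ w ∈ K, ⟪u - P u, w - P u⟫ ≤ 0) ∧
      ∀ u v, ‖P u - P v‖ ≤ ‖u - v‖ := by
  have hex : ∀ u : E, ∃ v ∈ K, ∀ w ∈ K, ⟪u - v, w - v⟫ ≤ 0 := fun u ↦ by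
    obtain ⟨v, hv, h⟩ := exists_norm_eq_iInf_of_complete_convex hne hK.isComplete hconv u
    exact ⟨v, hv, (norm_eq_iInf_iff_real_inner_le_zero hconv hv).1 h⟩
  choose P hP hP' using hex
  refine ⟨P, hP, hP', fun u v ↦ ?_⟩
  have h1 := hP' u (P v) (hP v)
  have h2 := hP' v (P u) (hP u)
  have h3 : ⟪u - v, P u - P v⟫ = ‖P u - P v‖ ^ 2 - ⟪u - P u, P v - P u⟫
      - ⟪v - P v, P u - P v⟫ := by
    rw [← real_inner_self_eq_norm_sq]
    simp only [inner_sub_left, inner_sub_right]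
    ring
  have h4 := real_inner_le_norm (u - v) (P u - P v)
  rcases (norm_nonneg (P u - P v)).eq_or_lt with h5 | h5
  · rw [← h5]; positivity
  · nlinarith

/-- A Lipschitz strongly monotone map solves every variational inequality on a closed convex
set. -/
lemma exists_variational_solution [CompleteSpace E] {K : Set E} (hne : K.Nonempty) (hK : IsClosed K)
    (hconv : Convex ℝ K) {f : E → E} {c M : ℝ} (hc : 0 < c)
    (hf : ∀ x ∈ K, ∀ y ∈ K, ‖f x - f y‖ ≤ M * ‖x - y‖ ∧ c * ‖x - y‖ ^ 2 ≤ ⟪f x - f y, x - y⟫)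
    (y : E) : ∃ p ∈ K, ∀ q ∈ K, ⟪y - f p, q - p⟫ ≤ 0 := by
  obtain ⟨P, hP, hP', hPn⟩ := exists_nonexpansive_projection hne hK hconv
  -- Enlarging `M` to at least `c` keeps `1 - c² / N²` nonnegative under the square root.
  set N := max M c with hN
  have hNc : c ≤ N := le_max_right _ _
  have hN0 : 0 < N := hc.trans_le hNc
  -- The step size minimizing `1 - 2τc + τ²N²`, the bound for the squared contraction factor.
  set τ := c / N ^ 2 with hτ
  have hτ0 : 0 < τ := by positivity
  have hk : 0 ≤ 1 - c ^ 2 / N ^ 2 := by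
    rw [sub_nonneg, div_le_one (by positivity)]
    gcongr
  have hcontr : ∀ x ∈ K, ∀ z ∈ K, ‖P (x + τ • (y - f x)) - P (z + τ • (y - f z))‖ ≤
      Real.sqrt (1 - c ^ 2 / N ^ 2) * ‖x - z‖ := by
    intro x hx z hz
    refine (hPn _ _).trans ?_
    rw [← sq_le_sq₀ (norm_nonneg _) (by positivity), mul_pow, Real.sq_sqrt hk]
    have e : x + τ • (y - f x) - (z + τ • (y - f z)) = (x - z) - τ • (f x - f z) := by
      simp only [smul_sub]; abel
    rw [e, norm_sub_sq_real, inner_smul_right, norm_smul, Real.norm_eq_abs, abs_of_pos hτ0,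
      real_inner_comm]
    obtain ⟨h1, h2⟩ := hf x hx z hz
    have h3 : ‖f x - f z‖ ^ 2 ≤ (N * ‖x - z‖) ^ 2 := by
      gcongr
      exact h1.trans (by gcongr; exact le_max_left _ _)
    have h4 : (τ * ‖f x - f z‖) ^ 2 ≤ τ ^ 2 * (N * ‖x - z‖) ^ 2 := by
      rw [mul_pow]; gcongr
    have h5 : τ ^ 2 * (N * ‖x - z‖) ^ 2 = c ^ 2 / N ^ 2 * ‖x - z‖ ^ 2 := by
      rw [hτ]; field_simp
    have h6 : τ * (c * ‖x - z‖ ^ 2) = c ^ 2 / N ^ 2 * ‖x - z‖ ^ 2 := by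
      rw [hτ]; field_simp
    have h7 := mul_le_mul_of_nonneg_left h2 hτ0.le
    linarith
  have : CompleteSpace K := hK.completeSpace_coe
  have : Nonempty K := hne.to_subtype
  -- A fixed point of this projected step is a solution, by the variational inequality
  -- characterizing `P`.
  let T : K → K := fun x ↦ ⟨P (x + τ • (y - f x)), hP _⟩
  have hT : ContractingWith (Real.sqrt (1 - c ^ 2 / N ^ 2)).toNNReal T := by
    refine ⟨?_, LipschitzWith.of_dist_le_mul fun x z ↦ ?_⟩
    · rw [Real.toNNReal_lt_one, Real.sqrt_lt' one_pos]
      have : 0 < c ^ 2 / N ^ 2 := by positivity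
      linarith
    · rw [Subtype.dist_eq, Subtype.dist_eq, dist_eq_norm, dist_eq_norm,
        Real.coe_toNNReal _ (Real.sqrt_nonneg _)]
      exact hcontr x x.2 z z.2
  set p := ContractingWith.fixedPoint T hT with hp
  have hfix : P (p + τ • (y - f p)) = p := congrArg Subtype.val hT.fixedPoint_isFixedPt
  refine ⟨p, p.2, fun q hq ↦ ?_⟩
  have := hP' (p + τ • (y - f p)) q hq
  rw [hfix, add_sub_cancel_left, inner_smul_left] at this
  simp only [conj_trivial] at this
  exact nonpos_of_mul_nonpos_right this hτ0

/-- `f` is Lipschitz and strongly monotone on each closed ball of radius less than `R` about the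
origin. -/
def LocallyStronglyMonotone (f : E → E) (R : ℝ) : Prop :=
  ∀ r < R, ∃ c > 0, ∃ M : ℝ, ∀ x ∈ closedBall (0 : E) r, ∀ y ∈ closedBall (0 : E) r,
    ‖f x - f y‖ ≤ M * ‖x - y‖ ∧ c * ‖x - y‖ ^ 2 ≤ ⟪f x - f y, x - y⟫

namespace LocallyStronglyMonotone

variable {f : E → E} {R : ℝ}

lemma inner_pos (hf : LocallyStronglyMonotone f R) {x y : E} (hx : x ∈ ball 0 R)
    (hy : y ∈ ball 0 R) (hne : x ≠ y) : 0 < ⟪f x - f y, x - y⟫ := by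
  rw [mem_ball_zero_iff] at hx hy
  obtain ⟨c, hc, M, h⟩ := hf (max ‖x‖ ‖y‖) (max_lt hx hy)
  refine lt_of_lt_of_le ?_ (h x (by simp) y (by simp)).2
  have := norm_pos_iff.2 (sub_ne_zero.2 hne)
  positivity

lemma inner_nonneg (hf : LocallyStronglyMonotone f R) {x y : E} (hx : x ∈ ball 0 R)
    (hy : y ∈ ball 0 R) : 0 ≤ ⟪f x - f y, x - y⟫ := by
  rcases eq_or_ne x y with rfl | hne
  · simp
  · exact (hf.inner_pos hx hy hne).le

lemma injOn (hf : LocallyStronglyMonotone f R) : InjOn f (ball 0 R) := by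
  intro x hx y hy hxy
  by_contra hne
  have := hf.inner_pos hx hy hne
  simp [hxy] at this

lemma continuousOn (hf : LocallyStronglyMonotone f R) : ContinuousOn f (ball 0 R) := by
  intro x hx
  rw [mem_ball_zero_iff] at hx
  obtain ⟨r, hxr, hrR⟩ := exists_between hx
  obtain ⟨c, hc, M, h⟩ := hf r hrR
  have hL : LipschitzOnWith (Real.toNNReal M) f (closedBall 0 r) :=
    LipschitzOnWith.of_dist_le_mul fun a ha b hb ↦ by
      rw [dist_eq_norm, dist_eq_norm]
      exact (h a ha b hb).1.trans (by gcongr; exact Real.le_coe_toNNReal M)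
  exact (hL.continuousOn.continuousAt
    (closedBall_mem_nhds_of_mem (by simpa using hxr))).continuousWithinAt

/-- The variational inequality says that `y - f p` lies in the normal cone of the ball at `p`: zero
at interior points, the outward ray through `p` on the sphere. -/
lemma exists_eq_add_smul [CompleteSpace E] (hf : LocallyStronglyMonotone f R) {r : ℝ} (hr : 0 < r) (hrR : r < R)
    (y : E) : ∃ p ∈ closedBall (0 : E) r, ∃ t : ℝ, 0 ≤ t ∧ y = f p + t • p ∧ (‖p‖ < r → t = 0) := by
  obtain ⟨c, hc, M, h⟩ := hf r hrR
  obtain ⟨p, hp, hpq⟩ := exists_variational_solution ⟨0, by simp [hr.le]⟩ isClosed_closedBall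
    (convex_closedBall 0 r) hc h y
  refine ⟨p, hp, ?_⟩
  rcases eq_or_ne (y - f p) 0 with hv | hv
  · exact ⟨0, le_rfl, by simpa [sub_eq_zero] using hv, fun _ ↦ rfl⟩
  have hp' : ‖p‖ ≤ r := by simpa using hp
  have hvn := norm_pos_iff.2 hv
  -- Testing with the point of the ball farthest in the direction `y - f p` forces equality in
  -- Cauchy-Schwarz.
  have hq := hpq ((r / ‖y - f p‖) • (y - f p)) (by
    rw [mem_closedBall_zero_iff, norm_smul, Real.norm_eq_abs, abs_of_pos (by positivity),
      div_mul_cancel₀ _ hvn.ne'])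
  rw [inner_sub_right, inner_smul_right, real_inner_self_eq_norm_sq] at hq
  have e : r / ‖y - f p‖ * ‖y - f p‖ ^ 2 = r * ‖y - f p‖ := by field_simp
  rw [e] at hq
  have hcs := real_inner_le_norm (y - f p) p
  have hle : ‖y - f p‖ * ‖p‖ ≤ ‖y - f p‖ * r := by gcongr
  have hpr : ‖p‖ = r := by
    refine le_antisymm hp' ?_
    nlinarith
  have heq : ⟪y - f p, p⟫ = ‖y - f p‖ * ‖p‖ := by
    refine le_antisymm hcs ?_
    linarith
  rw [inner_eq_norm_mul_iff_real, hpr] at heq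
  refine ⟨‖y - f p‖ / r, by positivity, ?_, fun h ↦ absurd hpr h.ne⟩
  rw [div_eq_inv_mul, mul_smul, ← heq, smul_smul, inv_mul_cancel₀ hr.ne', one_smul]
  abel

/-- If the point `p` representing `y` lay on the sphere of radius `r`, strong monotonicity would
give `c (r - ‖x‖) ≤ c ‖p - x‖ ≤ ‖y - f x‖`. So every `y` closer than that to `f x` is attained. -/
lemma isOpen_image [CompleteSpace E] (hf : LocallyStronglyMonotone f R) : IsOpen (f '' ball 0 R) := by
  rw [Metric.isOpen_iff]
  rintro _ ⟨x, hx, rfl⟩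
  rw [mem_ball_zero_iff] at hx
  obtain ⟨r, hxr, hrR⟩ := exists_between hx
  have hr : 0 < r := (norm_nonneg x).trans_lt hxr
  obtain ⟨c, hc, M, h⟩ := hf r hrR
  refine ⟨c * (r - ‖x‖), mul_pos hc (by linarith), fun y hy ↦ ?_⟩
  obtain ⟨p, hp, t, ht, hy', htp⟩ := hf.exists_eq_add_smul hr hrR y
  have hp' : ‖p‖ ≤ r := by simpa using hp
  rcases hp'.eq_or_lt with hpr | hpr
  · exfalso
    have h1 := (h p hp x (by simpa using hxr.le)).2
    have h2 : ⟪y - f x, p - x⟫ = ⟪f p - f x, p - x⟫ + t * (‖p‖ ^ 2 - ⟪p, x⟫) := by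
      rw [hy', ← real_inner_self_eq_norm_sq]
      simp only [inner_sub_left, inner_sub_right, inner_add_left, inner_smul_left, conj_trivial]
      ring
    have h3 : 0 ≤ ‖p‖ ^ 2 - ⟪p, x⟫ := by
      have := real_inner_le_norm p x
      nlinarith [norm_nonneg p]
    have h4 := real_inner_le_norm (y - f x) (p - x)
    rw [mem_ball, dist_eq_norm] at hy
    have h5 : r - ‖x‖ ≤ ‖p - x‖ := by
      have := norm_sub_norm_le p x
      linarith
    have h6 := mul_nonneg ht h3
    have h7 : 0 < ‖p - x‖ := by linarith
    have h8 : c * ‖p - x‖ ≤ ‖y - f x‖ := by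
      by_contra! hlt
      nlinarith
    nlinarith
  · refine ⟨p, by simpa using hpr.trans hrR, ?_⟩
    simp [hy', htp hpr]

end LocallyStronglyMonotone

end Variational

/-! ### Close-to-convexity of images of monotone maps -/

section CloseToConvex

variable {f : ℂ → ℂ} {R : ℝ}

/-- For omitted `y` the point `p_r(y)` with `y = f p + t p` lies on the sphere of radius `r`. These
points depend monotonically on `y`, and `P y` is their limit as `r` tends to `R`. -/
lemma LocallyStronglyMonotone.exists_directions (hR : 0 < R) (hf : LocallyStronglyMonotone f R) :
    ∃ P : ℂ → ℂ, (∀ y ∉ f '' ball 0 R, ‖P y‖ = R) ∧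
      (∀ y₁ ∉ f '' ball 0 R, ∀ y₂ ∉ f '' ball 0 R, 0 ≤ ⟪y₁ - y₂, P y₁ - P y₂⟫) ∧
      ∀ y ∉ f '' ball 0 R, ∀ z ∈ ball (0 : ℂ) R, 0 ≤ ⟪y - f z, P y - z⟫ := by
  have hex : ∀ y : ℂ, ∀ r : ℝ, ∃ p : ℂ, y ∉ f '' ball 0 R → 0 < r → r < R →
      ‖p‖ = r ∧ ∃ t : ℝ, 0 ≤ t ∧ y = f p + t • p := by
    intro y r
    by_cases hh : y ∉ f '' ball 0 R ∧ 0 < r ∧ r < R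
    · obtain ⟨p, hp, t, ht, hy, htp⟩ := hf.exists_eq_add_smul hh.2.1 hh.2.2 y
      have hp' : ‖p‖ ≤ r := by simpa using hp
      refine ⟨p, fun _ _ _ ↦ ⟨hp'.antisymm ?_, t, ht, hy⟩⟩
      by_contra! hlt
      refine hh.1 ⟨p, by simpa using hlt.trans hh.2.2, ?_⟩
      simp [hy, htp hlt]
    · exact ⟨0, fun h1 h2 h3 ↦ absurd ⟨h1, h2, h3⟩ hh⟩
  choose p hp using hex
  have hne : (𝓝[<] R).NeBot := inferInstance
  -- One ultrafilter serves all `y` simultaneously, so inequalities between `p y₁ r` and `p y₂ r`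
  -- survive in the limit.
  let U : Ultrafilter ℝ := Ultrafilter.of (𝓝[<] R)
  have hU : (U : Filter ℝ) ≤ 𝓝[<] R := Ultrafilter.of_le _
  have hev : ∀ s < R, ∀ᶠ r in (U : Filter ℝ), s < r ∧ 0 < r ∧ r < R := by
    intro s hs
    have : Ioo (max s 0) R ∈ 𝓝[<] R := Ioo_mem_nhdsLT (max_lt hs hR)
    filter_upwards [hU this] with r hr
    exact ⟨(le_max_left _ _).trans_lt hr.1, (le_max_right _ _).trans_lt hr.1, hr.2⟩
  have hlim : ∀ y : ℂ, ∃ P : ℂ, y ∉ f '' ball 0 R → Tendsto (p y) U (𝓝 P) := by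
    intro y
    by_cases hy : y ∉ f '' ball 0 R
    · obtain ⟨P, -, hP⟩ := (isCompact_closedBall (0 : ℂ) R).ultrafilter_le_nhds (U.map (p y)) (by
        rw [le_principal_iff]
        change ∀ᶠ r in (U : Filter ℝ), p y r ∈ closedBall 0 R
        filter_upwards [hev 0 hR] with r hr
        simpa [(hp y r hy hr.2.1 hr.2.2).1] using hr.2.2.le)
      exact ⟨P, fun _ ↦ hP⟩
    · exact ⟨0, fun h ↦ absurd h hy⟩
  choose P hP using hlim
  have hinner : ∀ a b : ℂ, ⟪a, b⟫ ≤ ‖a‖ * ‖b‖ := real_inner_le_norm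
  refine ⟨P, fun y hy ↦ ?_, fun y₁ h₁ y₂ h₂ ↦ ?_, fun y hy z hz ↦ ?_⟩
  · have h1 : Tendsto (fun r ↦ ‖p y r‖) U (𝓝 R) := by
      have h2 : Tendsto (fun r : ℝ ↦ r) U (𝓝 R) := (hU.trans nhdsWithin_le_nhds)
      refine h2.congr' ?_
      filter_upwards [hev 0 hR] with r hr
      exact (hp y r hy hr.2.1 hr.2.2).1.symm
    exact tendsto_nhds_unique (hP y hy).norm h1
  · have ht : Tendsto (fun r ↦ ⟪y₁ - y₂, p y₁ r - p y₂ r⟫) U (𝓝 ⟪y₁ - y₂, P y₁ - P y₂⟫) :=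
      tendsto_const_nhds.inner ((hP y₁ h₁).sub (hP y₂ h₂))
    refine ge_of_tendsto ht ?_
    filter_upwards [hev 0 hR] with r hr
    obtain ⟨n1, t1, ht1, e1⟩ := hp y₁ r h₁ hr.2.1 hr.2.2
    obtain ⟨n2, t2, ht2, e2⟩ := hp y₂ r h₂ hr.2.1 hr.2.2
    have hm := hf.inner_nonneg (x := p y₁ r) (y := p y₂ r) (by simpa [n1] using hr.2.2)
      (by simpa [n2] using hr.2.2)
    have hi : ⟪p y₁ r, p y₂ r⟫ ≤ r ^ 2 := by
      have := hinner (p y₁ r) (p y₂ r)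
      rw [n1, n2] at this
      linarith
    have key : ⟪y₁ - y₂, p y₁ r - p y₂ r⟫ = ⟪f (p y₁ r) - f (p y₂ r), p y₁ r - p y₂ r⟫
        + (t1 + t2) * (r ^ 2 - ⟪p y₁ r, p y₂ r⟫) := by
      have s1 : ⟪p y₁ r, p y₁ r⟫ = r ^ 2 := by rw [real_inner_self_eq_norm_sq, n1]
      have s2 : ⟪p y₂ r, p y₂ r⟫ = r ^ 2 := by rw [real_inner_self_eq_norm_sq, n2]
      nth_rw 1 [e1, e2]
      simp only [inner_sub_left, inner_sub_right, inner_add_left, inner_smul_left, conj_trivial,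
        s1, s2, real_inner_comm (p y₁ r) (p y₂ r)]
      ring
    rw [key]
    have := mul_nonneg (add_nonneg ht1 ht2) (sub_nonneg.2 hi)
    linarith
  · have ht : Tendsto (fun r ↦ ⟪y - f z, p y r - z⟫) U (𝓝 ⟪y - f z, P y - z⟫) :=
      tendsto_const_nhds.inner ((hP y hy).sub_const z)
    refine ge_of_tendsto ht ?_
    filter_upwards [hev ‖z‖ (by simpa using hz)] with r hr
    obtain ⟨n1, t1, ht1, e1⟩ := hp y r hy hr.2.1 hr.2.2
    have hm := hf.inner_nonneg (x := p y r) (y := z) (by simpa [n1] using hr.2.2) hz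
    have hi : ⟪p y r, z⟫ ≤ r ^ 2 := by
      have := hinner (p y r) z
      rw [n1] at this
      nlinarith
    have key : ⟪y - f z, p y r - z⟫ = ⟪f (p y r) - f z, p y r - z⟫
        + t1 * (r ^ 2 - ⟪p y r, z⟫) := by
      have s1 : ⟪p y r, p y r⟫ = r ^ 2 := by rw [real_inner_self_eq_norm_sq, n1]
      nth_rw 1 [e1]
      simp only [inner_sub_left, inner_sub_right, inner_add_left, inner_smul_left, conj_trivial,
        s1]
      ring
    rw [key]
    have := mul_nonneg ht1 (sub_nonneg.2 hi)
    linarith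

/-- From an omitted `y` the half-line in direction `P y` stays in the complement, and `P` is
constant along it. Each half-line is prolonged backwards as far as both properties persist; two such
maximal half-lines meeting beyond their origins have the same direction and then the same origin. -/
theorem LocallyStronglyMonotone.isCloseToConvexDomain (hR : 0 < R)
    (hf : LocallyStronglyMonotone f R) : IsCloseToConvexDomain (f '' ball 0 R) := by
  obtain ⟨P, hPn, hPP, hPz⟩ := hf.exists_directions hR
  set Ω := f '' ball 0 R with hΩ
  have hopen : IsOpen Ω := hf.isOpen_image
  -- If `f z = y + s P y`, monotonicity reads `-s (R² - ⟪P y, z⟫) ≥ 0`, and `|z| < R` leaves only `s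
  -- = 0`.
  have hray : ∀ y ∉ Ω, ∀ s : ℝ, 0 ≤ s → y + s * P y ∉ Ω := by
    rintro y hy s hs ⟨z, hz, hzy⟩
    have h1 := hPz y hy z hz
    have e : y - f z = -(s • P y) := by rw [hzy, Complex.real_smul]; ring
    rw [e, inner_neg_left, inner_smul_left, inner_sub_right, real_inner_self_eq_norm_sq,
      hPn y hy] at h1
    simp only [conj_trivial] at h1
    have h2 := real_inner_le_norm (P y) z
    rw [hPn y hy] at h2
    rw [mem_ball_zero_iff] at hz
    have h3 : 0 < R ^ 2 - ⟪P y, z⟫ := by nlinarith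
    have h4 : s = 0 := by
      refine le_antisymm ?_ hs
      by_contra! h5
      nlinarith [mul_pos h5 h3]
    exact hy ⟨z, by simpa using hz, by simpa [h4] using hzy⟩
  -- Monotonicity of `P` gives `⟪P y, P (y + s P y)⟫ ≥ R²`; both vectors have norm `R`, so they
  -- coincide.
  have hconst : ∀ y ∉ Ω, ∀ s : ℝ, 0 ≤ s → P (y + s * P y) = P y := by
    intro y hy s hs
    rcases hs.eq_or_lt with rfl | hs
    · simp
    have hy' := hray y hy s hs.le
    have h1 := hPP _ hy' _ hy
    have e : y + s * P y - y = s • P y := by rw [Complex.real_smul]; ring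
    rw [e, inner_smul_left, inner_sub_right, real_inner_self_eq_norm_sq, hPn y hy] at h1
    simp only [conj_trivial] at h1
    have h2 : R ^ 2 ≤ ⟪P y, P (y + s * P y)⟫ := by
      by_contra! h
      nlinarith [mul_pos hs (sub_pos.2 h)]
    have h3 : ‖P y - P (y + s * P y)‖ ^ 2 ≤ 0 := by
      rw [norm_sub_sq_real, hPn y hy, hPn _ hy']
      linarith
    have h4 : ‖P y - P (y + s * P y)‖ = 0 := by nlinarith [norm_nonneg (P y - P (y + s * P y))]
    exact (sub_eq_zero.1 (norm_eq_zero.1 h4)).symm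
  -- Negative `s` are allowed: the infimum of this up-closed set marks the origin of the maximal
  -- half-line through `y`.
  let A : ℂ → Set ℝ := fun y ↦ {s | y + s * P y ∉ Ω ∧ P (y + s * P y) = P y}
  have hA0 : ∀ y ∉ Ω, (0 : ℝ) ∈ A y := fun y hy ↦ by simpa [A] using hy
  have hAup : ∀ y, ∀ s ∈ A y, ∀ s', s ≤ s' → s' ∈ A y := by
    rintro y s ⟨h1, h2⟩ s' hs
    have e : y + s' * P y = (y + s * P y) + ((s' - s : ℝ) : ℂ) * P (y + s * P y) := by
      rw [h2]; push_cast; ring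
    refine ⟨?_, ?_⟩
    · rw [e]; exact hray _ h1 _ (sub_nonneg.2 hs)
    · rw [e, hconst _ h1 _ (sub_nonneg.2 hs), h2]
  have hAb : ∀ y ∉ Ω, BddBelow (A y) := by
    intro y hy
    refine ⟨-⟪y - f 0, P y⟫ / R ^ 2, fun s hs ↦ ?_⟩
    have h1 := hPz _ hs.1 0 (by simpa using hR)
    have e : y + s * P y - f 0 = (y - f 0) + s • P y := by rw [Complex.real_smul]; ring
    rw [hs.2, e, sub_zero, inner_add_left, inner_smul_left, real_inner_self_eq_norm_sq,
      hPn y hy] at h1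
    simp only [conj_trivial] at h1
    rw [div_le_iff₀ (by positivity)]
    linarith
  have hglb : ∀ y ∉ Ω, IsGLB (A y) (sInf (A y)) := fun y hy ↦
    isGLB_csInf ⟨0, hA0 y hy⟩ (hAb y hy)
  have hgt : ∀ y ∉ Ω, ∀ t : ℝ, 0 < t → sInf (A y) + t ∈ A y := by
    intro y hy t ht
    obtain ⟨s, hs, hst⟩ := exists_lt_of_csInf_lt ⟨0, hA0 y hy⟩
      (show sInf (A y) < sInf (A y) + t by linarith)
    exact hAup y s hs _ hst.le
  have hpt : ∀ (y : ℂ) (t : ℝ), y + sInf (A y) * P y + t * P y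
      = y + ((sInf (A y) + t : ℝ) : ℂ) * P y := fun y t ↦ by push_cast; ring
  refine ⟨hopen, ?_, (fun y ↦ (y + sInf (A y) * P y, P y)) '' Ωᶜ, ?_, ?_, ?_⟩
  · exact ((convex_ball (0 : ℂ) R).isConnected ⟨0, by simpa using hR⟩).image f hf.continuousOn
  · rintro _ ⟨y, hy, rfl⟩
    have := hPn y hy
    rw [← norm_pos_iff]
    simpa [this] using hR
  · rw [biUnion_image]
    refine Subset.antisymm (fun y hy ↦ mem_biUnion hy ⟨-sInf (A y), ?_, ?_⟩)
      (iUnion₂_subset fun y hy ↦ ?_)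
    · have := csInf_le (hAb y hy) (hA0 y hy)
      linarith
    · push_cast; ring
    · rintro w ⟨t, ht, rfl⟩
      rcases ht.eq_or_lt with rfl | ht
      -- The origin need not belong to the parameter set, but it is a limit of omitted points.
      · have hcl : IsClosed Ωᶜ := hopen.isClosed_compl
        have htend : Tendsto (fun t : ℝ ↦ y + sInf (A y) * P y + (t : ℂ) * P y) (𝓝[>] 0)
            (𝓝 (y + sInf (A y) * P y + ((0 : ℝ) : ℂ) * P y)) := by
          refine Tendsto.mono_left (Continuous.tendsto ?_ 0) nhdsWithin_le_nhds
          fun_prop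
        refine hcl.mem_of_tendsto htend ?_
        filter_upwards [self_mem_nhdsWithin] with t ht
        rw [hpt]
        exact (hgt y hy t ht).1
      · rw [hpt]
        exact (hgt y hy t ht).1
  · rintro _ ⟨y₁, h₁, rfl⟩ _ ⟨y₂, h₂, rfl⟩ hne
    rw [Set.disjoint_left]
    rintro w ⟨t₁, ht₁, hw₁⟩ ⟨t₂, ht₂, hw₂⟩
    refine hne ?_
    simp only [hpt] at hw₁ hw₂
    -- Seen from a common point `w`, the half-line has direction `P w` and begins at parameter `-t`.
    -- Both are determined by `w` alone.
    have hshift : ∀ y ∉ Ω, ∀ t : ℝ, 0 < t → w = y + ((sInf (A y) + t : ℝ) : ℂ) * P y →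
        P w = P y ∧ IsGLB (A w) (-t) := by
      intro y hy t ht hw
      have hPw : P w = P y := by rw [hw]; exact (hgt y hy t ht).2
      have hmem : ∀ s : ℝ, s ∈ A w ↔ s + (sInf (A y) + t) ∈ A y := by
        intro s
        have e : w + s * P w = y + ((s + (sInf (A y) + t) : ℝ) : ℂ) * P y := by
          rw [hPw, hw]; push_cast; ring
        change w + s * P w ∉ Ω ∧ P (w + s * P w) = P w ↔ _
        rw [e, hPw]
        rfl
      refine ⟨hPw, fun s hs ↦ ?_, fun b hb ↦ ?_⟩
      · have := (hglb y hy).1 ((hmem s).1 hs)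
        linarith
      · have : b + (sInf (A y) + t) ≤ sInf (A y) := (hglb y hy).2 fun s hs ↦ by
          have := hb ((hmem (s - (sInf (A y) + t))).2 (by simpa using hs))
          linarith
        linarith
    obtain ⟨p1, g1⟩ := hshift y₁ h₁ t₁ ht₁ hw₁
    obtain ⟨p2, g2⟩ := hshift y₂ h₂ t₂ ht₂ hw₂
    have ht : t₁ = t₂ := neg_injective (g1.unique g2)
    have hP12 : P y₁ = P y₂ := p1.symm.trans p2
    have : y₁ + sInf (A y₁) * P y₁ = y₂ + sInf (A y₂) * P y₂ := by
      have e := hw₁.symm.trans hw₂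
      rw [ht, hP12] at e
      push_cast at e
      rw [hP12]
      linear_combination e
    exact Prod.ext this hP12

end CloseToConvex

/-! ### Monotonicity of the harmonic mappings under consideration -/

lemma le_re_sub_of_le_re_deriv {k : ℂ → ℂ} {s : Set ℂ} (hs : IsOpen s)
    (hk : DifferentiableOn ℂ k s) {a b : ℂ} {C : ℝ} (hseg : segment ℝ a b ⊆ s)
    (hC : ∀ w ∈ segment ℝ a b, C ≤ (deriv k w * (b - a)).re) : C ≤ (k b - k a).re := by
  have hmem : ∀ t ∈ Icc (0 : ℝ) 1, a + t * (b - a) ∈ segment ℝ a b := fun t ht ↦ by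
    rw [segment_eq_image']
    exact ⟨t, ht, by simp⟩
  have hder : ∀ t ∈ Icc (0 : ℝ) 1, HasDerivAt (fun t : ℝ ↦ (k (a + t * (b - a))).re)
      (deriv k (a + t * (b - a)) * (b - a)).re t := by
    intro t ht
    have h1 := (hk.differentiableAt (hs.mem_nhds (hseg (hmem t ht)))).hasDerivAt
    have h2 : HasDerivAt (fun x : ℂ ↦ a + x * (b - a)) (b - a) (t : ℂ) := by
      simpa using ((hasDerivAt_id (t : ℂ)).mul_const (b - a)).const_add a
    exact (h1.comp (t : ℂ) h2).real_of_complex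
  obtain ⟨t, ht, hslope⟩ := exists_hasDerivAt_eq_slope _ _ one_pos
    (fun t ht ↦ (hder t ht).continuousAt.continuousWithinAt)
    fun t ht ↦ hder t (Ioo_subset_Icc_self ht)
  have := hC _ (hmem t (Ioo_subset_Icc_self ht))
  simp only [hslope, Complex.ofReal_one, one_mul, add_sub_cancel, Complex.ofReal_zero, zero_mul,
    add_zero, sub_zero, div_one] at this
  simpa using this

namespace IsRPair

variable {h g : ℂ → ℂ}

/-- With `k = conj (x - y) h + (x - y) g` one has `⟪f x - f y, x - y⟫ = Re (k x - k y)`. Along the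
segment, `Re (k' (x - y)) = |x - y|² Re h' + Re ((x - y)² g')`, which is at least `|x - y|² (Re h' -
|g'|)`; Harnack's bound then supplies the constant. -/
lemma locallyStronglyMonotone (H : IsRPair h g) {f : ℂ → ℂ}
    (hf : ∀ z ∈ unitDisk, f z = h z + conj (g z)) {R : ℝ} (hR : R ≤ 1) :
    LocallyStronglyMonotone f R := by
  intro r hr
  rcases lt_or_ge r 0 with hr0 | hr0
  · refine ⟨1, one_pos, 1, fun x hx ↦ ?_⟩
    simp [closedBall_eq_empty.2 hr0] at hx
  have hr1 : r < 1 := hr.trans_le hR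
  have hsub : closedBall (0 : ℂ) r ⊆ unitDisk := closedBall_subset_ball hr1
  refine ⟨(1 - r) / (1 + r), div_pos (by linarith) (by linarith), 2 * ((1 + r) / (1 - r)),
    fun x hx y hy ↦ ⟨?_, ?_⟩⟩
  · have hb : ∀ w ∈ closedBall (0 : ℂ) r, ‖deriv h w‖ + ‖deriv g w‖ ≤ (1 + r) / (1 - r) := by
      intro w hw
      have hw' : ‖w‖ ≤ r := by simpa using hw
      refine (H.norm_add_norm_le (hsub hw)).trans ?_
      exact div_le_div₀ (by linarith) (by linarith) (by linarith) (by linarith)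
    have h1 := (convex_closedBall (0 : ℂ) r).norm_image_sub_le_of_norm_deriv_le (𝕜 := ℂ)
      (fun w hw ↦ (H.hasDerivAt_h (hsub hw)).differentiableAt)
      (fun w hw ↦ (le_add_of_nonneg_right (norm_nonneg _)).trans (hb w hw)) hy hx
    have h2 := (convex_closedBall (0 : ℂ) r).norm_image_sub_le_of_norm_deriv_le (𝕜 := ℂ)
      (fun w hw ↦ (H.hasDerivAt_g (hsub hw)).differentiableAt)
      (fun w hw ↦ (le_add_of_nonneg_left (norm_nonneg _)).trans (hb w hw)) hy hx
    have e : f x - f y = (h x - h y) + conj (g x - g y) := by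
      rw [hf x (hsub hx), hf y (hsub hy), map_sub]; ring
    rw [e]
    refine (norm_add_le _ _).trans ?_
    rw [Complex.norm_conj]
    linarith
  · have hk : DifferentiableOn ℂ (fun w ↦ conj (x - y) * h w + (x - y) * g w) unitDisk :=
      (H.diff_h.const_mul _).add (H.diff_g.const_mul _)
    have hseg : segment ℝ y x ⊆ closedBall (0 : ℂ) r := (convex_closedBall 0 r).segment_subset hy hx
    have := le_re_sub_of_le_re_deriv (C := (1 - r) / (1 + r) * ‖x - y‖ ^ 2) isOpen_ball hk
      (hseg.trans hsub) fun w hw ↦ by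
        have hw1 := hseg hw
        have hw2 : ‖w‖ ≤ r := by simpa using hw1
        rw [(((H.hasDerivAt_h (hsub hw1)).const_mul _).fun_add
          ((H.hasDerivAt_g (hsub hw1)).const_mul _)).deriv]
        have h1 := H.one_sub_div_le (hsub hw1)
        have h2 : (1 - r) / (1 + r) ≤ (1 - ‖w‖) / (1 + ‖w‖) :=
          div_le_div₀ (by linarith) (by linarith) (by linarith [norm_nonneg w]) (by linarith)
        have h3 : ((conj (x - y) * deriv h w + (x - y) * deriv g w) * (x - y)).re
            = (deriv h w).re * ‖x - y‖ ^ 2 + ((x - y) ^ 2 * deriv g w).re := by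
          rw [← Complex.normSq_eq_norm_sq, ← Complex.re_mul_ofReal, ← Complex.mul_conj,
            ← Complex.add_re]
          congr 1
          ring
        have h4 := (abs_le.1 (Complex.abs_re_le_norm ((x - y) ^ 2 * deriv g w))).1
        rw [norm_mul, norm_pow] at h4
        rw [h3]
        have h5 : 0 ≤ ‖x - y‖ ^ 2 := by positivity
        nlinarith
    refine this.trans_eq ?_
    rw [Complex.inner, hf x (hsub hx), hf y (hsub hy)]
    simp only [Complex.add_re, Complex.sub_re, Complex.mul_re, Complex.conj_re, Complex.conj_im,
      Complex.sub_im, Complex.add_im, map_sub, map_add]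
    ring

lemma closeToConvexInDisk (H : IsRPair h g) {f : ℂ → ℂ}
    (hf : ∀ z ∈ unitDisk, f z = h z + conj (g z)) {R : ℝ} (hR0 : 0 < R) (hR : R ≤ 1) :
    CloseToConvexInDisk f R :=
  ⟨(H.locallyStronglyMonotone hf hR).injOn,
    (H.locallyStronglyMonotone hf hR).isCloseToConvexDomain hR0⟩

end IsRPair

end HarmonicMappings

namespace HarmonicMappings

open Metric Set Filter Topology
open scoped ComplexConjugate RealInnerProductSpace

/-! ### Growth and covering -/

lemma sub_le_re_sub_of_hasDerivAt {k : ℂ → ℂ} (hk : DifferentiableOn ℂ k unitDisk) {u : ℂ}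
    (hu : ‖u‖ = 1) {B b : ℝ → ℝ} {r : ℝ} (hr0 : 0 ≤ r) (hr : r < 1)
    (hB : ∀ t ∈ Icc 0 r, HasDerivAt B (b t) t)
    (hb : ∀ t ∈ Icc 0 r, b t ≤ (deriv k (t * u) * u).re) :
    B r - B 0 ≤ (k (r * u) - k 0).re := by
  have hmem : ∀ t ∈ Icc 0 r, (t : ℂ) * u ∈ unitDisk := fun t ht ↦ by
    rw [mem_ball_zero_iff, norm_mul, hu, mul_one, Complex.norm_real, Real.norm_eq_abs,
      abs_of_nonneg ht.1]
    exact ht.2.trans_lt hr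
  have hder : ∀ t ∈ Icc 0 r, HasDerivAt (fun t : ℝ ↦ (k (t * u)).re)
      (deriv k (t * u) * u).re t := by
    intro t ht
    have h1 := (hk.differentiableAt (isOpen_ball.mem_nhds (hmem t ht))).hasDerivAt
    have h2 : HasDerivAt (fun x : ℂ ↦ x * u) u (t : ℂ) := by
      simpa using (hasDerivAt_id (t : ℂ)).mul_const u
    exact (h1.comp (t : ℂ) h2).real_of_complex
  have hd : ∀ t ∈ Icc 0 r, HasDerivAt (fun t : ℝ ↦ (k (t * u)).re - B t)
      ((deriv k (t * u) * u).re - b t) t := fun t ht ↦ (hder t ht).sub (hB t ht)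
  have hmono : MonotoneOn (fun t : ℝ ↦ (k (t * u)).re - B t) (Icc 0 r) := by
    refine monotoneOn_of_deriv_nonneg (convex_Icc 0 r)
      (fun t ht ↦ (hd t ht).continuousAt.continuousWithinAt)
      (fun t ht ↦ (hd t (interior_subset ht)).differentiableAt.differentiableWithinAt)
      fun t ht ↦ ?_
    rw [(hd t (interior_subset ht)).deriv]
    linarith [hb t (interior_subset ht)]
  have := hmono (left_mem_Icc.2 hr0) (right_mem_Icc.2 hr0) hr0
  simp only [Complex.ofReal_zero, zero_mul] at this
  rw [Complex.sub_re]
  linarith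

lemma hasDerivAt_lower {t : ℝ} (ht : 0 ≤ t) :
    HasDerivAt (fun t : ℝ ↦ -t + 2 * Real.log (1 + t)) ((1 - t) / (1 + t)) t := by
  have h1 := ((hasDerivAt_id t).const_add 1).log (by simp; linarith)
  convert! (hasDerivAt_id t).neg.add (h1.const_mul 2) using 1
  simp only [id]
  field_simp
  ring

lemma hasDerivAt_upper {t : ℝ} (ht : t < 1) :
    HasDerivAt (fun t : ℝ ↦ -t - 2 * Real.log (1 - t)) ((1 + t) / (1 - t)) t := by
  have h1 := ((hasDerivAt_id t).const_sub 1).log (by simp; linarith)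
  convert! (hasDerivAt_id t).neg.sub (h1.const_mul 2) using 1
  have : 1 - t ≠ 0 := by linarith
  simp only [id]
  field_simp
  ring

namespace IsRPair

variable {h g f : ℂ → ℂ}

lemma map_zero (H : IsRPair h g) (hf : ∀ z ∈ unitDisk, f z = h z + conj (g z)) : f 0 = 0 := by
  simp [hf 0 zero_mem_unitDisk, H.h_zero, H.g_zero]

/-- The lower growth estimate, in the radial direction. -/
lemma lower_growth_inner (H : IsRPair h g) (hf : ∀ z ∈ unitDisk, f z = h z + conj (g z)) {z : ℂ}
    (hz : z ∈ unitDisk) : (-‖z‖ + 2 * Real.log (1 + ‖z‖)) * ‖z‖ ≤ ⟪f z, z⟫ := by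
  rcases eq_or_ne z 0 with rfl | hz0
  · simp
  have hzn := norm_pos_iff.2 hz0
  have hz1 : ‖z‖ < 1 := by simpa using hz
  obtain ⟨u, hu, hzu⟩ : ∃ u : ℂ, ‖u‖ = 1 ∧ z = ‖z‖ * u :=
    ⟨z / ‖z‖, by simp [hz0], by rw [mul_div_cancel₀]; simpa using hz0⟩
  -- An analytic function whose real part is the component of `f` along `u`; here `Re (k' u) = Re
  -- (h' + u² g')`.
  have hk : DifferentiableOn ℂ (fun w ↦ conj u * h w + u * g w) unitDisk :=
    (H.diff_h.const_mul _).add (H.diff_g.const_mul _)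
  have key := sub_le_re_sub_of_hasDerivAt hk hu hzn.le hz1
    (fun t ht ↦ hasDerivAt_lower ht.1) fun t ht ↦ by
      have htn : ‖(t : ℂ) * u‖ = t := by
        rw [norm_mul, hu, mul_one, Complex.norm_real, Real.norm_eq_abs, abs_of_nonneg ht.1]
      have htm : (t : ℂ) * u ∈ unitDisk := by
        rw [mem_ball_zero_iff, htn]; exact ht.2.trans_lt hz1
      rw [(((H.hasDerivAt_h htm).const_mul _).fun_add ((H.hasDerivAt_g htm).const_mul _)).deriv]
      have h1 := H.one_sub_div_le htm
      rw [htn] at h1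
      refine h1.trans ?_
      have e : (conj u * deriv h (t * u) + u * deriv g (t * u)) * u
          = deriv h (t * u) + u ^ 2 * deriv g (t * u) := by
        have : conj u * u = 1 := by
          rw [← Complex.normSq_eq_conj_mul_self, Complex.normSq_eq_norm_sq, hu]; simp
        linear_combination deriv h (t * u) * this
      have h4 := (abs_le.1 (Complex.abs_re_le_norm (u ^ 2 * deriv g (t * u)))).1
      rw [norm_mul, norm_pow, hu, one_pow, one_mul] at h4
      rw [e, Complex.add_re]
      linarith
  rw [← hzu, H.h_zero, H.g_zero] at key
  simp only [neg_zero, add_zero, Real.log_one, mul_zero, sub_zero] at key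
  have e : ⟪f z, z⟫ = ‖z‖ * (conj u * h z + u * g z).re := by
    have hre : z.re = ‖z‖ * u.re := by
      rw [← Complex.re_ofReal_mul, ← hzu]
    have him : z.im = ‖z‖ * u.im := by
      rw [← Complex.im_ofReal_mul, ← hzu]
    rw [Complex.inner, hf z hz]
    simp only [map_add, Complex.conj_conj, Complex.mul_re, Complex.add_re, Complex.conj_re,
      Complex.conj_im, Complex.add_im]
    linear_combination ((h z).re + (g z).re) * hre + ((h z).im - (g z).im) * him
  rw [e]
  nlinarith

lemma lower_growth (H : IsRPair h g) (hf : ∀ z ∈ unitDisk, f z = h z + conj (g z)) {z : ℂ}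
    (hz : z ∈ unitDisk) : -‖z‖ + 2 * Real.log (1 + ‖z‖) ≤ ‖f z‖ := by
  rcases eq_or_ne z 0 with rfl | hz0
  · simp
  exact le_of_mul_le_mul_right ((H.lower_growth_inner hf hz).trans (real_inner_le_norm _ _))
    (norm_pos_iff.2 hz0)

lemma upper_growth (H : IsRPair h g) (hf : ∀ z ∈ unitDisk, f z = h z + conj (g z)) {z : ℂ}
    (hz : z ∈ unitDisk) : ‖f z‖ ≤ -‖z‖ - 2 * Real.log (1 - ‖z‖) := by
  rcases eq_or_ne z 0 with rfl | hz0
  · simp [H.map_zero hf]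
  have hzn := norm_pos_iff.2 hz0
  have hz1 : ‖z‖ < 1 := by simpa using hz
  obtain ⟨u, hu, hzu⟩ : ∃ u : ℂ, ‖u‖ = 1 ∧ z = ‖z‖ * u :=
    ⟨z / ‖z‖, by simp [hz0], by rw [mul_div_cancel₀]; simpa using hz0⟩
  -- `a` turns `f z` onto the negative axis, so the upper bound follows from the comparison lemma
  -- applied to the negated majorant.
  obtain ⟨a, ha, hfa⟩ := exists_norm_eq_one_re_mul (f z)
  have hk : DifferentiableOn ℂ (fun w ↦ a * h w + conj a * g w) unitDisk :=
    (H.diff_h.const_mul _).add (H.diff_g.const_mul _)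
  have key := sub_le_re_sub_of_hasDerivAt hk hu hzn.le hz1
    (fun t ht ↦ (hasDerivAt_upper (ht.2.trans_lt hz1)).neg) fun t ht ↦ by
      have htn : ‖(t : ℂ) * u‖ = t := by
        rw [norm_mul, hu, mul_one, Complex.norm_real, Real.norm_eq_abs, abs_of_nonneg ht.1]
      have htm : (t : ℂ) * u ∈ unitDisk := by
        rw [mem_ball_zero_iff, htn]; exact ht.2.trans_lt hz1
      rw [(((H.hasDerivAt_h htm).const_mul _).fun_add ((H.hasDerivAt_g htm).const_mul _)).deriv]
      have h1 := H.norm_add_norm_le htm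
      rw [htn] at h1
      have h4 := (abs_le.1 (Complex.abs_re_le_norm
        ((a * deriv h (t * u) + conj a * deriv g (t * u)) * u))).1
      rw [norm_mul, hu, mul_one] at h4
      have h5 := norm_add_le (a * deriv h (t * u)) (conj a * deriv g (t * u))
      rw [norm_mul, norm_mul, Complex.norm_conj, ha, one_mul, one_mul] at h5
      linarith
  rw [← hzu, H.h_zero, H.g_zero] at key
  simp only [Pi.neg_apply, neg_zero, sub_zero, Real.log_one, mul_zero, add_zero] at key
  have e : (a * h z + conj a * g z).re = (a * f z).re := by
    rw [hf z hz]
    simp only [Complex.mul_re, Complex.add_re, Complex.conj_re, Complex.conj_im, Complex.add_im]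
    ring
  rw [e, hfa] at key
  linarith

/-- Write `y = f p + t p`. If `|p| = r`, then `r |y| ≥ ⟪y, p⟫ ≥ ⟪f p, p⟫ ≥ r (-r + 2 log (1 + r))`,
which fails for `r` close to 1. The growth estimate is needed in its inner-product form here. -/
lemma ball_subset_image (H : IsRPair h g) (hf : ∀ z ∈ unitDisk, f z = h z + conj (g z)) :
    ball (0 : ℂ) (2 * Real.log 2 - 1) ⊆ f '' unitDisk := by
  intro y hy
  rw [mem_ball_zero_iff] at hy
  have hcont : ContinuousAt (fun t : ℝ ↦ -t + 2 * Real.log (1 + t)) 1 :=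
    (hasDerivAt_lower zero_le_one).continuousAt
  have hlim : ∀ᶠ r in 𝓝[<] (1 : ℝ), ‖y‖ < -r + 2 * Real.log (1 + r) := by
    refine (hcont.tendsto.mono_left nhdsWithin_le_nhds).eventually_const_lt ?_
    norm_num
    linarith
  obtain ⟨r, hry, hr0, hr1⟩ :=
    (hlim.and (Ioo_mem_nhdsLT (show (0 : ℝ) < 1 by norm_num))).exists
  obtain ⟨p, hp, t, ht, hyp, htp⟩ :=
    (H.locallyStronglyMonotone hf le_rfl).exists_eq_add_smul hr0 hr1 y
  have hp' : ‖p‖ ≤ r := by simpa using hp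
  have hpm : p ∈ unitDisk := by simpa using hp'.trans_lt hr1
  rcases hp'.eq_or_lt with hpr | hpr
  · exfalso
    have h1 := H.lower_growth_inner hf hpm
    have h2 : ⟪y, p⟫ = ⟪f p, p⟫ + t * ‖p‖ ^ 2 := by
      rw [hyp, inner_add_left, inner_smul_left, real_inner_self_eq_norm_sq]; simp
    have h3 := real_inner_le_norm y p
    have h4 : 0 ≤ t * ‖p‖ ^ 2 := by positivity
    rw [hpr] at h1 h3
    nlinarith
  · exact ⟨p, hpm, by simp [hyp, htp hpr]⟩

end IsRPair

/-! ### The extremal function -/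

lemma hasDerivAt_extremalFun {z : ℂ} (hz : 0 < (1 - z).re) :
    HasDerivAt extremalFun (-1 + 2 / (1 - z)) z := by
  have h1 := ((hasDerivAt_id z).const_sub 1).clog (Or.inl hz)
  convert! (hasDerivAt_id z).neg.sub (h1.const_mul 2) using 1
  simp only [id]
  ring

lemma one_sub_re_pos {z : ℂ} (hz : z ∈ unitDisk) : 0 < (1 - z).re := by
  have h1 : ‖z‖ < 1 := by simpa using hz
  have := Complex.re_le_norm z
  simp
  linarith

lemma isRPair_extremalFun : IsRPair extremalFun 0 := by
  have hd : ∀ z ∈ unitDisk, HasDerivAt extremalFun (-1 + 2 / (1 - z)) z := fun z hz ↦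
    hasDerivAt_extremalFun (one_sub_re_pos hz)
  refine ⟨fun z hz ↦ (hd z hz).differentiableAt.differentiableWithinAt, differentiableOn_const 0,
    by simp [extremalFun], rfl, ?_, by simp, fun z hz ↦ ?_⟩
  · rw [(hd 0 zero_mem_unitDisk).deriv]; norm_num
  · rw [(hd z hz).deriv]
    have hre := one_sub_re_pos hz
    have hpos : 0 < Complex.normSq (1 - z) := Complex.normSq_pos.2 fun h ↦ by simp [h] at hre
    have hz1 : ‖z‖ ^ 2 < 1 := by
      have : ‖z‖ < 1 := by simpa using hz
      nlinarith [norm_nonneg z]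
    rw [← Complex.normSq_eq_norm_sq, Complex.normSq_apply] at hz1
    have e : (-1 + 2 / (1 - z)).re = -1 + 2 * (1 - z.re) / Complex.normSq (1 - z) := by
      rw [Complex.add_re, Complex.div_re]
      simp
    simp only [Pi.zero_def, deriv_const, norm_zero]
    rw [e, neg_add_eq_sub, sub_nonneg, le_div_iff₀ hpos, Complex.normSq_apply]
    simp
    nlinarith

lemma extremalFun_eq_add (z : ℂ) : extremalFun z = extremalFun z + conj ((0 : ℂ → ℂ) z) := by simp

lemma extremalFun_mem : extremalFun ∈ classRH0 :=
  isRPair_extremalFun.mem_classRH0 fun z _ ↦ extremalFun_eq_add z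

lemma extremalFun_monotone : LocallyStronglyMonotone extremalFun 1 :=
  isRPair_extremalFun.locallyStronglyMonotone (fun z _ ↦ extremalFun_eq_add z) le_rfl

lemma extremalFun_ofReal {x : ℝ} (hx : x ≤ 1) :
    extremalFun x = ((-x - 2 * Real.log (1 - x) : ℝ) : ℂ) := by
  have : (1 - x : ℂ) = ((1 - x : ℝ) : ℂ) := by push_cast; ring
  rw [extremalFun, this, ← Complex.ofReal_log (by linarith)]
  push_cast
  ring

lemma extremalFun_sharp {r : ℝ} (hr0 : 0 ≤ r) (hr1 : r < 1) :
    (∃ z : ℂ, ‖z‖ = r ∧ ‖extremalFun z‖ = -r + 2 * Real.log (1 + r)) ∧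
      ∃ z : ℂ, ‖z‖ = r ∧ ‖extremalFun z‖ = -r - 2 * Real.log (1 - r) := by
  constructor
  · refine ⟨((-r : ℝ) : ℂ), by simp [abs_of_nonneg hr0], ?_⟩
    rw [extremalFun_ofReal (by linarith), Complex.norm_real, Real.norm_eq_abs, ← abs_neg,
      abs_of_nonneg]
    · rw [sub_neg_eq_add]; ring
    · have h1 := Real.one_sub_inv_le_log_of_pos (show 0 < 1 + r by linarith)
      have h2 : r / 2 ≤ 1 - (1 + r)⁻¹ := by
        rw [show 1 - (1 + r)⁻¹ = r / (1 + r) by field_simp; ring]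
        gcongr
        linarith
      rw [sub_neg_eq_add]
      linarith
  · refine ⟨(r : ℂ), by simp [abs_of_nonneg hr0], ?_⟩
    rw [extremalFun_ofReal hr1.le, Complex.norm_real, Real.norm_eq_abs, abs_of_nonneg]
    have h1 := Real.log_le_sub_one_of_pos (show 0 < 1 - r by linarith)
    linarith

/-- This is the boundary value at `-1`. If it were also taken at `z`, monotonicity, strict between
`z` and the midpoint `m` of `z` and `-1`, and non-strict in the limit between `m` and `-1`, would
give contradictory signs. -/
lemma extremalFun_neg_one_notMem : ((1 - 2 * Real.log 2 : ℝ) : ℂ) ∉ extremalFun '' unitDisk := by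
  rintro ⟨z, hz, hzy⟩
  have hz1 : ‖z‖ < 1 := by simpa using hz
  set m : ℂ := (z - 1) / 2 with hm
  have hmd : m ∈ unitDisk := by
    rw [mem_ball_zero_iff, hm, norm_div]
    have := norm_sub_le z 1
    norm_num at this ⊢
    linarith
  have hzm : z - m = (z + 1) / 2 := by rw [hm]; ring
  have hne : z ≠ m := by
    intro h
    have : z = -1 := by rw [h] at hzm; linear_combination (-2 : ℂ) * hzm + h
    rw [this] at hz1
    simp at hz1
  have h1 := extremalFun_monotone.inner_pos hz hmd hne
  have hcont : Continuous fun s : ℝ ↦ ((-s : ℝ) : ℂ) := by fun_prop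
  have hv : extremalFun ((-1 : ℝ) : ℂ) = ((1 - 2 * Real.log 2 : ℝ) : ℂ) := by
    rw [extremalFun_ofReal (by norm_num)]
    norm_num
  have hcont2 : ContinuousAt (fun s : ℝ ↦ extremalFun ((-s : ℝ) : ℂ)) 1 :=
    ContinuousAt.comp (f := fun s : ℝ ↦ ((-s : ℝ) : ℂ)) (g := extremalFun)
      (hasDerivAt_extremalFun (by norm_num)).continuousAt hcont.continuousAt
  have ht : Tendsto (fun s : ℝ ↦ ⟪extremalFun m - extremalFun ((-s : ℝ) : ℂ), m - ((-s : ℝ) : ℂ)⟫)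
      (𝓝[<] 1) (𝓝 ⟪extremalFun m - extremalFun ((-1 : ℝ) : ℂ), m - ((-1 : ℝ) : ℂ)⟫) :=
    ((tendsto_const_nhds.sub hcont2.tendsto).inner
      (tendsto_const_nhds.sub hcont.continuousAt.tendsto)).mono_left nhdsWithin_le_nhds
  have h2 : 0 ≤ ⟪extremalFun m - extremalFun ((-1 : ℝ) : ℂ), m - ((-1 : ℝ) : ℂ)⟫ := by
    refine ge_of_tendsto ht ?_
    filter_upwards [Ioo_mem_nhdsLT (show (0 : ℝ) < 1 by norm_num)] with s hs
    refine extremalFun_monotone.inner_nonneg hmd ?_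
    rw [mem_ball_zero_iff, Complex.norm_real, Real.norm_eq_abs, abs_neg, abs_of_pos hs.1]
    exact hs.2
  have e2 : m - ((-1 : ℝ) : ℂ) = (z + 1) / 2 := by rw [hm]; push_cast; ring
  rw [e2, hv, ← hzy] at h2
  rw [hzm] at h1
  have h3 : ⟪extremalFun m - extremalFun z, (z + 1) / 2⟫
      = -⟪extremalFun z - extremalFun m, (z + 1) / 2⟫ := by
    rw [← inner_neg_left, neg_sub]
  linarith

lemma extremalFun_not_ball_subset {ρ : ℝ} (hρ : 2 * Real.log 2 - 1 < ρ) :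
    ¬ ball (0 : ℂ) ρ ⊆ extremalFun '' unitDisk := by
  intro h
  refine extremalFun_neg_one_notMem (h ?_)
  rw [mem_ball_zero_iff, Complex.norm_real, Real.norm_eq_abs, ← abs_neg, abs_of_nonneg]
  · linarith
  · linarith [Real.log_two_gt_d9]

lemma taylorCoeff_extremal {h g : ℂ → ℂ} (hD : IsCanonicalDecomp extremalFun h g) {n : ℕ}
    (hn : 2 ≤ n) : |‖taylorCoeff h n‖ - ‖taylorCoeff g n‖| = 2 / (n : ℝ) := by
  have hD0 : IsDecomp extremalFun extremalFun 0 :=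
    ⟨isRPair_extremalFun.diff_h, isRPair_extremalFun.diff_g, fun z _ ↦ extremalFun_eq_add z⟩
  have hdh : deriv h =ᶠ[𝓝 0] fun z ↦ -1 + 2 * (-1 * z + 1)⁻¹ := by
    filter_upwards [isOpen_ball.mem_nhds zero_mem_unitDisk] with z hz
    rw [← hD.1.dz_eq hz, hD0.dz_eq hz, (hasDerivAt_extremalFun (one_sub_re_pos hz)).deriv]
    rw [div_eq_mul_inv]
    ring_nf
  have hdg : deriv g =ᶠ[𝓝 0] fun _ ↦ 0 := by
    filter_upwards [isOpen_ball.mem_nhds zero_mem_unitDisk] with z hz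
    have := (hD.1.dzbar_eq hz).symm.trans (hD0.dzbar_eq hz)
    simpa using this
  obtain ⟨m, rfl⟩ : ∃ m, n = m + 2 := ⟨n - 2, by omega⟩
  have hg : taylorCoeff g (m + 2) = 0 := by
    rw [taylorCoeff, iteratedDeriv_succ', hdg.iteratedDeriv_eq]
    simp
  have hh : taylorCoeff h (m + 2) = 2 / ((m + 2 : ℕ) : ℂ) := by
    rw [taylorCoeff, iteratedDeriv_succ', hdh.iteratedDeriv_eq, iteratedDeriv_const_add (by omega),
      iteratedDeriv_const_mul_field, iteratedDeriv_eq_iterate, iter_deriv_inv_linear]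
    have h1 : ((m + 1).factorial : ℂ) ≠ 0 := by exact_mod_cast (Nat.factorial_pos _).ne'
    have h2 : ((m + 2 : ℕ) : ℂ) ≠ 0 := by exact_mod_cast (by omega : m + 2 ≠ 0)
    rw [Nat.factorial_succ (m + 1), Nat.cast_mul, show m + 1 + 1 = m + 2 from rfl]
    have h3 : (-1 : ℂ) ^ (m + 1) * (-1) ^ (m + 1) = 1 := by
      rw [← mul_pow]; norm_num
    simp only [mul_zero, zero_add, one_zpow, mul_one]
    rw [div_eq_div_iff (mul_ne_zero h2 h1) h2]
    linear_combination 2 * (m + 1).factorial * ((m + 2 : ℕ) : ℂ) * h3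
  rw [hg, hh, norm_zero, sub_zero, norm_div, Complex.norm_natCast]
  simp
  positivity

/-! ### The harmonic analogue and stable close-to-convexity -/

lemma classR_subset_classS : classR ⊆ classS := fun F hF ↦
  ⟨hF.1, ((isRPair_of_mem_classR hF).locallyStronglyMonotone (f := F) (fun z _ ↦ by simp)
    le_rfl).injOn⟩

lemma isHarmonicAnalogue_classR : IsHarmonicAnalogue classR classRH0 := by
  refine ⟨classR_subset_classS, Set.ext fun f ↦ ⟨fun hf ↦ ?_, ?_⟩⟩
  · obtain ⟨h, g, H, hfe⟩ := exists_isRPair hf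
    refine ⟨h, g, ⟨H.diff_h, H.diff_g, hfe⟩, fun ε hε ↦ ⟨⟨H.diff_h.add (H.diff_g.const_mul ε), ?_,
      ?_⟩, fun z hz ↦ ?_⟩⟩
    · simp [H.h_zero, H.g_zero]
    · rw [((H.hasDerivAt_h zero_mem_unitDisk).fun_add
        ((H.hasDerivAt_g zero_mem_unitDisk).const_mul ε)).deriv, H.deriv_zero]
    · rw [((H.hasDerivAt_h hz).fun_add ((H.hasDerivAt_g hz).const_mul ε)).deriv]
      exact forall_re_add_mul_pos_iff.2 (H.norm_lt hz) ε hε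
  · rintro ⟨h, g, hD, hε⟩
    have hd : ∀ z ∈ unitDisk, ∀ ε : ℂ, deriv (fun z ↦ h z + ε * g z) z
        = deriv h z + ε * deriv g z := fun z hz ε ↦ by
      have hn := isOpen_ball.mem_nhds hz
      exact ((hD.1.differentiableAt hn).hasDerivAt.fun_add
        ((hD.2.1.differentiableAt hn).hasDerivAt.const_mul ε)).deriv
    -- Half the sum and half the difference of the cases `ε = 1` and `ε = -1` separate the
    -- normalizations of `h` and `g`.
    have h1 := hε 1 (by simp)
    have h2 := hε (-1) (by simp)
    have e1 := h1.1.2.1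
    have e2 := h2.1.2.1
    have e3 := (hd 0 zero_mem_unitDisk 1).symm.trans h1.1.2.2
    have e4 := (hd 0 zero_mem_unitDisk (-1)).symm.trans h2.1.2.2
    have H : IsRPair h g :=
      ⟨hD.1, hD.2.1, by linear_combination (e1 + e2) / 2, by linear_combination (e1 - e2) / 2,
        by linear_combination (e3 + e4) / 2, by linear_combination (e3 - e4) / 2, fun z hz ↦ by
          refine forall_re_add_mul_nonneg_iff.1 fun ε he ↦ ?_
          rw [← hd z hz]
          exact ((hε ε he).2 z hz).le⟩
    exact H.mem_classRH0 hD.2.2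

lemma classRH0_subset_classSCH0 : classRH0 ⊆ classSCH0 := by
  intro f hf
  obtain ⟨h, g, H, hfe⟩ := exists_isRPair hf
  have hD : IsDecomp f h g := ⟨H.diff_h, H.diff_g, hfe⟩
  refine ⟨⟨hf.1, (H.locallyStronglyMonotone hfe le_rfl).injOn, fun z hz ↦ ?_⟩, h, g,
    ⟨hD, H.g_zero⟩, fun l hl ↦ ?_⟩
  · rw [hD.dz_eq hz, hD.dzbar_eq hz, Complex.norm_conj]
    exact (H.norm_lt hz).trans_le (Complex.re_le_norm _)
  -- `h + l conj g` is the harmonic function with parts `h` and `conj l * g`, again of the same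
  -- kind.
  · refine (H.mul_right (ε := conj l) (by simpa using hl)).closeToConvexInDisk (fun z _ ↦ ?_)
      one_pos le_rfl
    simp

lemma isRadiusOfCloseToConvexity_classRH0 : IsRadiusOfCloseToConvexity classRH0 1 := by
  refine ⟨by simp, fun r hr ↦ ⟨fun _ ↦ hr.2, fun _ f hf ↦ ?_⟩⟩
  obtain ⟨h, g, H, hfe⟩ := exists_isRPair hf
  exact H.closeToConvexInDisk hfe hr.1 hr.2

end HarmonicMappings

namespace HarmonicMappings

open Metric Set Filter Topology
open scoped ComplexConjugate RealInnerProductSpace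

/-! ### The radius of convexity -/

/-- Positivity of `Re ((S + ε T) / (a + ε b))` for all unimodular `ε` is equivalent to that of
`Re ((S + μ conj T) / (a - μ conj b))` for all unimodular `μ`; this is the implication used. -/
lemma re_mul_conj_nonneg_of_forall {a b S T : ℂ} (hab : ‖b‖ < ‖a‖)
    (H : ∀ ε : ℂ, ‖ε‖ = 1 → 0 ≤ ((S + ε * T) * conj (a + ε * b)).re) {μ : ℂ} (hμ : ‖μ‖ = 1) :
    0 ≤ ((S + μ * conj T) * conj (a - μ * conj b)).re := by
  have unit : ∀ ε : ℂ, ‖ε‖ = 1 → ε.re * ε.re + ε.im * ε.im = 1 := fun ε hε ↦ by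
    rw [← Complex.normSq_apply, Complex.normSq_eq_norm_sq, hε, one_pow]
  set X := (S * conj a).re with hX
  set Y := (T * conj b).re with hY
  set V := T * conj a + conj S * b with hV
  set W := T * a - S * b with hW
  -- The hypothesis at the worst `ε`. The conclusion amounts to `‖W‖ ≤ X - Y`, and `‖W‖² = ‖V‖² -
  -- 4XY ≤ (X - Y)²`; only `Y ≤ X` then remains, which uses `‖b‖ < ‖a‖`.
  have h1 : ‖V‖ ≤ X + Y := by
    obtain ⟨ε, hε, he⟩ := exists_norm_eq_one_re_mul V
    have h := H ε hε
    have e : ((S + ε * T) * conj (a + ε * b)).re = X + Y + (ε * V).re := by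
      simp only [hX, hY, hV, Complex.mul_re, Complex.add_re, Complex.conj_re, Complex.conj_im,
        Complex.add_im, Complex.mul_im, map_add, map_mul]
      linear_combination (T.re * b.re + T.im * b.im) * unit ε hε
    rw [e, he] at h
    linarith
  have h2 : ‖W‖ ^ 2 = ‖V‖ ^ 2 - 4 * X * Y := by
    rw [← Complex.normSq_eq_norm_sq, ← Complex.normSq_eq_norm_sq, Complex.normSq_apply,
      Complex.normSq_apply]
    simp only [hX, hY, hV, hW, Complex.mul_re, Complex.add_re, Complex.conj_re, Complex.conj_im,
      Complex.add_im, Complex.mul_im, Complex.sub_re, Complex.sub_im]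
    ring
  have h3 : Y * ‖a‖ ≤ X * ‖b‖ := by
    have e : Y * ‖a‖ ^ 2 + X * ‖b‖ ^ 2 = (V * (conj b * a)).re := by
      rw [← Complex.normSq_eq_norm_sq, ← Complex.normSq_eq_norm_sq, Complex.normSq_apply,
        Complex.normSq_apply]
      simp only [hX, hY, hV, Complex.mul_re, Complex.add_re, Complex.conj_re, Complex.conj_im,
        Complex.add_im, Complex.mul_im]
      ring
    have h4 := Complex.re_le_norm (V * (conj b * a))
    rw [norm_mul, norm_mul, Complex.norm_conj, ← e] at h4
    have h5 : ‖V‖ * (‖b‖ * ‖a‖) ≤ (X + Y) * (‖b‖ * ‖a‖) := by gcongr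
    have h6 : (Y * ‖a‖ - X * ‖b‖) * (‖a‖ - ‖b‖) ≤ 0 := by nlinarith
    have h7 := nonpos_of_mul_nonpos_left h6 (sub_pos.2 hab)
    linarith
  have hb0 := norm_nonneg b
  have ha0 : 0 < ‖a‖ := hb0.trans_lt hab
  have h4 : 0 ≤ X := by
    by_contra! hneg
    have : Y * ‖a‖ ≤ 0 := h3.trans (mul_nonpos_of_nonpos_of_nonneg hneg.le hb0)
    have : Y ≤ 0 := nonpos_of_mul_nonpos_left this ha0
    linarith [norm_nonneg V]
  have h5 : Y ≤ X := by
    have : Y * ‖a‖ ≤ X * ‖a‖ := h3.trans (by gcongr)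
    exact le_of_mul_le_mul_right this ha0
  have h6 : ‖W‖ ≤ X - Y := by
    rw [← sq_le_sq₀ (norm_nonneg _) (sub_nonneg.2 h5), h2]
    nlinarith [norm_nonneg V]
  have h7 := (abs_le.1 (Complex.abs_re_le_norm (conj μ * W))).1
  rw [norm_mul, Complex.norm_conj, hμ, one_mul] at h7
  have e : ((S + μ * conj T) * conj (a - μ * conj b)).re = X - Y + (conj μ * W).re := by
    simp only [hX, hY, hW, Complex.mul_re, Complex.add_re, Complex.conj_re, Complex.conj_im,
      Complex.add_im, Complex.mul_im, Complex.sub_re, Complex.sub_im, map_sub, map_mul]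
    linear_combination (-(T.re * b.re + T.im * b.im)) * unit μ hμ
  rw [e]
  linarith

namespace IsRPair

variable {h g f : ℂ → ℂ}

/-- The tangent direction of the image of a circle of radius at most `√2 - 1` turns
monotonically. -/
lemma re_curvature_nonneg (H : IsRPair h g) {z : ℂ} (hz : ‖z‖ ≤ Real.sqrt 2 - 1) {μ : ℂ}
    (hμ : ‖μ‖ = 1) :
    0 ≤ ((deriv h z + z * deriv (deriv h) z
        + μ * conj (deriv g z + z * deriv (deriv g) z))
      * conj (deriv h z - μ * conj (deriv g z))).re := by
  have hs2 : Real.sqrt 2 ^ 2 = 2 := Real.sq_sqrt (by norm_num)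
  have hs0 := Real.sqrt_nonneg 2
  have hr : ‖z‖ < 1 := by nlinarith
  -- `√2 - 1` is the positive root of `2r = 1 - r²`; Schwarz-Pick then yields `|z p'| ≤ |p|`.
  have hr2 : 2 * ‖z‖ ≤ 1 - ‖z‖ ^ 2 := by nlinarith [norm_nonneg z]
  have hzm : z ∈ unitDisk := by simpa using hr
  refine re_mul_conj_nonneg_of_forall
    ((H.norm_lt hzm).trans_le (Complex.re_le_norm _)) (fun ε hε ↦ ?_) hμ
  set p : ℂ → ℂ := fun w ↦ deriv h w + ε * deriv g w with hp
  have hpd : deriv p z = deriv (deriv h) z + ε * deriv (deriv g) z := by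
    have hn := isOpen_ball.mem_nhds hzm
    exact (((H.diff_h.deriv isOpen_ball).differentiableAt hn).hasDerivAt.fun_add
      (((H.diff_g.deriv isOpen_ball).differentiableAt hn).hasDerivAt.const_mul ε)).deriv
  have e : (deriv h z + z * deriv (deriv h) z + ε * (deriv g z + z * deriv (deriv g) z))
      * conj (deriv h z + ε * deriv g z) = p z * conj (p z) + z * deriv p z * conj (p z) := by
    rw [hpd]; simp only [hp]; ring
  rw [e, Complex.add_re, Complex.mul_conj, Complex.ofReal_re, Complex.normSq_eq_norm_sq]
  have h1 := norm_deriv_mul_le (H.diff_deriv ε)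
    (fun w hw ↦ forall_re_add_mul_pos_iff.2 (H.norm_lt hw) ε hε) hzm
  have h2 := Complex.re_le_norm (p z)
  have h3 := (abs_le.1 (Complex.abs_re_le_norm (z * deriv p z * conj (p z)))).1
  rw [norm_mul, norm_mul, Complex.norm_conj] at h3
  change ‖deriv p z‖ * (1 - ‖z‖ ^ 2) ≤ 2 * (p z).re at h1
  have h4 : ‖z‖ * ‖deriv p z‖ ≤ ‖p z‖ := by
    nlinarith [norm_nonneg (deriv p z), mul_le_mul_of_nonneg_left hr2 (norm_nonneg (deriv p z))]
  nlinarith [norm_nonneg (p z), mul_le_mul_of_nonneg_right h4 (norm_nonneg (p z))]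

/-- The outward normal of the image of a circle. -/
lemma inner_normal_pos (H : IsRPair h g) {z : ℂ} (hz : z ∈ unitDisk) {μ : ℂ} (hμ : ‖μ‖ = 1) :
    0 < (deriv h z - μ * conj (deriv g z)).re := by
  have := H.norm_lt hz
  have h1 := (abs_le.1 (Complex.abs_re_le_norm (μ * conj (deriv g z)))).2
  rw [norm_mul, hμ, one_mul, Complex.norm_conj] at h1
  rw [Complex.sub_re]
  linarith

/-- The curve `f(ρ e^{iθ})` has velocity `i N(θ)`, where the normal `N = z h' - conj (z g')` has a
nondecreasing argument `ψ` gaining `2π` per turn. Hence `Re (f conj N(θ₀))` has derivative of the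
sign of `-sin (ψ(θ) - ψ(θ₀))`: it falls until `ψ` has gained `π` and then rises back to its initial
value. -/
lemma circle_support (H : IsRPair h g) (hf : ∀ z ∈ unitDisk, f z = h z + conj (g z)) {ρ : ℝ}
    (hρ0 : 0 < ρ) (hρ : ρ ≤ Real.sqrt 2 - 1) {z w : ℂ} (hz : ‖z‖ = ρ) (hw : ‖w‖ = ρ) :
    (f w * conj (z * deriv h z - conj (z * deriv g z))).re
      ≤ (f z * conj (z * deriv h z - conj (z * deriv g z))).re := by
  have hs2 : Real.sqrt 2 ^ 2 = 2 := Real.sq_sqrt (by norm_num)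
  have hρ1 : ρ < 1 := by nlinarith [Real.sqrt_nonneg 2]
  let γ : ℝ → ℂ := circleMap 0 ρ
  have hγn : ∀ θ, ‖γ θ‖ = ρ := fun θ ↦ by simp [γ, abs_of_pos hρ0]
  have hγm : ∀ θ, γ θ ∈ unitDisk := fun θ ↦ by simpa [hγn θ] using hρ1
  have hγd : ∀ θ, HasDerivAt γ (γ θ * Complex.I) θ := fun θ ↦ hasDerivAt_circleMap 0 ρ θ
  have hγper : Function.Periodic γ (2 * Real.pi) := periodic_circleMap 0 ρ
  -- Since `γ μ = conj γ`, the normal factors as `γ q` with `q = h' - μ conj g'`. As `Re q > 0`, the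
  -- principal logarithm gives a smooth global argument `ψ = θ + arg q`.
  let μ : ℝ → ℂ := fun θ ↦ Complex.exp (-(2 * θ * Complex.I))
  have hμn : ∀ θ, ‖μ θ‖ = 1 := fun θ ↦ by
    have := Complex.norm_exp_ofReal_mul_I (-(2 * θ))
    simpa [μ] using this
  have hγexp : ∀ θ, γ θ = ρ * Complex.exp (θ * Complex.I) := fun θ ↦ by simp [γ, circleMap]
  have hμγ : ∀ θ, γ θ * μ θ = conj (γ θ) := fun θ ↦ by
    rw [hγexp, map_mul, Complex.conj_ofReal, ← Complex.exp_conj, mul_assoc, ← Complex.exp_add]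
    congr 2
    simp
    ring
  have hμd : ∀ θ, HasDerivAt μ (μ θ * (-(2 * Complex.I))) θ := fun θ ↦ by
    have h1 : HasDerivAt (fun x : ℂ ↦ -(2 * x * Complex.I)) (-(2 * Complex.I)) (θ : ℂ) := by
      simpa using ((((hasDerivAt_id (θ : ℂ)).const_mul 2).mul_const Complex.I).fun_neg)
    exact h1.cexp.comp_ofReal
  let q : ℝ → ℂ := fun θ ↦ deriv h (γ θ) - μ θ * conj (deriv g (γ θ))
  have hqre : ∀ θ, 0 < (q θ).re := fun θ ↦ H.inner_normal_pos (hγm θ) (hμn θ)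
  have hq0 : ∀ θ, q θ ≠ 0 := fun θ h0 ↦ by
    have := hqre θ
    simp [h0] at this
  have hconj : ∀ {F : ℝ → ℂ} {F' : ℂ} {θ : ℝ}, HasDerivAt F F' θ →
      HasDerivAt (fun θ ↦ conj (F θ)) (conj F') θ := fun hF ↦ hF.star
  have hder : ∀ {F : ℂ → ℂ}, DifferentiableOn ℂ F unitDisk → ∀ θ,
      HasDerivAt (fun θ ↦ F (γ θ)) (deriv F (γ θ) * (γ θ * Complex.I)) θ := fun hF θ ↦
    (hF.differentiableAt (isOpen_ball.mem_nhds (hγm θ))).hasDerivAt.comp θ (hγd θ)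
  have hqd : ∀ θ, HasDerivAt q (Complex.I * (γ θ * deriv (deriv h) (γ θ)
      + μ θ * conj (2 * deriv g (γ θ) + γ θ * deriv (deriv g) (γ θ)))) θ := fun θ ↦ by
    have h1 := (hder (H.diff_h.deriv isOpen_ball) θ).sub
      ((hμd θ).mul (hconj (hder (H.diff_g.deriv isOpen_ball) θ)))
    convert! h1 using 1
    simp only [map_add, map_mul, Complex.conj_I, map_ofNat]
    ring
  let ψ : ℝ → ℝ := fun θ ↦ θ + (Complex.log (q θ)).im
  have hψd : ∀ θ, HasDerivAt ψ (1 + ((Complex.I * (γ θ * deriv (deriv h) (γ θ)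
      + μ θ * conj (2 * deriv g (γ θ) + γ θ * deriv (deriv g) (γ θ)))) / q θ).im) θ := fun θ ↦ by
    have h1 := (hqd θ).clog_real (Or.inl (hqre θ))
    exact (hasDerivAt_id θ).add (Complex.imCLM.hasFDerivAt.comp_hasDerivAt θ h1)
  have hψmono : Monotone ψ := by
    refine monotone_of_deriv_nonneg (fun θ ↦ (hψd θ).differentiableAt) fun θ ↦ ?_
    rw [(hψd θ).deriv]
    have h1 := H.re_curvature_nonneg (z := γ θ) (by rw [hγn]; exact hρ) (hμn θ)
    have h2 : ∀ v : ℂ, 1 + (Complex.I * v / q θ).im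
        = ((v + q θ) * conj (q θ)).re / Complex.normSq (q θ) := fun v ↦ by
      have e1 : (Complex.I * v / q θ).im = (v / q θ).re := by
        rw [mul_div_assoc]; simp
      have e2 : (1 : ℝ) = (q θ / q θ).re := by rw [div_self (hq0 θ)]; simp
      rw [e1, e2, ← Complex.add_re, ← add_div, add_comm, Complex.div_re, Complex.mul_re,
        Complex.conj_re, Complex.conj_im]
      ring
    rw [h2]
    refine div_nonneg ?_ (Complex.normSq_nonneg _)
    refine h1.trans_eq ?_
    congr 2
    simp only [q, map_add, map_mul, map_ofNat]
    ring
  have hψper : ∀ θ, ψ (θ + 2 * Real.pi) = ψ θ + 2 * Real.pi := fun θ ↦ by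
    have h1 : μ (θ + 2 * Real.pi) = μ θ := by
      simp only [μ]
      rw [← Complex.exp_periodic.nat_mul 2]
      congr 1
      push_cast
      ring
    have h2 : q (θ + 2 * Real.pi) = q θ := by simp only [q, h1, hγper θ]
    simp only [ψ, h2]
    ring
  have hψcont : Continuous ψ := continuous_iff_continuousAt.2 fun θ ↦ (hψd θ).continuousAt
  have hN : ∀ θ, γ θ * deriv h (γ θ) - conj (γ θ * deriv g (γ θ))
      = ((ρ * ‖q θ‖ : ℝ) : ℂ) * Complex.exp (ψ θ * Complex.I) := fun θ ↦ by
    have h1 : γ θ * deriv h (γ θ) - conj (γ θ * deriv g (γ θ)) = γ θ * q θ := by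
      simp only [q, map_mul]
      linear_combination (conj (deriv g (γ θ))) * hμγ θ
    have h2 : q θ = ‖q θ‖ * Complex.exp ((Complex.log (q θ)).im * Complex.I) := by
      rw [Complex.log_im, Complex.norm_mul_exp_arg_mul_I]
    rw [h1, hγexp]
    nth_rw 1 [h2]
    simp only [ψ]
    push_cast
    rw [add_mul, Complex.exp_add]
    ring
  obtain ⟨θ₀, rfl⟩ : ∃ θ₀, γ θ₀ = z := by
    have : z ∈ range γ := by
      simp only [γ, range_circleMap, abs_of_pos hρ0]
      simpa using hz
    exact this
  obtain ⟨θ, hθ, rfl⟩ : ∃ θ ∈ Icc θ₀ (θ₀ + 2 * Real.pi), γ θ = w := by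
    have : w ∈ range γ := by
      simp only [γ, range_circleMap, abs_of_pos hρ0]
      simpa using hw
    obtain ⟨α, rfl⟩ := this
    obtain ⟨θ, hθ, he⟩ := hγper.exists_mem_Ico Real.two_pi_pos α θ₀
    exact ⟨θ, Ico_subset_Icc_self hθ, he.symm⟩
  let D : ℝ → ℝ := fun θ ↦ (f (γ θ) * conj (γ θ₀ * deriv h (γ θ₀) - conj (γ θ₀ * deriv g (γ θ₀)))).re
  change D θ ≤ D θ₀
  have hDd : ∀ θ, HasDerivAt D
      (-(ρ * ‖q θ‖ * (ρ * ‖q θ₀‖) * Real.sin (ψ θ - ψ θ₀))) θ := fun θ ↦ by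
    have h1 : HasDerivAt (fun θ ↦ f (γ θ))
        (Complex.I * (γ θ * deriv h (γ θ) - conj (γ θ * deriv g (γ θ)))) θ := by
      have h2 := (hder H.diff_h θ).add (hconj (hder H.diff_g θ))
      have h3 : (fun θ ↦ f (γ θ)) = (fun θ ↦ h (γ θ)) + fun θ ↦ conj (g (γ θ)) :=
        funext fun θ ↦ hf _ (hγm θ)
      rw [h3]
      convert! h2 using 1
      simp only [map_mul, Complex.conj_I]
      ring
    have h4 := Complex.reCLM.hasFDerivAt.comp_hasDerivAt θ (h1.mul_const
      (conj (γ θ₀ * deriv h (γ θ₀) - conj (γ θ₀ * deriv g (γ θ₀)))))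
    convert! h4 using 1
    rw [hN θ, hN θ₀, map_mul (starRingEnd ℂ), Complex.conj_ofReal, ← Complex.exp_conj,
      map_mul (starRingEnd ℂ), Complex.conj_I, Complex.conj_ofReal]
    have e : Complex.I * (((ρ * ‖q θ‖ : ℝ) : ℂ) * Complex.exp (ψ θ * Complex.I))
        * (((ρ * ‖q θ₀‖ : ℝ) : ℂ) * Complex.exp (ψ θ₀ * -Complex.I))
        = ((ρ * ‖q θ‖ * (ρ * ‖q θ₀‖) : ℝ) : ℂ)
          * (Complex.I * Complex.exp (((ψ θ - ψ θ₀ : ℝ) : ℂ) * Complex.I)) := by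
      have : (((ψ θ - ψ θ₀ : ℝ) : ℂ) * Complex.I) = ψ θ * Complex.I + ψ θ₀ * -Complex.I := by
        push_cast; ring
      rw [this, Complex.exp_add]
      push_cast
      ring
    rw [e, Complex.reCLM_apply, Complex.re_ofReal_mul, Complex.I_mul_re, Complex.exp_ofReal_mul_I_im]
    ring
  have hDc : Continuous D := continuous_iff_continuousAt.2 fun θ ↦ (hDd θ).continuousAt
  have hpi := Real.pi_pos
  obtain ⟨θ₁, hθ₁, hψ₁⟩ : ∃ θ₁ ∈ Icc θ₀ (θ₀ + 2 * Real.pi), ψ θ₁ = ψ θ₀ + Real.pi := by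
    refine intermediate_value_Icc (by linarith) hψcont.continuousOn ⟨by linarith, ?_⟩
    rw [hψper]
    linarith
  have hcoef : ∀ θ, 0 ≤ ρ * ‖q θ‖ * (ρ * ‖q θ₀‖) := fun θ ↦ by positivity
  rcases le_total θ θ₁ with hle | hle
  · have hanti : AntitoneOn D (Icc θ₀ θ₁) := by
      refine antitoneOn_of_deriv_nonpos (convex_Icc _ _) hDc.continuousOn
        (fun t _ ↦ (hDd t).differentiableAt.differentiableWithinAt) fun t ht ↦ ?_
      have ht' := interior_subset ht
      rw [(hDd t).deriv, neg_nonpos]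
      have h1 := hψmono ht'.1
      have h2 := hψmono ht'.2
      exact mul_nonneg (hcoef t) (Real.sin_nonneg_of_nonneg_of_le_pi (by linarith) (by linarith))
    exact hanti (left_mem_Icc.2 hθ₁.1) ⟨hθ.1, hle⟩ hθ.1
  · have hmono : MonotoneOn D (Icc θ₁ (θ₀ + 2 * Real.pi)) := by
      refine monotoneOn_of_deriv_nonneg (convex_Icc _ _) hDc.continuousOn
        (fun t _ ↦ (hDd t).differentiableAt.differentiableWithinAt) fun t ht ↦ ?_
      have ht' := interior_subset ht
      rw [(hDd t).deriv]
      have h1 := hψmono ht'.1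
      have h2 := hψmono ht'.2
      rw [hψper] at h2
      have h3 := Real.sin_nonneg_of_nonneg_of_le_pi (x := ψ t - ψ θ₀ - Real.pi) (by linarith)
        (by linarith)
      rw [Real.sin_sub_pi] at h3
      have := mul_nonneg (hcoef t) h3
      linarith
    have h1 := hmono ⟨hle, hθ.2⟩ (right_mem_Icc.2 hθ₁.2) hθ.2
    have h2 : D (θ₀ + 2 * Real.pi) = D θ₀ := by simp only [D, hγper θ₀]
    linarith

/-- `Re (f conj N)` is the real part of an analytic `k`, so the maximum principle for `exp k`
carries the inequality from the circle to the disk. -/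
lemma disk_support (H : IsRPair h g) (hf : ∀ z ∈ unitDisk, f z = h z + conj (g z)) {z w : ℂ}
    (hz0 : z ≠ 0) (hz : ‖z‖ ≤ Real.sqrt 2 - 1) (hw : ‖w‖ ≤ ‖z‖) :
    (f w * conj (z * deriv h z - conj (z * deriv g z))).re
      ≤ (f z * conj (z * deriv h z - conj (z * deriv g z))).re := by
  set N := z * deriv h z - conj (z * deriv g z) with hN
  have hs2 : Real.sqrt 2 ^ 2 = 2 := Real.sq_sqrt (by norm_num)
  have hz1 : ‖z‖ < 1 := by nlinarith [Real.sqrt_nonneg 2]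
  have hsub : closedBall (0 : ℂ) ‖z‖ ⊆ unitDisk := closedBall_subset_ball hz1
  let k : ℂ → ℂ := fun w ↦ conj N * h w + N * g w
  have hk : DifferentiableOn ℂ k unitDisk := (H.diff_h.const_mul _).add (H.diff_g.const_mul _)
  have hkre : ∀ w ∈ unitDisk, (k w).re = (f w * conj N).re := fun w hw ↦ by
    rw [hf w hw]
    simp only [k, Complex.mul_re, Complex.add_re, Complex.conj_re, Complex.conj_im, Complex.add_im]
    ring
  have hzn := norm_pos_iff.2 hz0
  have hd : DiffContOnCl ℂ (fun w ↦ Complex.exp (k w)) (ball 0 ‖z‖) := by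
    refine DifferentiableOn.diffContOnCl ?_
    rw [closure_ball _ hzn.ne']
    exact (hk.mono hsub).cexp
  have hmax := Complex.norm_le_of_forall_mem_frontier_norm_le isBounded_ball hd
    (C := Real.exp (f z * conj N).re) (fun v hv ↦ by
      rw [frontier_ball _ hzn.ne'] at hv
      have hvn : ‖v‖ = ‖z‖ := by simpa using hv
      rw [Complex.norm_exp, hkre v (hsub (sphere_subset_closedBall hv))]
      exact Real.exp_le_exp.2 (H.circle_support hf hzn hz rfl hvn))
    (z := w) (by rw [closure_ball _ hzn.ne']; simpa using hw)
  rw [Complex.norm_exp, hkre w (hsub (by simpa using hw))] at hmax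
  exact Real.exp_le_exp.1 hmax

/-- An omitted convex combination equals `f p + τ p` with `|p| = r`, `τ ≥ 0`. As `Re (p conj N) >
0`, it lies on or beyond the supporting line at `f p`, whereas both endpoints lie strictly before
it. -/
lemma convexInDisk (H : IsRPair h g) (hf : ∀ z ∈ unitDisk, f z = h z + conj (g z)) {r : ℝ}
    (hr0 : 0 < r) (hr : r ≤ Real.sqrt 2 - 1) : ConvexInDisk f r := by
  have hs2 : Real.sqrt 2 ^ 2 = 2 := Real.sq_sqrt (by norm_num)
  have hr1 : r < 1 := by nlinarith [Real.sqrt_nonneg 2]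
  have hmr := H.locallyStronglyMonotone hf hr1.le
  have hm1 := H.locallyStronglyMonotone hf le_rfl
  refine ⟨hmr.injOn, ?_⟩
  intro y₁ h₁ y₂ h₂ s t hs ht hst
  by_contra hy
  obtain ⟨p, hp, τ, hτ, hyp, hτp⟩ := hm1.exists_eq_add_smul hr0 hr1 (s • y₁ + t • y₂)
  have hp' : ‖p‖ ≤ r := by simpa using hp
  have hpr : ‖p‖ = r := by
    refine hp'.antisymm ?_
    by_contra! hlt
    exact hy ⟨p, by simpa using hlt, by rw [hyp, hτp hlt]; simp⟩
  have hp0 : p ≠ 0 := by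
    rw [← norm_pos_iff, hpr]; exact hr0
  have hpm : p ∈ unitDisk := by simpa [hpr] using hr1
  set N := p * deriv h p - conj (p * deriv g p) with hN
  have hpN : 0 < (p * conj N).re := by
    have hmu : ‖conj p / p‖ = 1 := by rw [norm_div, Complex.norm_conj, div_self (by simpa using hp0)]
    have h1 := H.inner_normal_pos hpm hmu
    have e : p * conj N = ((‖p‖ ^ 2 : ℝ) : ℂ) * conj (deriv h p - conj p / p * conj (deriv g p)) := by
      rw [← Complex.normSq_eq_norm_sq, ← Complex.mul_conj, hN]
      have : conj p ≠ 0 := by simpa using hp0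
      simp only [map_sub, map_mul, map_div₀, Complex.conj_conj]
      field_simp
    rw [e, Complex.re_ofReal_mul, Complex.conj_re]
    positivity
  have hN0 : N ≠ 0 := by
    intro h0
    simp [h0] at hpN
  -- The image is open, so `y` can be pushed a little in the direction `N`; this makes the support
  -- inequality strict.
  have hstrict : ∀ y ∈ f '' ball 0 r, (y * conj N).re < (f p * conj N).re := by
    intro y hy
    have hopen := hmr.isOpen_image
    have hlim : Tendsto (fun δ : ℝ ↦ y + δ * N) (𝓝[>] 0) (𝓝 y) := by
      have : Continuous fun δ : ℝ ↦ y + δ * N := by fun_prop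
      simpa using (this.tendsto 0).mono_left nhdsWithin_le_nhds
    obtain ⟨δ, ⟨w, hw, hwy⟩, hδ⟩ :=
      ((hlim.eventually (hopen.mem_nhds hy)).and self_mem_nhdsWithin).exists
    have hδ' : 0 < δ := hδ
    have h1 := H.disk_support hf hp0 (by rw [hpr]; exact hr)
      (show ‖w‖ ≤ ‖p‖ by rw [hpr]; exact (mem_ball_zero_iff.1 hw).le)
    simp only [hwy] at h1
    rw [add_mul, mul_assoc, Complex.mul_conj, Complex.add_re, Complex.re_ofReal_mul,
      Complex.ofReal_re] at h1
    have := mul_pos hδ' (Complex.normSq_pos.2 hN0)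
    linarith
  have e1 := hstrict y₁ h₁
  have e2 := hstrict y₂ h₂
  have e3 : ((s • y₁ + t • y₂) * conj N).re = s * (y₁ * conj N).re + t * (y₂ * conj N).re := by
    simp only [Complex.real_smul, add_mul, mul_assoc, Complex.add_re, Complex.re_ofReal_mul]
  have e4 : ((s • y₁ + t • y₂) * conj N).re = (f p * conj N).re + τ * (p * conj N).re := by
    rw [hyp]
    simp only [Complex.real_smul, add_mul, mul_assoc, Complex.add_re, Complex.re_ofReal_mul]
  have e5 := mul_nonneg hτ hpN.le
  have e6 : s * (y₁ * conj N).re + t * (y₂ * conj N).re < (f p * conj N).re := by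
    rcases hs.eq_or_lt with rfl | hs
    · rw [zero_add] at hst
      subst hst
      linarith
    · have := mul_lt_mul_of_pos_left e1 hs
      have := mul_le_mul_of_nonneg_left e2.le ht
      have e7 : s * (f p * conj N).re + t * (f p * conj N).re = (f p * conj N).re := by
        rw [← add_mul, hst, one_mul]
      linarith
  linarith

end IsRPair

/-! ### Sharpness of the radius of convexity -/

lemma extremalFun_conj {z : ℂ} (hz : z ∈ unitDisk) :
    extremalFun (conj z) = conj (extremalFun z) := by
  have : (1 - z).arg ≠ Real.pi := Complex.slitPlane_arg_ne_pi (Or.inl (one_sub_re_pos hz))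
  simp only [extremalFun, map_sub, map_neg, map_mul, map_ofNat, ← Complex.log_conj _ this, map_one]

/-- The image is symmetric in the real axis, so convexity puts `Re f₀(z)` into it. By injectivity
this value is attained at a real point, and `f₀` increases on the real interval. -/
lemma lt_re_extremalFun_of_convex {r : ℝ} (hr1 : r ≤ 1)
    (hc : Convex ℝ (extremalFun '' ball 0 r)) {z : ℂ} (hz : z ∈ ball (0 : ℂ) r) :
    r - 2 * Real.log (1 + r) < (extremalFun z).re := by
  have hsub : ball (0 : ℂ) r ⊆ unitDisk := ball_subset_ball hr1
  have hzc : conj z ∈ ball (0 : ℂ) r := by simpa using hz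
  have h1 := hc (mem_image_of_mem _ hz) (mem_image_of_mem _ hzc) (by norm_num : (0 : ℝ) ≤ 1 / 2)
    (by norm_num : (0 : ℝ) ≤ 1 / 2) (by norm_num)
  obtain ⟨w, hw, hwz⟩ := h1
  have hre : extremalFun w = ((extremalFun z).re : ℂ) := by
    rw [hwz, extremalFun_conj (hsub hz), Complex.re_eq_add_conj]
    simp only [Complex.real_smul]
    push_cast
    ring
  have hwr : conj w = w := by
    refine extremalFun_monotone.injOn (hsub (by simpa using hw)) (hsub hw) ?_
    rw [extremalFun_conj (hsub hw), hre, Complex.conj_ofReal]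
  obtain ⟨x, rfl⟩ := Complex.conj_eq_iff_real.1 hwr
  have hx : |x| < r := by simpa using hw
  rw [abs_lt] at hx
  rw [extremalFun_ofReal (by linarith), Complex.ofReal_inj] at hre
  rw [← hre]
  have hmono : StrictMonoOn (fun t : ℝ ↦ -t - 2 * Real.log (1 - t)) (Icc (-r) x) := by
    refine strictMonoOn_of_deriv_pos (convex_Icc _ _)
      (fun t ht ↦ (hasDerivAt_upper (by linarith [ht.2])).continuousAt.continuousWithinAt)
      fun t ht ↦ ?_
    rw [interior_Icc] at ht
    rw [(hasDerivAt_upper (by linarith [ht.2])).deriv]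
    exact div_pos (by linarith [ht.1]) (by linarith [ht.2])
  have := hmono (left_mem_Icc.2 hx.1.le) (right_mem_Icc.2 hx.1.le) hx.1
  simp only [neg_neg, sub_neg_eq_add] at this
  exact this

lemma extremalFun_re (s τ : ℝ) : (extremalFun (-(s * Complex.exp (τ * Complex.I)))).re
    = s * Real.cos τ - Real.log (1 + 2 * s * Real.cos τ + s ^ 2) := by
  have h1 : 2 * Real.log ‖1 - -(s * Complex.exp (τ * Complex.I))‖
      = Real.log (1 + 2 * s * Real.cos τ + s ^ 2) := by
    have h2 : ‖1 - -(s * Complex.exp (τ * Complex.I))‖ ^ 2 = 1 + 2 * s * Real.cos τ + s ^ 2 := by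
      rw [← Complex.normSq_eq_norm_sq, Complex.normSq_apply]
      simp only [Complex.sub_re, Complex.sub_im, Complex.neg_re, Complex.neg_im,
        Complex.re_ofReal_mul, Complex.im_ofReal_mul, Complex.exp_ofReal_mul_I_re,
        Complex.exp_ofReal_mul_I_im, Complex.one_re, Complex.one_im]
      linear_combination s ^ 2 * Real.sin_sq_add_cos_sq τ
    rw [← h2, Real.log_pow]
    norm_num
  rw [extremalFun, Complex.sub_re, ← h1, neg_neg, Complex.re_ofReal_mul,
    Complex.exp_ofReal_mul_I_re, ← Complex.log_re]
  simp

/-- On `|z| = r` the real part of `f₀`, as a function of `c = cos τ` with `z = -r e^{iτ}`, would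
have its minimum at `c = 1`. Its derivative there is positive as soon as `(1 + r)² > 2`. Using `c`
instead of `τ` makes a first derivative suffice. -/
lemma extremalFun_not_convexInDisk {r : ℝ} (hr : Real.sqrt 2 - 1 < r) (hr1 : r ≤ 1) :
    ¬ ConvexInDisk extremalFun r := by
  rintro ⟨-, hc⟩
  have hs2 : Real.sqrt 2 ^ 2 = 2 := Real.sq_sqrt (by norm_num)
  have hs1 : 1 < Real.sqrt 2 := by nlinarith [Real.sqrt_nonneg 2]
  have hr0 : 0 < r := by linarith
  have key : ∀ s ∈ Ioo 0 r, ∀ c ∈ Icc (-1 : ℝ) 1,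
      r - 2 * Real.log (1 + r) < s * c - Real.log (1 + 2 * s * c + s ^ 2) := by
    intro s hs c hc'
    have h1 := lt_re_extremalFun_of_convex hr1 hc
      (z := -(s * Complex.exp (Real.arccos c * Complex.I))) (by
        rw [mem_ball_zero_iff, norm_neg, norm_mul, Complex.norm_exp_ofReal_mul_I, mul_one,
          Complex.norm_real, Real.norm_eq_abs, abs_of_pos hs.1]
        exact hs.2)
    rwa [extremalFun_re, Real.cos_arccos hc'.1 hc'.2] at h1
  have hle : ∀ c ∈ Ioo (0 : ℝ) 1,
      r - 2 * Real.log (1 + r) ≤ r * c - Real.log (1 + 2 * r * c + r ^ 2) := by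
    intro c hc'
    have hpos : 0 < 1 + 2 * r * c + r ^ 2 := by
      have := mul_pos hr0 hc'.1
      nlinarith
    have hcont : ContinuousAt (fun s : ℝ ↦ s * c - Real.log (1 + 2 * s * c + s ^ 2)) r := by
      refine ContinuousAt.sub (by fun_prop) (ContinuousAt.log (by fun_prop) hpos.ne')
    refine ge_of_tendsto (hcont.tendsto.mono_left (nhdsWithin_le_nhds (s := Iio r))) ?_
    filter_upwards [Ioo_mem_nhdsLT hr0] with s hs
    exact (key s hs c ⟨by linarith [hc'.1], hc'.2.le⟩).le
  have hd : HasDerivAt (fun c : ℝ ↦ r * c - Real.log (1 + 2 * r * c + r ^ 2))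
      (r - 2 * r / (1 + 2 * r * 1 + r ^ 2)) 1 := by
    have h1 : HasDerivAt (fun c : ℝ ↦ 1 + 2 * r * c + r ^ 2) (2 * r) 1 := by
      simpa using (((hasDerivAt_id (1 : ℝ)).const_mul (2 * r)).const_add 1).add_const (r ^ 2)
    have h2 := h1.log (by positivity)
    have h3 : HasDerivAt (fun c : ℝ ↦ r * c) r 1 := by
      simpa using (hasDerivAt_id (1 : ℝ)).const_mul r
    exact h3.sub h2
  have hd0 : 0 < r - 2 * r / (1 + 2 * r * 1 + r ^ 2) := by
    rw [sub_pos, div_lt_iff₀ (by positivity)]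
    have : 2 < 1 + 2 * r * 1 + r ^ 2 := by nlinarith
    nlinarith
  have hslope := (hasDerivAt_iff_tendsto_slope_left_right.1 hd).1.eventually_const_lt hd0
  obtain ⟨c, hc1, hc2⟩ := (hslope.and (Ioo_mem_nhdsLT (show (0 : ℝ) < 1 by norm_num))).exists
  have h1 := hle c hc2
  have h2 : Real.log (1 + 2 * r * 1 + r ^ 2) = 2 * Real.log (1 + r) := by
    rw [show 1 + 2 * r * 1 + r ^ 2 = (1 + r) ^ 2 by ring, Real.log_pow]; norm_num
  rw [slope_def_field, h2] at hc1
  have h3 : c - 1 < 0 := by linarith [hc2.2]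
  have h4 := div_nonpos_of_nonneg_of_nonpos
    (show 0 ≤ r * c - Real.log (1 + 2 * r * c + r ^ 2) - (r * 1 - 2 * Real.log (1 + r)) by linarith)
    h3.le
  linarith

lemma isRadiusOfConvexity_classRH0 : IsRadiusOfConvexity classRH0 (Real.sqrt 2 - 1) := by
  have hs2 : Real.sqrt 2 ^ 2 = 2 := Real.sq_sqrt (by norm_num)
  have hs0 := Real.sqrt_nonneg 2
  refine ⟨⟨by nlinarith, by nlinarith⟩, fun r hr ↦ ⟨fun hall ↦ ?_, fun hle f hf ↦ ?_⟩⟩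
  · by_contra! hlt
    exact extremalFun_not_convexInDisk hlt hr.2 (hall _ extremalFun_mem)
  · obtain ⟨h, g, H, hfe⟩ := exists_isRPair hf
    exact H.convexInDisk hfe hr.1 hle

end HarmonicMappings

namespace HarmonicMappings

open Metric Set Filter Topology
open scoped ComplexConjugate RealInnerProductSpace

/-! ### Taylor coefficients as circle averages -/

section Taylor

variable {p q : ℂ → ℂ} {r : ℝ}

lemma hasSum_taylorCoeff (hd : DifferentiableOn ℂ p unitDisk) {z : ℂ} (hz : z ∈ unitDisk) :
    HasSum (fun n ↦ taylorCoeff p n * z ^ n) (p z) := by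
  convert! Complex.hasSum_taylorSeries_on_ball hd hz using 2 with n
  simp only [taylorCoeff, sub_zero, smul_eq_mul]
  ring

lemma taylorCoeff_deriv (p : ℂ → ℂ) (n : ℕ) :
    taylorCoeff (deriv p) n = (n + 1) * taylorCoeff p (n + 1) := by
  have h1 : (n.factorial : ℂ) ≠ 0 := by exact_mod_cast (Nat.factorial_pos _).ne'
  have h2 : (n + 1 : ℂ) ≠ 0 := by exact_mod_cast n.succ_ne_zero
  rw [taylorCoeff, taylorCoeff, iteratedDeriv_succ', Nat.factorial_succ]
  push_cast
  field_simp

lemma taylorCoeff_add_const_mul (hp : DifferentiableOn ℂ p unitDisk)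
    (hq : DifferentiableOn ℂ q unitDisk) (ε : ℂ) (n : ℕ) :
    taylorCoeff (fun z ↦ p z + ε * q z) n = taylorCoeff p n + ε * taylorCoeff q n := by
  have hn := isOpen_ball.mem_nhds zero_mem_unitDisk
  have h1 : ContDiffAt ℂ n p 0 := (hp.analyticAt hn).contDiffAt
  have h2 : ContDiffAt ℂ n (fun z ↦ ε * q z) 0 := contDiffAt_const.mul (hq.analyticAt hn).contDiffAt
  simp only [taylorCoeff]
  rw [iteratedDeriv_fun_add h1 h2, iteratedDeriv_const_mul_field]
  ring

lemma sphere_subset_unitDisk (hr : r < 1) : sphere (0 : ℂ) r ⊆ unitDisk :=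
  sphere_subset_closedBall.trans (closedBall_subset_ball hr)

lemma circleAverage_taylor (hp : DifferentiableOn ℂ p unitDisk) (hr0 : 0 < r) (hr : r < 1)
    (n : ℕ) : Real.circleAverage (fun ζ ↦ (r / ζ) ^ n * p ζ) 0 r = taylorCoeff p n * r ^ n := by
  rw [Real.circleAverage_eq_circleIntegral hr0.ne']
  have h1 := (hp.mono (closedBall_subset_ball hr)).circleIntegral_one_div_sub_center_pow_smul hr0 n
  have h2 : (fun ζ : ℂ ↦ (ζ - 0)⁻¹ • ((r / ζ) ^ n * p ζ))
      = fun ζ ↦ (r ^ n : ℂ) • ((1 / (ζ - 0) ^ (n + 1)) • p ζ) := by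
    funext ζ
    simp only [sub_zero, smul_eq_mul, pow_succ, mul_inv, div_eq_mul_inv]
    ring
  rw [h2, circleIntegral.integral_smul, h1, taylorCoeff]
  have h3 : (2 * Real.pi * Complex.I : ℂ) ≠ 0 := Complex.two_pi_I_ne_zero
  simp only [smul_eq_mul]
  field_simp

lemma continuousOn_weight (hp : ContinuousOn p unitDisk) (hr0 : 0 < r) (hr : r < 1) (n : ℕ) :
    ContinuousOn (fun ζ : ℂ ↦ ((r : ℂ) / ζ) ^ n * p ζ) (sphere 0 r) := by
  refine ((continuousOn_const.div continuousOn_id fun ζ hζ h0 ↦ ?_).pow n).mul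
    (hp.mono (sphere_subset_unitDisk hr))
  simp only [id] at h0
  simp [h0] at hζ
  linarith

/-- On the circle `r/ζ = conj (ζ/r)`, so the integrand is the conjugate of an analytic function and
the mean value property applies. -/
lemma circleAverage_conj (hp : DifferentiableOn ℂ p unitDisk) (hr0 : 0 < r) (hr : r < 1)
    (n : ℕ) : Real.circleAverage (fun ζ ↦ (r / ζ) ^ n * conj (p ζ)) 0 r = conj (0 ^ n * p 0) := by
  have hr' : (r : ℂ) ≠ 0 := by exact_mod_cast hr0.ne'
  have h1 : EqOn (fun ζ : ℂ ↦ (r / ζ) ^ n * conj (p ζ))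
      (Complex.conjCLE.toContinuousLinearMap ∘ fun ζ ↦ (ζ / r) ^ n * p ζ) (sphere 0 |r|) := by
    intro ζ hζ
    have hζn : ‖ζ‖ = r := by simpa [abs_of_pos hr0] using hζ
    have hζ0 : ζ ≠ 0 := by rw [← norm_pos_iff, hζn]; exact hr0
    have e : (r : ℂ) / ζ = conj (ζ / r) := by
      rw [map_div₀, Complex.conj_ofReal, div_eq_div_iff hζ0 hr', mul_comm (conj ζ), Complex.mul_conj,
        Complex.normSq_eq_norm_sq, hζn]
      push_cast
      ring
    simp [e]
  have hd : DifferentiableOn ℂ (fun ζ : ℂ ↦ (ζ / r) ^ n * p ζ) unitDisk :=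
    ((differentiableOn_id.div_const _).pow n).mul hp
  have hcl : DiffContOnCl ℂ (fun ζ : ℂ ↦ (ζ / r) ^ n * p ζ) (ball 0 |r|) := by
    refine DifferentiableOn.diffContOnCl ?_
    rw [abs_of_pos hr0, closure_ball _ hr0.ne']
    exact hd.mono (closedBall_subset_ball hr)
  rw [Real.circleAverage_congr_sphere h1, ContinuousLinearMap.circleAverage_comp_comm,
    hcl.circleAverage]
  · simp
  · exact (hd.continuousOn.mono (sphere_subset_unitDisk hr)).circleIntegrable hr0.le

lemma circleAverage_re (hp : DifferentiableOn ℂ p unitDisk) (h0 : p 0 = 1) (hr0 : 0 < r)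
    (hr : r < 1) (n : ℕ) :
    Real.circleAverage (fun ζ ↦ (r / ζ) ^ n * ((p ζ).re : ℂ)) 0 r
      = if n = 0 then 1 else taylorCoeff p n / 2 * r ^ n := by
  have h1 : (fun ζ : ℂ ↦ (r / ζ) ^ n * ((p ζ).re : ℂ)) = fun ζ ↦ (1 / 2 : ℂ) •
      ((r / ζ) ^ n * p ζ + (r / ζ) ^ n * conj (p ζ)) := by
    funext ζ
    rw [Complex.re_eq_add_conj, smul_eq_mul]
    ring
  have hc : ContinuousOn (fun ζ ↦ conj (p ζ)) unitDisk :=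
    Complex.continuous_conj.comp_continuousOn hp.continuousOn
  rw [h1, Real.circleAverage_fun_smul, Real.circleAverage_fun_add
    ((continuousOn_weight hp.continuousOn hr0 hr n).circleIntegrable hr0.le)
    ((continuousOn_weight hc hr0 hr n).circleIntegrable hr0.le),
    circleAverage_taylor hp hr0 hr, circleAverage_conj hp hr0 hr, h0]
  split_ifs with hn
  · subst hn
    simp [taylorCoeff, h0]
    norm_num
  · simp [hn]
    ring

/-- Carathéodory's coefficient bound. -/
lemma norm_taylorCoeff_le_two (hp : DifferentiableOn ℂ p unitDisk)
    (hre : ∀ z ∈ unitDisk, 0 ≤ (p z).re) (h0 : p 0 = 1) {n : ℕ} (hn : n ≠ 0) :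
    ‖taylorCoeff p n‖ ≤ 2 := by
  have key : ∀ r ∈ Ioo (0 : ℝ) 1, ‖taylorCoeff p n‖ * r ^ n ≤ 2 := by
    rintro r ⟨hr0, hr⟩
    have h1 := circleAverage_re hp h0 hr0 hr n
    have h2 := circleAverage_re hp h0 hr0 hr 0
    rw [if_neg hn] at h1
    rw [if_pos rfl] at h2
    have hm : ∀ θ, circleMap 0 r θ ∈ unitDisk := fun θ ↦
      sphere_subset_unitDisk hr (circleMap_mem_sphere 0 hr0.le θ)
    -- The weight is unimodular and `Re p ≥ 0`, so every Fourier coefficient is dominated by the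
    -- zeroth one, which is 1.
    have h3 : ‖Real.circleAverage (fun ζ ↦ (r / ζ) ^ n * ((p ζ).re : ℂ)) 0 r‖
        ≤ Real.circleAverage (fun ζ ↦ (p ζ).re) 0 r := by
      rw [Real.circleAverage, Real.circleAverage, norm_smul, Real.norm_eq_abs,
        abs_of_pos (inv_pos.2 Real.two_pi_pos), smul_eq_mul]
      refine mul_le_mul_of_nonneg_left ?_ (inv_pos.2 Real.two_pi_pos).le
      refine (intervalIntegral.norm_integral_le_integral_norm Real.two_pi_pos.le).trans_eq ?_
      refine intervalIntegral.integral_congr fun θ _ ↦ ?_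
      simp only [norm_mul, norm_pow, norm_div, Complex.norm_real, norm_circleMap_zero,
        Real.norm_eq_abs, div_self (abs_pos.2 hr0.ne').ne', one_pow, one_mul,
        abs_of_nonneg (hre _ (hm θ))]
    have h4 : Real.circleAverage (fun ζ ↦ (p ζ).re) 0 r = 1 := by
      have h5 : ((Real.circleAverage (fun ζ ↦ (p ζ).re) 0 r : ℝ) : ℂ) = 1 := by
        rw [← h2]
        simp only [pow_zero, one_mul]
        rw [← Complex.ofRealCLM_apply, ← ContinuousLinearMap.circleAverage_comp_comm]
        · rfl
        · exact ((Complex.continuous_re.comp_continuousOn hp.continuousOn).mono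
            (sphere_subset_unitDisk hr)).circleIntegrable hr0.le
      exact_mod_cast h5
    rw [h1, h4, norm_mul, norm_div, norm_pow, Complex.norm_real, Real.norm_eq_abs,
      abs_of_pos hr0, Complex.norm_ofNat] at h3
    linarith
  have ht : Tendsto (fun r : ℝ ↦ ‖taylorCoeff p n‖ * r ^ n) (𝓝[<] 1) (𝓝 (‖taylorCoeff p n‖)) := by
    have : Continuous fun r : ℝ ↦ ‖taylorCoeff p n‖ * r ^ n := by fun_prop
    simpa using (this.tendsto 1).mono_left nhdsWithin_le_nhds
  refine le_of_tendsto ht ?_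
  filter_upwards [Ioo_mem_nhdsLT (show (0 : ℝ) < 1 by norm_num)] with r hr using key r hr

/-! ### Convolution with functions of positive real part -/

/-- Termwise integration of the Taylor series of `p`, dominated by `|a_n| |z|^n (1 + r)/(1 - r)`. -/
lemma hasSum_circleAverage_convolution (hp : DifferentiableOn ℂ p unitDisk)
    (hq : DifferentiableOn ℂ q unitDisk) (hqre : ∀ z ∈ unitDisk, 0 ≤ (q z).re) (hq0 : q 0 = 1)
    (hr0 : 0 < r) (hr : r < 1) {z : ℂ} (hz : z ∈ unitDisk) :
    HasSum (fun n ↦ taylorCoeff p n * z ^ n *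
        Real.circleAverage (fun ζ ↦ (r / ζ) ^ n * ((q ζ).re : ℂ)) 0 r)
      (Real.circleAverage (fun ζ ↦ p (z * (r / ζ)) * ((q ζ).re : ℂ)) 0 r) := by
  have hγn : ∀ θ, ‖circleMap 0 r θ‖ = r := fun θ ↦ by simp [abs_of_pos hr0]
  have hγ0 : ∀ θ, circleMap 0 r θ ≠ 0 := fun θ ↦ by
    rw [← norm_pos_iff, hγn]; exact hr0
  have hm : ∀ θ, circleMap 0 r θ ∈ unitDisk := fun θ ↦
    sphere_subset_unitDisk hr (circleMap_mem_sphere 0 hr0.le θ)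
  have hun : ∀ θ, ‖(r : ℂ) / circleMap 0 r θ‖ = 1 := fun θ ↦ by
    rw [norm_div, hγn, Complex.norm_real, Real.norm_eq_abs, abs_of_pos hr0, div_self hr0.ne']
  have hzu : ∀ θ, z * (r / circleMap 0 r θ) ∈ unitDisk := fun θ ↦ by
    rw [mem_ball_zero_iff, norm_mul, hun, mul_one]
    simpa using hz
  have hqb : ∀ θ, ‖(((q (circleMap 0 r θ)).re : ℝ) : ℂ)‖ ≤ (1 + r) / (1 - r) := fun θ ↦ by
    rw [Complex.norm_real, Real.norm_eq_abs]
    refine (Complex.abs_re_le_norm _).trans ?_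
    have := norm_le_one_add_div hq hqre hq0 (hm θ)
    rwa [hγn] at this
  have hqc : Continuous fun θ ↦ (((q (circleMap 0 r θ)).re : ℝ) : ℂ) :=
    Complex.continuous_ofReal.comp (Complex.continuous_re.comp
      (hq.continuousOn.comp_continuous (continuous_circleMap 0 r) hm))
  have hfc : Continuous fun θ ↦ (r : ℂ) / circleMap 0 r θ :=
    continuous_const.div (continuous_circleMap 0 r) hγ0
  have hsn : Summable fun n ↦ ‖taylorCoeff p n‖ * ‖z‖ ^ n := by
    obtain ⟨s, hzs, hs⟩ := exists_between (show ‖z‖ < 1 by simpa using hz)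
    have hs0 : 0 ≤ s := (norm_nonneg z).trans hzs.le
    have h1 := (hasSum_taylorCoeff hp (z := (s : ℂ))
      (by simpa [abs_of_nonneg hs0] using hs)).summable.norm
    refine Summable.of_nonneg_of_le (fun n ↦ by positivity) (fun n ↦ ?_) h1
    rw [norm_mul, norm_pow, Complex.norm_real, Real.norm_eq_abs, abs_of_nonneg hs0]
    gcongr
  have key := intervalIntegral.hasSum_integral_of_dominated_convergence
    (μ := MeasureTheory.volume) (a := 0) (b := 2 * Real.pi)
    (F := fun n θ ↦ taylorCoeff p n * z ^ n *
      ((r / circleMap 0 r θ) ^ n * (((q (circleMap 0 r θ)).re : ℝ) : ℂ)))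
    (f := fun θ ↦ p (z * (r / circleMap 0 r θ)) * (((q (circleMap 0 r θ)).re : ℝ) : ℂ))
    (fun n _ ↦ ‖taylorCoeff p n‖ * ‖z‖ ^ n * ((1 + r) / (1 - r)))
    (fun n ↦ (continuous_const.mul ((hfc.pow n).mul hqc)).aestronglyMeasurable)
    (fun n ↦ MeasureTheory.ae_of_all _ fun θ _ ↦ by
      rw [norm_mul, norm_mul, norm_mul, norm_pow, norm_pow, hun, one_pow, one_mul]
      gcongr
      exact hqb θ)
    (MeasureTheory.ae_of_all _ fun θ _ ↦ hsn.mul_right _)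
    intervalIntegrable_const
    (MeasureTheory.ae_of_all _ fun θ _ ↦ by
      have := (hasSum_taylorCoeff hp (hzu θ)).mul_right (((q (circleMap 0 r θ)).re : ℝ) : ℂ)
      refine this.congr_fun fun n ↦ ?_
      rw [mul_pow]
      ring)
  have key2 := key.const_smul ((2 * Real.pi)⁻¹)
  refine key2.congr_fun fun n ↦ ?_
  rw [Real.circleAverage, intervalIntegral.integral_const_mul, mul_smul_comm]

/-- If `Re p ≥ 0`, `Re q ≥ 0` and `q(0) = 1`, then the convolution of `p` with `(1 + q) / 2` has
nonnegative real part. -/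
lemma re_convolution_nonneg (hp : DifferentiableOn ℂ p unitDisk)
    (hpre : ∀ z ∈ unitDisk, 0 ≤ (p z).re)
    (hq : DifferentiableOn ℂ q unitDisk) (hqre : ∀ z ∈ unitDisk, 0 ≤ (q z).re) (hq0 : q 0 = 1)
    {z S : ℂ} (hz : z ∈ unitDisk)
    (hS : HasSum (fun n ↦ taylorCoeff p n * (if n = 0 then 1 else taylorCoeff q n / 2) * z ^ n) S) :
    0 ≤ S.re := by
  have hz1 : ‖z‖ < 1 := by simpa using hz
  obtain ⟨r, hzr, hr⟩ := exists_between hz1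
  have hr0 : 0 < r := (norm_nonneg z).trans_lt hzr
  have hr' : (r : ℂ) ≠ 0 := by exact_mod_cast hr0.ne'
  have hzm : z / r ∈ unitDisk := by
    rw [mem_ball_zero_iff, norm_div, Complex.norm_real, Real.norm_eq_abs, abs_of_pos hr0,
      div_lt_one hr0]
    exact hzr
  have h1 := hasSum_circleAverage_convolution hp hq hqre hq0 hr0 hr hzm
  -- Evaluating at `z/r` cancels the factor `r^n` of the circle averages, so no limit in `r` is
  -- needed.
  have h2 : S = Real.circleAverage (fun ζ ↦ p (z / r * (r / ζ)) * ((q ζ).re : ℂ)) 0 r := by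
    refine hS.unique (h1.congr_fun fun n ↦ ?_)
    rw [circleAverage_re hq hq0 hr0 hr, div_pow]
    split_ifs with hn
    · subst hn; simp
    · field_simp
  have hun : ∀ ζ ∈ sphere (0 : ℂ) r, z / r * (r / ζ) ∈ unitDisk := fun ζ hζ ↦ by
    have hζn : ‖ζ‖ = r := by simpa using hζ
    rw [mem_ball_zero_iff, norm_mul, norm_div (r : ℂ), hζn, Complex.norm_real, Real.norm_eq_abs,
      abs_of_pos hr0, div_self hr0.ne', mul_one]
    simpa using hzm
  have hζ0 : ∀ ζ ∈ sphere (0 : ℂ) r, ζ ≠ 0 := fun ζ hζ h0 ↦ by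
    simp [h0] at hζ
    linarith
  rw [h2, ← Complex.reCLM_apply, ← ContinuousLinearMap.circleAverage_comp_comm]
  · refine Real.circleAverage_nonneg_of_nonneg fun ζ hζ ↦ ?_
    rw [abs_of_pos hr0] at hζ
    simp only [Function.comp_apply, Complex.reCLM_apply, Complex.re_mul_ofReal]
    exact mul_nonneg (hpre _ (hun ζ hζ)) (hqre _ (sphere_subset_unitDisk hr hζ))
  · refine ContinuousOn.circleIntegrable hr0.le (ContinuousOn.mul ?_ ?_)
    · exact hp.continuousOn.comp (continuousOn_const.mul
        (continuousOn_const.div continuousOn_id hζ0)) hun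
    · exact Complex.continuous_ofReal.comp_continuousOn (Complex.continuous_re.comp_continuousOn
        (hq.continuousOn.mono (sphere_subset_unitDisk hr)))

end Taylor

/-! ### Power series with bounded coefficients -/

section PowerSeries

variable {c : ℕ → ℂ} {C : ℝ}

lemma powerSeries_bounded (hc : ∀ n, ‖c n‖ ≤ C) :
    DifferentiableOn ℂ (fun z ↦ ∑' n, c n * z ^ n) unitDisk ∧
      ∀ z ∈ unitDisk, HasSum (fun n : ℕ ↦ (n + 1) * c (n + 1) * z ^ n)
        (deriv (fun z ↦ ∑' n, c n * z ^ n) z) := by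
  have key : ∀ z ∈ unitDisk, ∃ ρ : ℝ, z ∈ ball (0 : ℂ) ρ ∧ Summable (fun n : ℕ ↦ C * ρ ^ n) ∧
      ∀ n, ∀ w ∈ ball (0 : ℂ) ρ, ‖c n * w ^ n‖ ≤ C * ρ ^ n := by
    intro z hz
    obtain ⟨ρ, hzρ, hρ⟩ := exists_between (show ‖z‖ < 1 by simpa using hz)
    have hρ0 : 0 ≤ ρ := (norm_nonneg z).trans hzρ.le
    refine ⟨ρ, by simpa using hzρ, (summable_geometric_of_lt_one hρ0 hρ).mul_left C,
      fun n w hw ↦ ?_⟩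
    have hw' : ‖w‖ < ρ := by simpa using hw
    have hC : 0 ≤ C := (norm_nonneg _).trans (hc 0)
    rw [norm_mul, norm_pow]
    gcongr
    exact hc n
  have hd : ∀ (n : ℕ) (s : Set ℂ), DifferentiableOn ℂ (fun w ↦ c n * w ^ n) s := fun n s ↦ by
    fun_prop
  refine ⟨fun z hz ↦ ?_, fun z hz ↦ ?_⟩
  · obtain ⟨ρ, hzρ, hs, hb⟩ := key z hz
    exact ((Complex.differentiableOn_tsum_of_summable_norm hs (fun n ↦ hd n _) isOpen_ball
      hb).differentiableAt (isOpen_ball.mem_nhds hzρ)).differentiableWithinAt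
  · obtain ⟨ρ, hzρ, hs, hb⟩ := key z hz
    have h1 := Complex.hasSum_deriv_of_summable_norm hs (fun n ↦ hd n _) isOpen_ball hb hzρ
    have h2 := (hasSum_nat_add_iff' 1).2 h1
    simp only [Finset.range_one, Finset.sum_singleton, pow_zero, mul_one, deriv_const,
      sub_zero] at h2
    refine h2.congr_fun fun n ↦ ?_
    rw [((hasDerivAt_pow (n + 1) z).const_mul (c (n + 1))).deriv]
    push_cast
    ring

end PowerSeries

/-! ### Coefficient bounds and closure under convolution -/

namespace IsRPair

variable {h g φ : ℂ → ℂ}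

/-- Carathéodory's bound for coefficient `n - 1` of `h' + ε g'`, with `ε` aligning the phases of
`a_n` and `b_n`. The sum is bounded, which is more than the theorem claims. -/
lemma norm_taylorCoeff_add_le (H : IsRPair h g) {n : ℕ} (hn : 2 ≤ n) :
    ‖taylorCoeff h n‖ + ‖taylorCoeff g n‖ ≤ 2 / n := by
  obtain ⟨m, rfl⟩ : ∃ m, n = m + 1 := ⟨n - 1, by omega⟩
  obtain ⟨ε, hε, he⟩ := exists_norm_eq_one_mul (taylorCoeff h (m + 1)) (taylorCoeff g (m + 1))
  have h1 := norm_taylorCoeff_le_two (H.diff_deriv ε) (H.re_nonneg hε) (H.deriv_zero ε)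
    (show m ≠ 0 by omega)
  rw [taylorCoeff_add_const_mul (H.diff_h.deriv isOpen_ball) (H.diff_g.deriv isOpen_ball),
    taylorCoeff_deriv, taylorCoeff_deriv, show (m + 1 : ℂ) * taylorCoeff h (m + 1)
      + ε * ((m + 1) * taylorCoeff g (m + 1)) = ((m + 1 : ℕ) : ℂ) * (taylorCoeff h (m + 1)
      + ε * taylorCoeff g (m + 1)) by push_cast; ring, norm_mul, he, Complex.norm_natCast] at h1
  rw [le_div_iff₀ (by positivity)]
  linarith

lemma abs_norm_taylorCoeff_sub_le (H : IsRPair h g) {n : ℕ} (hn : 2 ≤ n) :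
    |‖taylorCoeff h n‖ - ‖taylorCoeff g n‖| ≤ 2 / (n : ℝ) := by
  have := H.norm_taylorCoeff_add_le hn
  have h1 := norm_nonneg (taylorCoeff h n)
  have h2 := norm_nonneg (taylorCoeff g n)
  rw [abs_le]
  constructor <;> linarith

lemma norm_taylorCoeff_le_two (H : IsRPair h g) (n : ℕ) :
    ‖taylorCoeff h n‖ ≤ 2 ∧ ‖taylorCoeff g n‖ ≤ 2 := by
  have h1 := norm_nonneg (taylorCoeff h n)
  have h2 := norm_nonneg (taylorCoeff g n)
  rcases n with _ | _ | n
  · simp [taylorCoeff, H.h_zero, H.g_zero]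
  · simp [taylorCoeff, H.deriv_h_zero, H.deriv_g_zero]
  · have h3 := H.norm_taylorCoeff_add_le (show 2 ≤ n + 2 by omega)
    have h4 : (2 : ℝ) / ((n + 2 : ℕ) : ℝ) ≤ 2 := by
      refine div_le_self (by norm_num) ?_
      exact_mod_cast (by omega : 1 ≤ n + 2)
    constructor <;> linarith

/-- The derivative of `(h + ε g) * φ` is the convolution of `h' + ε g'` with `q = φ(z)/z`, and `-1 +
2q` is a Carathéodory function; `re_convolution_nonneg` applies for each `ε`. -/
lemma harmonicHadamard_mem (H : IsRPair h g) (hφ : φ ∈ classA)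
    (hre : ∀ z ∈ unitDisk, z ≠ 0 → 1 / 2 < (φ z / z).re) :
    harmonicHadamard h g φ ∈ classRH0 := by
  obtain ⟨hφd, hφ0, hφ1⟩ := hφ
  set q : ℂ → ℂ := dslope φ 0 with hq
  have hqd : DifferentiableOn ℂ q unitDisk :=
    (Complex.differentiableOn_dslope (isOpen_ball.mem_nhds zero_mem_unitDisk)).2 hφd
  have hq0 : q 0 = 1 := by rw [hq, dslope_same, hφ1]
  have hφq : ∀ z, φ z = z * q z := fun z ↦ by
    have := sub_smul_dslope φ 0 z
    simpa [hφ0] using this.symm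
  have hqre : ∀ z ∈ unitDisk, 0 ≤ (-1 + 2 * q z).re := fun z hz ↦ by
    rcases eq_or_ne z 0 with rfl | hz0
    · rw [hq0]; norm_num
    · have h1 := hre z hz hz0
      rw [hφq, mul_div_cancel_left₀ _ hz0] at h1
      simp
      linarith
  have hPd : DifferentiableOn ℂ (fun z ↦ -1 + 2 * q z) unitDisk := (hqd.const_mul 2).const_add (-1)
  have hP0 : (-1 + 2 * q 0 : ℂ) = 1 := by rw [hq0]; norm_num
  have hPn : ∀ n : ℕ, (if n = 0 then 1 else taylorCoeff (fun z ↦ -1 + 2 * q z) n / 2)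
      = taylorCoeff q n := fun n ↦ by
    split_ifs with hn
    · simp [hn, taylorCoeff, hq0]
    · rw [taylorCoeff, iteratedDeriv_const_add (Nat.pos_of_ne_zero hn), iteratedDeriv_const_mul_field, taylorCoeff]
      ring
  -- The index shift is obtained by comparing Cauchy averages on one circle; the radius `1/2` is
  -- arbitrary.
  have hqn : ∀ n, taylorCoeff φ (n + 1) = taylorCoeff q n := fun n ↦ by
    have hr0 : (0 : ℝ) < 1 / 2 := by norm_num
    have hr1 : (1 / 2 : ℝ) < 1 := by norm_num
    have h1 := circleAverage_taylor hφd hr0 hr1 (n + 1)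
    have h2 := circleAverage_taylor hqd hr0 hr1 n
    have h3 : EqOn (fun ζ : ℂ ↦ (((1 / 2 : ℝ) : ℂ) / ζ) ^ (n + 1) * φ ζ)
        (fun ζ ↦ ((1 / 2 : ℝ) : ℂ) • ((((1 / 2 : ℝ) : ℂ) / ζ) ^ n * q ζ)) (sphere 0 |1 / 2|) := by
      intro ζ hζ
      have hζ0 : ζ ≠ 0 := fun h0 ↦ by simp [h0] at hζ
      simp only [hφq ζ, smul_eq_mul, pow_succ]
      field_simp
    rw [Real.circleAverage_congr_sphere h3, Real.circleAverage_fun_smul, h2] at h1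
    have h4 : (((1 / 2 : ℝ) : ℂ)) ^ (n + 1) ≠ 0 := by
      refine pow_ne_zero _ ?_
      norm_num
    refine mul_right_cancel₀ h4 (h1.symm.trans ?_)
    rw [smul_eq_mul]
    ring
  have hφn : ∀ n, ‖taylorCoeff φ n‖ ≤ 1 := fun n ↦ by
    rcases n with _ | n
    · simp [taylorCoeff, hφ0]
    · rw [hqn, ← hPn]
      split_ifs with hn
      · simp
      · have := HarmonicMappings.norm_taylorCoeff_le_two hPd hqre hP0 hn
        rw [norm_div, Complex.norm_ofNat]
        linarith
  have hbh : ∀ n, ‖taylorCoeff h n * taylorCoeff φ n‖ ≤ 2 := fun n ↦ by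
    rw [norm_mul]
    nlinarith [(H.norm_taylorCoeff_le_two n).1, hφn n, norm_nonneg (taylorCoeff h n),
      norm_nonneg (taylorCoeff φ n)]
  have hbg : ∀ n, ‖taylorCoeff g n * taylorCoeff φ n‖ ≤ 2 := fun n ↦ by
    rw [norm_mul]
    nlinarith [(H.norm_taylorCoeff_le_two n).2, hφn n, norm_nonneg (taylorCoeff g n),
      norm_nonneg (taylorCoeff φ n)]
  obtain ⟨hd1, hs1⟩ := powerSeries_bounded hbh
  obtain ⟨hd2, hs2⟩ := powerSeries_bounded hbg
  have hzero : ∀ c : ℕ → ℂ, ∑' n, c n * (0 : ℂ) ^ n = c 0 := fun c ↦ by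
    rw [tsum_eq_single 0 fun n hn ↦ by simp [hn]]
    simp
  have hzero' : ∀ {c : ℕ → ℂ} {S : ℂ}, HasSum (fun n : ℕ ↦ (n + 1) * c (n + 1) * (0 : ℂ) ^ n) S →
      S = c 1 := fun {c S} hS ↦ by
    rw [← hS.tsum_eq, tsum_eq_single 0 fun n hn ↦ by simp [hn]]
    simp
  refine IsRPair.mem_classRH0 (h := hadamard h φ) (g := hadamard g φ)
    ⟨hd1, hd2, ?_, ?_, ?_, ?_, fun z hz ↦ ?_⟩ fun z _ ↦ rfl
  · refine (hzero _).trans ?_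
    simp [taylorCoeff, H.h_zero]
  · refine (hzero _).trans ?_
    simp [taylorCoeff, H.g_zero]
  · refine (hzero' (c := fun n ↦ taylorCoeff h n * taylorCoeff φ n) (hs1 0 zero_mem_unitDisk)).trans ?_
    simp [taylorCoeff, H.deriv_h_zero, hφ1]
  · refine (hzero' (c := fun n ↦ taylorCoeff g n * taylorCoeff φ n) (hs2 0 zero_mem_unitDisk)).trans ?_
    simp [taylorCoeff, H.deriv_g_zero]
  · refine forall_re_add_mul_nonneg_iff.1 fun ε hε ↦ ?_
    refine re_convolution_nonneg (H.diff_deriv ε) (H.re_nonneg hε) hPd hqre hP0 hz ?_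
    refine ((hs1 z hz).add ((hs2 z hz).mul_left ε)).congr_fun fun n ↦ ?_
    rw [hPn, taylorCoeff_add_const_mul (H.diff_h.deriv isOpen_ball) (H.diff_g.deriv isOpen_ball),
      taylorCoeff_deriv, taylorCoeff_deriv, hqn]
    ring

end IsRPair

end HarmonicMappings

namespace HarmonicMappings

open Metric Set Filter Topology
open scoped ComplexConjugate RealInnerProductSpace

/-! ### Univalent functions -/

/-- At a critical point `f - f z₀ = u(z₀) ψⁿ` with `n ≥ 2` and `ψ` locally invertible. Preimages
under `ψ` of `t` and `ω t`, `ω` a primitive `n`-th root of unity, have the same image. -/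
lemma deriv_ne_zero_of_injOn {f : ℂ → ℂ} {U : Set ℂ} (hU : IsOpen U)
    (hf : DifferentiableOn ℂ f U) (hinj : InjOn f U) {z₀ : ℂ} (hz₀ : z₀ ∈ U) :
    deriv f z₀ ≠ 0 := by
  intro hder
  have hUn := hU.mem_nhds hz₀
  have hfa : AnalyticAt ℂ f z₀ := hf.analyticAt hUn
  have hga : AnalyticAt ℂ (fun z ↦ f z - f z₀) z₀ := hfa.sub analyticAt_const
  have hnz : ¬ ∀ᶠ z in 𝓝 z₀, f z - f z₀ = 0 := by
    intro h
    obtain ⟨z, ⟨hz1, hz2⟩, hz3⟩ := (((h.filter_mono nhdsWithin_le_nhds).and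
      (mem_nhdsWithin_of_mem_nhds hUn)).and (self_mem_nhdsWithin (s := {z₀}ᶜ))).exists
    exact hz3 (hinj hz2 hz₀ (sub_eq_zero.1 hz1))
  obtain ⟨n, u, hu, hu0, hfu⟩ := hga.exists_eventuallyEq_pow_smul_nonzero_iff.2 hnz
  have hn0 : n ≠ 0 := by
    rintro rfl
    have := hfu.self_of_nhds
    simp at this
    exact hu0 this.symm
  have hn1 : n ≠ 1 := by
    rintro rfl
    have h1 : HasDerivAt (fun z ↦ f z - f z₀) (u z₀) z₀ := by
      have h2 := ((hasDerivAt_id z₀).sub_const z₀).mul hu.differentiableAt.hasDerivAt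
      have h3 : HasDerivAt (fun z ↦ (z - z₀) * u z) (u z₀) z₀ := by
        convert! h2 using 1
        simp
      refine h3.congr_of_eventuallyEq ?_
      filter_upwards [hfu] with z hz
      simpa using hz
    have h4 := (hfa.differentiableAt.hasDerivAt.sub_const (f z₀)).unique h1
    exact hu0 (h4.symm.trans hder)
  have hnC : (n : ℂ) ≠ 0 := by exact_mod_cast hn0
  -- Dividing by `u z₀` brings the base near 1, where the principal branch of the root is analytic.
  have hua : AnalyticAt ℂ (fun z ↦ (u z / u z₀) ^ (1 / n : ℂ)) z₀ := by
    refine (hu.div analyticAt_const hu0).cpow analyticAt_const ?_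
    rw [Pi.div_apply, div_self hu0]
    exact Complex.one_mem_slitPlane
  set v : ℂ → ℂ := fun z ↦ (u z / u z₀) ^ (1 / n : ℂ) with hv
  have hv0 : v z₀ = 1 := by simp [hv, div_self hu0]
  have hvn : ∀ z, v z ^ n = u z / u z₀ := fun z ↦ by
    simp only [hv]
    rw [← Complex.cpow_nat_mul, mul_one_div_cancel hnC, Complex.cpow_one]
  have hψ : HasStrictDerivAt (fun z ↦ (z - z₀) * v z) 1 z₀ := by
    have h1 := ((analyticAt_id (𝕜 := ℂ) (z := z₀)).sub (analyticAt_const (v := z₀))).mul hua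
    have h2 := h1.hasStrictDerivAt
    have h3 := ((hasDerivAt_id z₀).sub_const z₀).mul hua.differentiableAt.hasDerivAt
    have h4 : deriv ((id - fun _ ↦ z₀) * fun z ↦ (u z / u z₀) ^ (1 / n : ℂ)) z₀ = 1 := by
      refine h3.deriv.trans ?_
      simpa using hv0
    rw [h4] at h2
    exact h2
  have hmap : map (fun z ↦ (z - z₀) * v z) (𝓝 z₀) = 𝓝 0 := by
    simpa using hψ.map_nhds_eq one_ne_zero
  have hV : (fun z ↦ (z - z₀) * v z) '' {z | z ∈ U ∧ f z - f z₀ = (z - z₀) ^ n • u z} ∈ 𝓝 (0 : ℂ) := by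
    rw [← hmap]
    exact image_mem_map (inter_mem hUn hfu)
  set ω : ℂ := Complex.exp (2 * Real.pi * Complex.I / n) with hω
  have hprim : IsPrimitiveRoot ω n := Complex.isPrimitiveRoot_exp n hn0
  have hω1 : ω ≠ 1 := hprim.ne_one (by omega)
  have hlim : Tendsto (fun t : ℂ ↦ ω * t) (𝓝 0) (𝓝 0) := by
    simpa using (continuous_const_mul ω).tendsto 0
  obtain ⟨t, ⟨⟨z₁, hz₁, h1⟩, z₂, hz₂, h2⟩, ht⟩ :=
    (((eventually_of_mem hV fun _ h ↦ h).and (hlim.eventually hV)).filter_mono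
      nhdsWithin_le_nhds |>.and (self_mem_nhdsWithin (s := {(0 : ℂ)}ᶜ))).exists
  have hval : ∀ z, f z - f z₀ = (z - z₀) ^ n • u z → f z - f z₀ = u z₀ * ((z - z₀) * v z) ^ n := by
    intro z hz
    rw [hz, mul_pow, hvn, smul_eq_mul]
    field_simp
  have e1 := hval z₁ hz₁.2
  have e2 := hval z₂ hz₂.2
  simp only at h1 h2
  rw [h1] at e1
  rw [h2, mul_pow, hprim.pow_eq_one, one_mul, ← e1] at e2
  have hz : z₂ = z₁ := hinj hz₂.1 hz₁.1 (sub_left_injective e2)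
  rw [hz, h1] at h2
  exact hω1 (mul_right_cancel₀ ht (by rw [one_mul]; exact h2.symm))

/-! ### Convex univalent functions and the Marx-Strohhäcker inequality -/

section Convex

variable {φ : ℂ → ℂ}

/-- The image of a circle under a convex univalent function lies on one side of each of its
tangents. -/
lemma re_mul_div_deriv_nonneg (hd : DifferentiableOn ℂ φ unitDisk) (hinj : InjOn φ unitDisk)
    (hconv : Convex ℝ (φ '' unitDisk)) {z w : ℂ} (hz : z ∈ unitDisk) (hz0 : z ≠ 0)
    (hw : ‖w‖ = ‖z‖) : 0 ≤ (conj z * ((φ z - φ w) / deriv φ z)).re := by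
  obtain ⟨ζ, hζ, rfl⟩ : ∃ ζ : ℂ, ‖ζ‖ = 1 ∧ w = ζ * z :=
    ⟨w / z, by rw [norm_div, hw, div_self (by simpa using hz0)], by field_simp⟩
  set I := Function.invFunOn φ unitDisk with hI
  have hleft : ∀ x ∈ unitDisk, I (φ x) = x := fun x hx ↦ hinj.leftInvOn_invFunOn hx
  have hId : ∀ x ∈ unitDisk, HasDerivAt I (deriv φ x)⁻¹ (φ x) := fun x hx ↦ by
    have hn := isOpen_ball.mem_nhds hx
    refine ((hd.analyticAt hn).hasStrictDerivAt.to_local_left_inverse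
      (deriv_ne_zero_of_injOn isOpen_ball hd hinj hx) ?_).hasDerivAt
    filter_upwards [hn] with y hy using hleft y hy
  have hrot : ∀ x ∈ unitDisk, ζ * x ∈ unitDisk := fun x hx ↦ by simpa [hζ] using hx
  have hmem : ∀ t ∈ Icc (0 : ℝ) 1, ∀ x ∈ unitDisk,
      φ x + t * (φ (ζ * x) - φ x) ∈ φ '' unitDisk := fun t ht x hx ↦ by
    have := hconv.add_smul_sub_mem (mem_image_of_mem φ hx) (mem_image_of_mem φ (hrot x hx)) ht
    simpa using this
  -- By convexity, `x ↦ φ⁻¹((1 - t) φ(x) + t φ(ζ x))` is a self-map of the disk fixing 0. Its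
  -- modulus at `z` is thus largest at `t = 0`, and the sign of the right derivative there is the
  -- claim.
  have hschwarz : ∀ t ∈ Icc (0 : ℝ) 1, ‖I (φ z + t * (φ (ζ * z) - φ z))‖ ≤ ‖z‖ := fun t ht ↦ by
    have hrotd : DifferentiableOn ℂ (fun x ↦ φ (ζ * x)) unitDisk :=
      hd.comp (differentiableOn_id.const_mul ζ) hrot
    have hF : DifferentiableOn ℂ (fun x ↦ φ x + t * (φ (ζ * x) - φ x)) unitDisk :=
      hd.add ((hrotd.sub hd).const_mul _)
    have hIm : DifferentiableOn ℂ I (φ '' unitDisk) := by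
      rintro _ ⟨x, hx, rfl⟩
      exact (hId x hx).differentiableAt.differentiableWithinAt
    have hW : DifferentiableOn ℂ (fun x ↦ I (φ x + t * (φ (ζ * x) - φ x))) unitDisk :=
      hIm.comp hF (hmem t ht)
    refine Complex.norm_le_norm_of_mapsTo_ball hW (fun x hx ↦ ?_) ?_ (by simpa using hz)
    · exact ball_subset_closedBall (Function.invFunOn_mem (hmem t ht x hx))
    · simp [hleft 0 zero_mem_unitDisk]
  have hγ : HasDerivAt (fun t : ℝ ↦ I (φ z + t * (φ (ζ * z) - φ z)))
      ((deriv φ z)⁻¹ * (φ (ζ * z) - φ z)) 0 := by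
    have h1 : HasDerivAt (fun t : ℂ ↦ φ z + t * (φ (ζ * z) - φ z)) (φ (ζ * z) - φ z) ((0 : ℝ) : ℂ) := by
      simpa using ((hasDerivAt_id (((0 : ℝ) : ℂ))).mul_const (φ (ζ * z) - φ z)).const_add (φ z)
    have h2 : HasDerivAt I (deriv φ z)⁻¹ (φ z + ((0 : ℝ) : ℂ) * (φ (ζ * z) - φ z)) := by
      simpa using hId z hz
    exact (HasDerivAt.comp (h₂ := I) ((0 : ℝ) : ℂ) h2 h1).comp_ofReal
  have hN := hγ.norm_sq
  have hslope := (hasDerivAt_iff_tendsto_slope_left_right.1 hN).2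
  have hle := le_of_tendsto hslope (b := 0) (by
    filter_upwards [Ioo_mem_nhdsGT (show (0 : ℝ) < 1 by norm_num)] with t ht
    rw [slope_def_field]
    refine div_nonpos_of_nonpos_of_nonneg ?_ (by linarith [ht.1])
    have h1 := hschwarz t (Ioo_subset_Icc_self ht)
    simp only [Complex.ofReal_zero, zero_mul, add_zero, hleft z hz]
    rw [sub_nonpos]
    gcongr)
  simp only [Complex.ofReal_zero, zero_mul, add_zero, hleft z hz] at hle
  rw [Complex.inner] at hle
  have e : conj z * ((φ z - φ (ζ * z)) / deriv φ z)
      = -((deriv φ z)⁻¹ * (φ (ζ * z) - φ z) * conj z) := by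
    rw [div_eq_mul_inv]; ring
  rw [e, Complex.neg_re]
  linarith

lemma re_inv_nonneg {x : ℂ} (hx : 0 ≤ x.re) : 0 ≤ (x⁻¹).re := by
  rw [Complex.inv_re]
  exact div_nonneg hx (Complex.normSq_nonneg x)

/-- The Marx-Strohhäcker inequality for convex univalent functions. -/
lemma half_le_re_div (hφ : φ ∈ classK) {w : ℂ} (hw : w ∈ unitDisk) (hw0 : w ≠ 0) :
    1 / 2 ≤ (φ w / w).re := by
  obtain ⟨⟨⟨hd, h0, h1⟩, hinj⟩, hconv⟩ := hφ
  have hwn := norm_pos_iff.2 hw0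
  have hw1 : ‖w‖ < 1 := by simpa using hw
  have hsub : closedBall (0 : ℂ) ‖w‖ ⊆ unitDisk := closedBall_subset_ball hw1
  have hφ' : ∀ z ∈ unitDisk, deriv φ z ≠ 0 := fun z hz ↦
    deriv_ne_zero_of_injOn isOpen_ball hd hinj hz
  set k : ℂ → ℂ := dslope φ w with hk
  have hkd : DifferentiableOn ℂ k unitDisk :=
    (Complex.differentiableOn_dslope (isOpen_ball.mem_nhds hw)).2 hd
  have hk0 : ∀ z ∈ unitDisk, k z ≠ 0 := fun z hz hkz ↦ by
    rcases eq_or_ne z w with rfl | hzw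
    · rw [hk, dslope_same] at hkz
      exact hφ' z hz hkz
    · have := sub_smul_dslope φ w z
      rw [← hk, hkz, smul_zero] at this
      exact hzw (hinj hz hw (sub_eq_zero.1 this.symm))
  have hkφ : ∀ z, (z - w) * k z = φ z - φ w := fun z ↦ by
    simpa using sub_smul_dslope φ w z
  -- The function wanted is `p(z) = 2zφ'(z)/(φ(z) - φ(w)) - (z + w)/(z - w)`. Clearing the factor `z
  -- - w` shows that the singularity at `w` is removable. On `|z| = |w|` the last fraction is
  -- imaginary and the first has nonnegative real part.
  set N : ℂ → ℂ := fun z ↦ 2 * z * deriv φ z / k z - (z + w) with hN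
  have hNd : DifferentiableOn ℂ N unitDisk :=
    (((differentiableOn_id.const_mul 2).mul (hd.deriv isOpen_ball)).div hkd hk0).sub
      (differentiableOn_id.add_const w)
  have hNw : N w = 0 := by
    have e : k w = deriv φ w := by rw [hk, dslope_same]
    simp only [hN, e]
    rw [mul_div_cancel_right₀ _ (hφ' w hw)]
    ring
  set p : ℂ → ℂ := dslope N w with hp
  have hpd : DifferentiableOn ℂ p unitDisk :=
    (Complex.differentiableOn_dslope (isOpen_ball.mem_nhds hw)).2 hNd
  have hpN : ∀ z, z ≠ w → p z = N z / (z - w) := fun z hz ↦ by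
    rw [hp, dslope_of_ne _ hz, slope_def_field, hNw, sub_zero]
  have hsphere : ∀ z, ‖z‖ = ‖w‖ → z ≠ w → 0 ≤ (p z).re := by
    intro z hz hzw
    have hz0 : z ≠ 0 := by rw [← norm_pos_iff, hz]; exact hwn
    have hzm : z ∈ unitDisk := hsub (by simp [hz])
    have hzw' : z - w ≠ 0 := sub_ne_zero.2 hzw
    have hφne : φ z - φ w ≠ 0 := fun h ↦ hzw (hinj hzm hw (sub_eq_zero.1 h))
    have h2 := re_inv_nonneg (re_mul_div_deriv_nonneg hd hinj hconv hzm hz0 hz.symm)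
    have hzz : conj z * z = ((‖w‖ ^ 2 : ℝ) : ℂ) := by
      rw [← Complex.normSq_eq_conj_mul_self, Complex.normSq_eq_norm_sq, hz]
    have hww : conj w * w = ((‖w‖ ^ 2 : ℝ) : ℂ) := by
      rw [← Complex.normSq_eq_conj_mul_self, Complex.normSq_eq_norm_sq]
    have hcz : conj z ≠ 0 := by simpa using hz0
    have e1 : p z = ((2 * ‖w‖ ^ 2 : ℝ) : ℂ) * (conj z * ((φ z - φ w) / deriv φ z))⁻¹
        - (z + w) / (z - w) := by
      rw [hpN z hzw, hN]
      simp only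
      rw [sub_div, div_div, mul_comm (k z), hkφ, Complex.ofReal_mul, ← hzz]
      have := hφ' z hzm
      push_cast
      field_simp
    have e2 : ((z + w) / (z - w)).re = 0 := by
      have h3 : conj ((z + w) / (z - w)) = -((z + w) / (z - w)) := by
        have h4 : conj z - conj w ≠ 0 := by
          rw [← map_sub]; exact (map_ne_zero _).2 hzw'
        rw [map_div₀, map_add, map_sub, ← neg_div, div_eq_div_iff h4 hzw']
        linear_combination 2 * hzz - 2 * hww
      have h5 := congrArg Complex.re h3
      rw [Complex.conj_re, Complex.neg_re] at h5
      linarith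
    rw [e1, Complex.sub_re, e2, sub_zero, Complex.re_ofReal_mul]
    positivity
  have hpw : 0 ≤ (p w).re := by
    have hcont : ContinuousAt p w := (hpd.differentiableAt (isOpen_ball.mem_nhds hw)).continuousAt
    have hexp : Tendsto (fun θ : ℝ ↦ w * Complex.exp (θ * Complex.I)) (𝓝[>] 0) (𝓝 w) := by
      have : Continuous fun θ : ℝ ↦ w * Complex.exp (θ * Complex.I) := by fun_prop
      simpa using (this.tendsto 0).mono_left nhdsWithin_le_nhds
    refine ge_of_tendsto ((Complex.continuous_re.tendsto _).comp (hcont.tendsto.comp hexp)) ?_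
    filter_upwards [Ioo_mem_nhdsGT (show (0 : ℝ) < 1 by norm_num)] with θ hθ
    refine hsphere _ (by rw [norm_mul, Complex.norm_exp_ofReal_mul_I, mul_one]) fun h ↦ ?_
    have h2 : Complex.exp (θ * Complex.I) = 1 := by
      refine mul_left_cancel₀ hw0 (h.trans (mul_one w).symm)
    have h3 := congrArg Complex.im h2
    rw [Complex.exp_ofReal_mul_I_im, Complex.one_im] at h3
    have h4 := Real.sin_pos_of_pos_of_lt_pi hθ.1 (by linarith [hθ.2, Real.pi_gt_three])
    linarith
  have hpball : ∀ z ∈ ball (0 : ℂ) ‖w‖, 0 ≤ (p z).re := by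
    have hdc : DiffContOnCl ℂ (fun z ↦ Complex.exp (-p z)) (ball 0 ‖w‖) := by
      refine DifferentiableOn.diffContOnCl ?_
      rw [closure_ball _ hwn.ne']
      exact (hpd.mono hsub).neg.cexp
    intro z hz
    have hmax := Complex.norm_le_of_forall_mem_frontier_norm_le isBounded_ball hdc
      (C := 1) (fun v hv ↦ by
        rw [frontier_ball _ hwn.ne'] at hv
        have hvn : ‖v‖ = ‖w‖ := by simpa using hv
        rw [Complex.norm_exp, Real.exp_le_one_iff, Complex.neg_re, neg_nonpos]
        rcases eq_or_ne v w with rfl | hvw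
        · exact hpw
        · exact hsphere v hvn hvw) (subset_closure hz)
    rw [Complex.norm_exp, Real.exp_le_one_iff, Complex.neg_re, neg_nonpos] at hmax
    exact hmax
  have hk00 : k 0 = φ w / w := by
    have := hkφ 0
    rw [h0] at this
    field_simp
    linear_combination -this
  have hφw : φ w ≠ 0 := fun h ↦ hw0 (hinj hw zero_mem_unitDisk (h.trans h0.symm))
  have hN0 : N 0 = -w := by simp [hN]
  have hp0 : p 0 = 1 := by
    rw [hpN 0 hw0.symm, hN0, zero_sub, div_self (neg_ne_zero.2 hw0)]
  have hN' : HasDerivAt N (2 * w / φ w - 1) 0 := by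
    have hn := isOpen_ball.mem_nhds zero_mem_unitDisk
    have a1 := ((hd.deriv isOpen_ball).differentiableAt hn).hasDerivAt
    have a2 := (hkd.differentiableAt hn).hasDerivAt
    have a3 := ((((hasDerivAt_id (0 : ℂ)).const_mul 2).fun_mul a1).fun_div a2
      (hk0 0 zero_mem_unitDisk)).fun_sub ((hasDerivAt_id (0 : ℂ)).add_const w)
    convert! a3 using 1
    simp only [id, hk00, h1]
    field_simp
    ring
  have hp' : deriv p 0 = 2 / w - 2 / φ w := by
    have a1 := hN'.fun_div ((hasDerivAt_id (0 : ℂ)).sub_const w) (by simpa using hw0)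
    have a2 : p =ᶠ[𝓝 0] fun z ↦ N z / (id z - w) := by
      filter_upwards [isOpen_ne.mem_nhds hw0.symm] with z hz using hpN z hz
    rw [a2.deriv_eq, a1.deriv, hN0]
    simp only [id]
    field_simp
    ring
  -- Since `p(0) = 1` and `p'(0) = 2/w - 2/φ(w)`, the coefficient bound on radius `|w|` reads `|1 -
  -- w/φ(w)| ≤ 1`, which is `Re (φ(w)/w) ≥ 1/2`.
  have hbound := norm_deriv_zero_le hwn (hpd.mono (ball_subset_ball hw1.le)) hpball
    (by rw [hp0]; simp)
  rw [hp', hp0, Complex.one_re, mul_one, le_div_iff₀ hwn, ← norm_mul] at hbound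
  have e : (2 / w - 2 / φ w) * w = 2 * (1 - w / φ w) := by field_simp
  rw [e, norm_mul, Complex.norm_ofNat] at hbound
  set x := w / φ w with hx
  have hxn : ‖1 - x‖ ^ 2 ≤ 1 := by
    have := norm_nonneg (1 - x)
    nlinarith
  have hx0 : 0 < Complex.normSq x := Complex.normSq_pos.2 (div_ne_zero hw0 hφw)
  rw [← Complex.normSq_eq_norm_sq, Complex.normSq_apply] at hxn
  rw [← inv_div w, ← hx, Complex.inv_re, le_div_iff₀ hx0, Complex.normSq_apply]
  simp at hxn
  nlinarith

lemma half_lt_re_div (hφ : φ ∈ classK) {z : ℂ} (hz : z ∈ unitDisk) (hz0 : z ≠ 0) :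
    1 / 2 < (φ z / z).re := by
  have hd := hφ.1.1.1
  have hφ0 := hφ.1.1.2.1
  set q : ℂ → ℂ := dslope φ 0 with hq
  have hqd : DifferentiableOn ℂ q unitDisk :=
    (Complex.differentiableOn_dslope (isOpen_ball.mem_nhds zero_mem_unitDisk)).2 hd
  have hq0 : q 0 = 1 := by rw [hq, dslope_same, hφ.1.1.2.2]
  have hφq : ∀ z, z ≠ 0 → φ z / z = q z := fun z hz ↦ by
    rw [hq, dslope_of_ne _ hz, slope_def_field, hφ0, sub_zero, sub_zero]
  have hqre : ∀ z ∈ unitDisk, 0 ≤ (-1 + 2 * q z).re := fun z hz ↦ by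
    rcases eq_or_ne z 0 with rfl | hz0
    · rw [hq0]; norm_num
    · have h1 := half_le_re_div hφ hz hz0
      rw [hφq z hz0] at h1
      simp
      linarith
  have h1 := one_sub_div_le_re ((hqd.const_mul 2).const_add (-1)) hqre (by rw [hq0]; norm_num) hz
  have hz1 : ‖z‖ < 1 := by simpa using hz
  have h2 : 0 < (1 - ‖z‖) / (1 + ‖z‖) := div_pos (by linarith) (by linarith [norm_nonneg z])
  rw [hφq z hz0]
  have h3 : (-1 + 2 * q z).re = -1 + 2 * (q z).re := by simp
  rw [h3] at h1
  linarith

end Convex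

end HarmonicMappings

namespace HarmonicMappings

open Metric Set Filter Topology
open scoped ComplexConjugate RealInnerProductSpace

/-! ### Compactness -/

/-- The Lipschitz constant does not depend on the index and passes to the limit, so three thirds of
`ε` suffice. -/
lemma tendstoLocallyUniformlyOn_of_lipschitz {ι : Type*} {l : Filter ι} [l.NeBot]
    {F : ι → ℂ → ℂ} {f : ℂ → ℂ}
    (hF : ∀ r < 1, ∃ M : ℝ, ∀ i, ∀ x ∈ closedBall (0 : ℂ) r, ∀ y ∈ closedBall (0 : ℂ) r,
      ‖F i x - F i y‖ ≤ M * ‖x - y‖)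
    (hf : ∀ z ∈ unitDisk, Tendsto (fun i ↦ F i z) l (𝓝 (f z))) :
    TendstoLocallyUniformlyOn F f l unitDisk := by
  rw [Metric.tendstoLocallyUniformlyOn_iff]
  intro ε hε x hx
  obtain ⟨r, hxr, hr⟩ := exists_between (show ‖x‖ < 1 by simpa using hx)
  obtain ⟨M, hM⟩ := hF r hr
  have hsub : closedBall (0 : ℂ) r ⊆ unitDisk := closedBall_subset_ball hr
  have hxm : x ∈ closedBall (0 : ℂ) r := by simpa using hxr.le
  have hfM : ∀ y ∈ closedBall (0 : ℂ) r, ‖f y - f x‖ ≤ M * ‖y - x‖ := fun y hy ↦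
    le_of_tendsto ((hf y (hsub hy)).sub (hf x hx)).norm
      (Eventually.of_forall fun i ↦ hM i y hy x hxm)
  have hlim : Tendsto (fun y ↦ M * ‖y - x‖) (𝓝 x) (𝓝 0) := by
    have : Continuous fun y ↦ M * ‖y - x‖ := by fun_prop
    simpa using this.tendsto x
  refine ⟨{y | y ∈ closedBall (0 : ℂ) r ∧ M * ‖y - x‖ < ε / 3}, mem_nhdsWithin_of_mem_nhds
    (inter_mem (closedBall_mem_nhds_of_mem (by simpa using hxr))
      (hlim.eventually_lt_const (by positivity))), ?_⟩
  filter_upwards [Metric.tendsto_nhds.1 (hf x hx) (ε / 3) (by positivity)] with i hi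
  rintro y ⟨hy, hyε⟩
  have h1 := hM i x hxm y hy
  rw [norm_sub_rev x y, ← dist_eq_norm] at h1
  have h2 := hfM y hy
  rw [← dist_eq_norm] at h2
  have h3 := dist_triangle4 (f y) (f x) (F i x) (F i y)
  rw [dist_comm] at hi
  linarith

namespace IsRPair

variable {h g : ℂ → ℂ}

lemma lipschitz (H : IsRPair h g) {r : ℝ} (hr : r < 1) {x y : ℂ} (hx : x ∈ closedBall (0 : ℂ) r)
    (hy : y ∈ closedBall (0 : ℂ) r) :
    ‖h x - h y‖ ≤ (1 + r) / (1 - r) * ‖x - y‖ ∧ ‖g x - g y‖ ≤ (1 + r) / (1 - r) * ‖x - y‖ := by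
  have hsub : closedBall (0 : ℂ) r ⊆ unitDisk := closedBall_subset_ball hr
  have hb : ∀ w ∈ closedBall (0 : ℂ) r, ‖deriv h w‖ + ‖deriv g w‖ ≤ (1 + r) / (1 - r) := by
    intro w hw
    have hw' : ‖w‖ ≤ r := by simpa using hw
    refine (H.norm_add_norm_le (hsub hw)).trans ?_
    exact div_le_div₀ (by linarith [norm_nonneg w]) (by linarith) (by linarith) (by linarith)
  exact ⟨(convex_closedBall (0 : ℂ) r).norm_image_sub_le_of_norm_deriv_le (𝕜 := ℂ)
      (fun w hw ↦ (H.hasDerivAt_h (hsub hw)).differentiableAt)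
      (fun w hw ↦ (le_add_of_nonneg_right (norm_nonneg _)).trans (hb w hw)) hy hx,
    (convex_closedBall (0 : ℂ) r).norm_image_sub_le_of_norm_deriv_le (𝕜 := ℂ)
      (fun w hw ↦ (H.hasDerivAt_g (hsub hw)).differentiableAt)
      (fun w hw ↦ (le_add_of_nonneg_left (norm_nonneg _)).trans (hb w hw)) hy hx⟩

lemma norm_le_bound (H : IsRPair h g) {r : ℝ} (hr : r < 1) {z : ℂ}
    (hz : z ∈ closedBall (0 : ℂ) r) :
    ‖h z‖ ≤ (1 + r) / (1 - r) ∧ ‖g z‖ ≤ (1 + r) / (1 - r) := by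
  have hz' : ‖z‖ ≤ r := by simpa using hz
  have hr0 := (norm_nonneg z).trans hz'
  have h1 := H.lipschitz hr hz (y := 0) (by simpa using hr0)
  simp only [H.h_zero, H.g_zero, sub_zero] at h1
  have h2 : 0 ≤ (1 + r) / (1 - r) := div_nonneg (by linarith) (by linarith)
  have h3 : (1 + r) / (1 - r) * ‖z‖ ≤ (1 + r) / (1 - r) :=
    mul_le_of_le_one_right h2 (by linarith)
  exact ⟨h1.1.trans h3, h1.2.trans h3⟩

end IsRPair

/-- Along an ultrafilter both parts converge pointwise by boundedness, then locally uniformly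
together with their derivatives by the common Lipschitz bounds. The non-strict inequality passes to
the limit and restores the strict one. -/
lemma isCompact_classRH0 :
    IsCompact {F : C(unitDisk, ℂ) | ∃ f ∈ classRH0, ∀ z : unitDisk, F z = f z} := by
  rw [isCompact_iff_ultrafilter_le_nhds]
  intro U hU
  have hex : ∀ F : C(unitDisk, ℂ), ∃ h g : ℂ → ℂ, IsRPair h g ∧
      ((∃ f ∈ classRH0, ∀ z : unitDisk, F z = f z) → ∀ z : unitDisk, F z = h z + conj (g z)) := by
    intro F
    by_cases hF : ∃ f ∈ classRH0, ∀ z : unitDisk, F z = f z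
    · obtain ⟨f, hf, hFf⟩ := hF
      obtain ⟨h, g, H, hfe⟩ := exists_isRPair hf
      exact ⟨h, g, H, fun _ z ↦ (hFf z).trans (hfe z z.2)⟩
    -- A default pair from the class, so that the bounds hold for every `F` and not just eventually.
    · exact ⟨extremalFun, 0, isRPair_extremalFun, fun h ↦ absurd h hF⟩
  choose h g H hFe using hex
  have hlim : ∀ k : C(unitDisk, ℂ) → ℂ → ℂ,
      (∀ r < 1, ∀ F, ∀ z ∈ closedBall (0 : ℂ) r, ‖k F z‖ ≤ (1 + r) / (1 - r)) →
      ∃ k₀ : ℂ → ℂ, ∀ z ∈ unitDisk, Tendsto (fun F ↦ k F z) U (𝓝 (k₀ z)) := by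
    intro k hk
    have : ∀ z : ℂ, ∃ a : ℂ, z ∈ unitDisk → Tendsto (fun F ↦ k F z) U (𝓝 a) := by
      intro z
      by_cases hz : z ∈ unitDisk
      · obtain ⟨a, -, ha⟩ := (isCompact_closedBall (0 : ℂ)
          ((1 + ‖z‖) / (1 - ‖z‖))).ultrafilter_le_nhds (U.map fun F ↦ k F z) (by
            rw [le_principal_iff]
            change ∀ᶠ F in (U : Filter C(unitDisk, ℂ)), k F z ∈ closedBall 0 _
            refine Eventually.of_forall fun F ↦ ?_
            rw [mem_closedBall_zero_iff]
            exact hk ‖z‖ (by simpa using hz) F z (by simp))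
        exact ⟨a, fun _ ↦ ha⟩
      · exact ⟨0, fun h ↦ absurd h hz⟩
    choose k₀ hk₀ using this
    exact ⟨k₀, hk₀⟩
  obtain ⟨h₀, hh₀⟩ := hlim h fun r hr F z hz ↦ ((H F).norm_le_bound hr hz).1
  obtain ⟨g₀, hg₀⟩ := hlim g fun r hr F z hz ↦ ((H F).norm_le_bound hr hz).2
  have hhu : TendstoLocallyUniformlyOn h h₀ U unitDisk :=
    tendstoLocallyUniformlyOn_of_lipschitz
      (fun r hr ↦ ⟨_, fun F x hx y hy ↦ ((H F).lipschitz hr hx hy).1⟩) hh₀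
  have hgu : TendstoLocallyUniformlyOn g g₀ U unitDisk :=
    tendstoLocallyUniformlyOn_of_lipschitz
      (fun r hr ↦ ⟨_, fun F x hx y hy ↦ ((H F).lipschitz hr hx hy).2⟩) hg₀
  have hhd : ∀ᶠ F in (U : Filter C(unitDisk, ℂ)), DifferentiableOn ℂ (h F) unitDisk :=
    Eventually.of_forall fun F ↦ (H F).diff_h
  have hgd : ∀ᶠ F in (U : Filter C(unitDisk, ℂ)), DifferentiableOn ℂ (g F) unitDisk :=
    Eventually.of_forall fun F ↦ (H F).diff_g
  have hh' : ∀ z ∈ unitDisk, Tendsto (fun F ↦ deriv (h F) z) U (𝓝 (deriv h₀ z)) := fun z hz ↦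
    (hhu.deriv hhd isOpen_ball).tendsto_at hz
  have hg' : ∀ z ∈ unitDisk, Tendsto (fun F ↦ deriv (g F) z) U (𝓝 (deriv g₀ z)) := fun z hz ↦
    (hgu.deriv hgd isOpen_ball).tendsto_at hz
  have hz0 := zero_mem_unitDisk
  have H₀ : IsRPair h₀ g₀ := by
    refine ⟨hhu.differentiableOn hhd isOpen_ball, hgu.differentiableOn hgd isOpen_ball,
      tendsto_nhds_unique (hh₀ 0 hz0) ?_, tendsto_nhds_unique (hg₀ 0 hz0) ?_,
      tendsto_nhds_unique (hh' 0 hz0) ?_, tendsto_nhds_unique (hg' 0 hz0) ?_, fun z hz ↦ ?_⟩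
    · simp only [(H _).h_zero, tendsto_const_nhds]
    · simp only [(H _).g_zero, tendsto_const_nhds]
    · simp only [(H _).deriv_h_zero, tendsto_const_nhds]
    · simp only [(H _).deriv_g_zero, tendsto_const_nhds]
    · exact le_of_tendsto_of_tendsto' (hg' z hz).norm
        ((Complex.continuous_re.tendsto _).comp (hh' z hz)) fun F ↦ (H F).norm_le z hz
  let f₀ : ℂ → ℂ := fun z ↦ h₀ z + conj (g₀ z)
  have hf₀ : f₀ ∈ classRH0 := H₀.mem_classRH0 fun z _ ↦ rfl
  have hc : ContinuousOn f₀ unitDisk := (H₀.locallyStronglyMonotone (f := f₀) (fun z _ ↦ rfl)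
    le_rfl).continuousOn
  have hfu : TendstoLocallyUniformlyOn (fun F z ↦ h F z + conj (g F z)) f₀ U unitDisk := by
    refine tendstoLocallyUniformlyOn_of_lipschitz
      (fun r hr ↦ ⟨2 * ((1 + r) / (1 - r)), fun F x hx y hy ↦ ?_⟩)
      fun z hz ↦ (hh₀ z hz).add ((Complex.continuous_conj.tendsto _).comp (hg₀ z hz))
    obtain ⟨h1, h2⟩ := (H F).lipschitz hr hx hy
    have e : h F x + conj (g F x) - (h F y + conj (g F y))
        = (h F x - h F y) + conj (g F x - g F y) := by
      rw [map_sub]; ring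
    rw [e]
    refine (norm_add_le _ _).trans ?_
    rw [Complex.norm_conj]
    linarith
  refine ⟨⟨unitDisk.domRestrict f₀, hc.domRestrict⟩, ⟨f₀, hf₀, fun z ↦ rfl⟩, ?_⟩
  have ht : Tendsto (fun F : C(unitDisk, ℂ) ↦ F) U (𝓝 ⟨unitDisk.domRestrict f₀, hc.domRestrict⟩) := by
    have : LocallyCompactSpace unitDisk := isOpen_ball.locallyCompactSpace
    rw [ContinuousMap.tendsto_iff_tendstoLocallyUniformly]
    rw [tendstoLocallyUniformlyOn_iff_tendstoLocallyUniformly_comp_coe] at hfu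
    intro u hu x
    obtain ⟨s, hs, hev⟩ := hfu u hu x
    refine ⟨s, hs, ?_⟩
    filter_upwards [hev, le_principal_iff.1 hU] with F hF1 hF2 y hy
    have := hF1 y hy
    rw [hFe F hF2 y]
    exact this
  exact ht

/-! ### Convex combinations -/

/-- On `|z| < r` the series of the two parts have the majorant `t_n (1 + r)/(1 - r)`, so they may be
differentiated termwise, and `Re (h' + ε g') ≥ 0` survives nonnegative combinations. -/
lemma summable_and_tsum_mem_classRH0 {t : ℕ → ℝ} {f : ℕ → ℂ → ℂ} (ht : ∀ n, 0 ≤ t n)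
    (hsum : HasSum t 1) (hf : ∀ n, f n ∈ classRH0) :
    (∀ z ∈ unitDisk, Summable fun n ↦ (t n : ℂ) * f n z) ∧
      (fun z ↦ ∑' n, (t n : ℂ) * f n z) ∈ classRH0 := by
  choose h g H hfe using fun n ↦ exists_isRPair (hf n)
  have hnorm : ∀ n, ‖(t n : ℂ)‖ = t n := fun n ↦ by
    rw [Complex.norm_real, Real.norm_eq_abs, abs_of_nonneg (ht n)]
  have hseries : ∀ k : ℕ → ℂ → ℂ, (∀ n, DifferentiableOn ℂ (k n) unitDisk) →
      (∀ r < 1, ∀ n, ∀ z ∈ closedBall (0 : ℂ) r, ‖k n z‖ ≤ (1 + r) / (1 - r)) →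
      (∀ z ∈ unitDisk, Summable fun n ↦ (t n : ℂ) * k n z) ∧
      DifferentiableOn ℂ (fun z ↦ ∑' n, (t n : ℂ) * k n z) unitDisk ∧
      ∀ z ∈ unitDisk, HasSum (fun n ↦ (t n : ℂ) * deriv (k n) z)
        (deriv (fun z ↦ ∑' n, (t n : ℂ) * k n z) z) := by
    intro k hkd hk
    have key : ∀ z ∈ unitDisk, ∃ r : ℝ, z ∈ ball (0 : ℂ) r ∧ r < 1 ∧ ∀ n, ∀ w ∈ ball (0 : ℂ) r,
        ‖(t n : ℂ) * k n w‖ ≤ t n * ((1 + r) / (1 - r)) := by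
      intro z hz
      obtain ⟨r, hzr, hr⟩ := exists_between (show ‖z‖ < 1 by simpa using hz)
      refine ⟨r, by simpa using hzr, hr, fun n w hw ↦ ?_⟩
      rw [norm_mul, hnorm]
      exact mul_le_mul_of_nonneg_left (hk r hr n w (ball_subset_closedBall hw)) (ht n)
    have hd : ∀ n, ∀ r < 1, DifferentiableOn ℂ (fun z ↦ (t n : ℂ) * k n z) (ball 0 r) :=
      fun n r hr ↦ ((hkd n).mono (ball_subset_ball hr.le)).const_mul _
    refine ⟨fun z hz ↦ ?_, fun z hz ↦ ?_, fun z hz ↦ ?_⟩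
    · obtain ⟨r, hzr, hr, hb⟩ := key z hz
      exact Summable.of_norm_bounded (hsum.summable.mul_right _) fun n ↦ hb n z hzr
    · obtain ⟨r, hzr, hr, hb⟩ := key z hz
      exact ((Complex.differentiableOn_tsum_of_summable_norm (hsum.summable.mul_right _)
        (fun n ↦ hd n r hr) isOpen_ball hb).differentiableAt
          (isOpen_ball.mem_nhds hzr)).differentiableWithinAt
    · obtain ⟨r, hzr, hr, hb⟩ := key z hz
      refine (Complex.hasSum_deriv_of_summable_norm (hsum.summable.mul_right _)
        (fun n ↦ hd n r hr) isOpen_ball hb hzr).congr_fun fun n ↦ ?_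
      rw [(((hkd n).differentiableAt (isOpen_ball.mem_nhds hz)).hasDerivAt.const_mul _).deriv]
  obtain ⟨hs1, hd1, hD1⟩ := hseries h (fun n ↦ (H n).diff_h)
    fun r hr n z hz ↦ ((H n).norm_le_bound hr hz).1
  obtain ⟨hs2, hd2, hD2⟩ := hseries g (fun n ↦ (H n).diff_g)
    fun r hr n z hz ↦ ((H n).norm_le_bound hr hz).2
  have hsumf : ∀ z ∈ unitDisk, HasSum (fun n ↦ (t n : ℂ) * f n z)
      (∑' n, (t n : ℂ) * h n z + conj (∑' n, (t n : ℂ) * g n z)) := fun z hz ↦ by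
    refine ((hs1 z hz).hasSum.add (Complex.hasSum_conj'.2 (by simpa using (hs2 z hz).hasSum))).congr_fun
      fun n ↦ ?_
    rw [hfe n z hz, map_mul, Complex.conj_ofReal]
    ring
  refine ⟨fun z hz ↦ (hsumf z hz).summable, ?_⟩
  have hz0 := zero_mem_unitDisk
  refine IsRPair.mem_classRH0 (h := fun z ↦ ∑' n, (t n : ℂ) * h n z)
    (g := fun z ↦ ∑' n, (t n : ℂ) * g n z) ⟨hd1, hd2, ?_, ?_, ?_, ?_, fun z hz ↦ ?_⟩
    fun z hz ↦ (hsumf z hz).tsum_eq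
  · simp [(H _).h_zero]
  · simp [(H _).g_zero]
  · refine (hD1 0 hz0).unique ?_
    simp only [(H _).deriv_h_zero, mul_one]
    simpa using Complex.ofRealCLM.hasSum hsum
  · refine (hD2 0 hz0).unique ?_
    simp only [(H _).deriv_g_zero, mul_zero]
    exact hasSum_zero
  · refine forall_re_add_mul_nonneg_iff.1 fun ε hε ↦ ?_
    have h1 := Complex.reCLM.hasSum ((hD1 z hz).add ((hD2 z hz).mul_left ε))
    refine h1.nonneg fun n ↦ ?_
    have e : (t n : ℂ) * deriv (h n) z + ε * ((t n : ℂ) * deriv (g n) z)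
        = (t n : ℂ) * (deriv (h n) z + ε * deriv (g n) z) := by ring
    rw [e, Complex.reCLM_apply, Complex.re_ofReal_mul]
    exact mul_nonneg (ht n) ((H n).re_nonneg hε z hz)

end HarmonicMappings

theorem theorem3p3 :
    -- `𝓡_H⁰` is the harmonic analogue of `𝓡`, and its members are stable close-to-convex
    IsHarmonicAnalogue classR classRH0 ∧
    classRH0 ⊆ classSCH0 ∧
    -- the function `-z - 2 log (1 - z)` for which the bounds are sharp is in the class
    extremalFun ∈ classRH0 ∧
    -- (i) coefficient bounds, with equality for the extremal function
    (∀ f ∈ classRH0, ∀ h g : ℂ → ℂ, IsCanonicalDecomp f h g → ∀ n : ℕ, 2 ≤ n →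
      |‖taylorCoeff h n‖ - ‖taylorCoeff g n‖| ≤ 2 / (n : ℝ)) ∧
    (∀ h g : ℂ → ℂ, IsCanonicalDecomp extremalFun h g → ∀ n : ℕ, 2 ≤ n →
      |‖taylorCoeff h n‖ - ‖taylorCoeff g n‖| = 2 / (n : ℝ)) ∧
    -- (ii) growth and covering, sharp for the extremal function
    (∀ f ∈ classRH0, ∀ z ∈ unitDisk,
      -‖z‖ + 2 * Real.log (1 + ‖z‖) ≤ ‖f z‖ ∧ ‖f z‖ ≤ -‖z‖ - 2 * Real.log (1 - ‖z‖)) ∧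
    (∀ f ∈ classRH0, Metric.ball (0 : ℂ) (2 * Real.log 2 - 1) ⊆ f '' unitDisk) ∧
    (∀ r : ℝ, 0 ≤ r → r < 1 →
      (∃ z : ℂ, ‖z‖ = r ∧ ‖extremalFun z‖ = -r + 2 * Real.log (1 + r)) ∧
      (∃ z : ℂ, ‖z‖ = r ∧ ‖extremalFun z‖ = -r - 2 * Real.log (1 - r))) ∧
    (∀ ρ : ℝ, 2 * Real.log 2 - 1 < ρ →
      ¬ Metric.ball (0 : ℂ) ρ ⊆ extremalFun '' unitDisk) ∧
    -- (iii) compactness for locally uniform convergence (the compact-open topology on `C(𝔻, ℂ)`)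
    IsCompact {F : C(unitDisk, ℂ) | ∃ f ∈ classRH0, ∀ z : unitDisk, F z = f z} ∧
    -- (iv) radii of convexity and of close-to-convexity
    IsRadiusOfConvexity classRH0 (Real.sqrt 2 - 1) ∧
    IsRadiusOfCloseToConvexity classRH0 1 ∧
    -- (v) convolution properties
    (∀ φ ∈ classK, ∀ f ∈ classRH0, ∀ h g : ℂ → ℂ, IsCanonicalDecomp f h g →
      harmonicHadamard h g φ ∈ classRH0) ∧
    (∀ φ ∈ classA, (∀ z ∈ unitDisk, z ≠ 0 → 1 / 2 < (φ z / z).re) →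
      ∀ f ∈ classRH0, ∀ h g : ℂ → ℂ, IsCanonicalDecomp f h g →
        harmonicHadamard h g φ ∈ classRH0) ∧
    -- (vi) closure under (countable) convex combinations
    (∀ (t : ℕ → ℝ) (f : ℕ → ℂ → ℂ), (∀ n, 0 ≤ t n) → HasSum t 1 → (∀ n, f n ∈ classRH0) →
      (∀ z ∈ unitDisk, Summable fun n ↦ (t n : ℂ) * f n z) ∧
      (fun z ↦ ∑' n, (t n : ℂ) * f n z) ∈ classRH0) := by

  refine ⟨isHarmonicAnalogue_classR, classRH0_subset_classSCH0, extremalFun_mem, ?_,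
    fun h g hD n hn ↦ taylorCoeff_extremal hD hn, ?_, ?_, fun r h0 h1 ↦ extremalFun_sharp h0 h1,
    fun ρ hρ ↦ extremalFun_not_ball_subset hρ, isCompact_classRH0, isRadiusOfConvexity_classRH0,
    isRadiusOfCloseToConvexity_classRH0, ?_, ?_,
    fun t f ht hs hf ↦ summable_and_tsum_mem_classRH0 ht hs hf⟩
  · exact fun f hf h g hD n hn ↦ (hD.isRPair hf).abs_norm_taylorCoeff_sub_le hn
  · intro f hf z hz
    obtain ⟨h, g, H, hfe⟩ := exists_isRPair hf
    exact ⟨H.lower_growth hfe hz, H.upper_growth hfe hz⟩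
  · intro f hf
    obtain ⟨h, g, H, hfe⟩ := exists_isRPair hf
    exact H.ball_subset_image hfe
  · exact fun φ hφ f hf h g hD ↦ (hD.isRPair hf).harmonicHadamard_mem hφ.1.1
      fun z hz hz0 ↦ half_lt_re_div hφ hz hz0
  · exact fun φ hφ hre f hf h g hD ↦ (hD.isRPair hf).harmonicHadamard_mem hφ hre
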